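/- **Setting.** Let $d\ge 1$, $v_1,v_2\in\mathbb R^d$, $\Gamma_i,W_i\in\mathbb R^{d\times d}$ and $h_i(\theta,w)=v_i-\Gamma_i\theta-W_iw$ ($i=1,2$). Assume that $W_2$ and $X_1=\Gamma_1-W_1W_2^{-1}\Gamma_2$ are positive definite (not necessarily symmetric), and put $\theta^*=X_1^{-1}(v_1-W_1W_2^{-1}v_2)$, $w^*=W_2^{-1}(v_2-\Gamma_2\theta^*)$. Let $1>\alpha>\beta>0$, $\alpha_n=(n+1)^{-\alpha}$, $\beta_n=(n+1)^{-\beta}$, $p>1$, $\delta\in(0,1)$, $m_1,m_2>0$, and let $R_\theta>\|\theta^*\|$, $R_w>\|w^*\|$. For $R>0$ let $\Pi_R(x)=\min\{1,R/\|x\|\}\,x$, and let $\Pi_{n,R}=\Pi_R$ if $n=k^k-1$ for some integer $k\ge1$, and $\Pi_{n,R}=\mathrm{id}$ otherwise. Consider, from arbitrary $\theta'_0,w'_0$, $$\theta'_{n+1}=\Pi_{n+1,R_\theta}\big(\theta'_n+\alpha_n[h_1(\theta'_n,w'_n)+M^{(1)}_{n+1}]\big),\qquad w'_{n+1}=\Pi_{n+1,R_w}\big(w'_n+\beta_n[h_2(\theta'_n,w'_n)+M^{(2)}_{n+1}]\big),$$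 where $M^{(1)},M^{(2)}$ are martingale difference sequences with respect to $\mathcal F_n=\sigma(\theta'_0,w'_0,M^{(1)}_1,M^{(2)}_1,\dots,M^{(1)}_n,M^{(2)}_n)$ and $\|M^{(i)}_{n+1}\|\le m_i(1+\|\theta'_n\|+\|w'_n\|)$ a.s. for $i=1,2$, $n\ge0$. **Theorem.** With probability larger than $1-\delta$, for all $n\ge N$, $$\|\theta'_n-\theta^*\|\le C_\theta\frac{\sqrt{\ln(4d^2(n+1)^p/\delta)}}{(n+1)^{\alpha/2}}\quad\text{and}\quad \|w'_n-w^*\|\le C_w\frac{\sqrt{\ln(4d^2(n+1)^p/\delta)}}{(n+1)^{\beta/2}},$$ where $C_\theta=A_5'/\nu(N,\alpha)$, $C_w=A_4'/\nu(N,\beta)$, $\nu(n,\gamma)=(n+1)^{-\gamma/2}\sqrt{\ln(4d^2(n+1)^p/\delta)}$, $N=\min\{n\ge N': n=k^k-1\text{ for some integer }k\geq 1\}$, and the constants $N',A_4',A_5'$, which depend only on $d,p,\delta,\alpha,\beta,m_1,m_2,R_\theta,R_w$ and the $v_i,\Gamma_i,W_i$, are as follows. *Basic constants.* Matrix norms are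 spectral norms. $r_\theta=R_\theta+\|\theta^*\|$, $r_w=R_w+\|w^*\|$, $s_\theta=R_\theta-\|\theta^*\|$, $s_w=R_w-\|w^*\|$; $q_1=\lambda_{\min}(X_1+X_1^\top)/4$, $q_2=\lambda_{\min}(W_2+W_2^\top)/4$, $q_{\min}=\min\{q_1,q_2\}$. For $\gamma\in(0,1)$, $q>0$ let $E_{\gamma,q}(n)=\exp(-q\sum_{k=1}^{n-1}(k+1)^{-\gamma})$, let $K(\gamma,q)$ be the least $K\ge1$ with $E_{\gamma,q}(n)\le n^{-\gamma}$ for all $n\ge K$, and $C(\gamma,q)=\max_{1\le i\le K(\gamma,q)}i^\gamma E_{\gamma,q}(i)$. For $(\gamma,A,q)\in\{(\alpha,X_1,q_1),(\beta,W_2,q_2)\}$ let $\rho=\frac{\lambda_{\min}(A+A^\top)-2q}{\lambda_{\max}(A^\top A)}$, let $K^{\rm eig}_\gamma$ be the least $K$ with $(n+1)^{-\gamma}\le\rho$ for all $n\ge K$, and $$D_\gamma=\max\Big\{1,\Big(\max_{0\le\ell_1\le\ell_2\le\lceil\rho^{-1/\gamma}\rceil}\prod_{\ell=\ell_1}^{\ell_2}e^{(\ell+1)^{-\gamma}(-\lambda_{\min}(A+A^\top)+\lambda_{\max}(A^\top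 A)+2q)}\Big)^{1/2}\Big\}.$$ Write $D_\theta=D_\alpha$, $D_w=D_\beta$. Put $C_R^\theta=3$, $C_R^w=\frac32+\frac{e^{q_2}}{q_2}\|\Gamma_2\|D_wC_R^\theta\frac{r_\theta}{r_w}$, $B=1+C_R^\theta r_\theta+C_R^wr_w+\|\theta^*\|+\|w^*\|$, $L_\theta=2\,[D_\theta(m_1+m_2\|W_1\|\|W_2^{-1}\|)B]^2$, $L_w=2\,[D_wm_2B]^2$, $c_\theta=C(\alpha,q_1)e^{q_1}/q_1$, $c_w=C(\beta,q_2)e^{q_2}/q_2$, $V_\theta=d^3L_\theta c_\theta$, $V_w=d^3L_wc_w$, $C_T=\|X_1\|+2(\alpha-\beta)(1+\|X_1\|)$, $C_a=D_\theta\max\{\|W_1W_2^{-1}\|,1\}$, $C_b=\|W_1W_2^{-1}\|\big(1+\frac{2e^{q_1/2}}{q_1}C_TD_\theta\big)$, $\ell^*=\lceil\frac{\beta}{2(\alpha-\beta)}\rceil$, $A_2=e^{q_1+2(\alpha-\beta)}D_w\|\Gamma_2\|C_b\frac{2e^{q_2/2}}{q_2}$, $S=\sum_{i=0}^{\ell^*-1}A_2^i$.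 *The constants $A_4',A_5'$.* $A_4'=A_{4,1}+1$ and $A_5'=4+2A_{5,1}+2C_bA_{4,1}$ with $A_{5,1}=C_a(C_R^\theta r_\theta+C_R^wr_w)$ and $$A_{4,1}=\Big(D_w\|\Gamma_2\|\Big[r_\theta+C_ae^{q_1}\tfrac{2e^{q_{\min}/2}}{q_{\min}}(r_\theta+r_w)\Big]+D_wr_w\Big)e\,S.$$ *The bound $N'$.* With $x_+=\max\{x,0\}$, $\kappa(\gamma,c)=c^{1/\gamma}\big[2\ln\big(2c(4d^2/\delta)^{\gamma/p}\big)\big]_+^{1/\gamma}$ and $$K_\alpha(z)=\max\Big\{\Big\lceil\Big(\tfrac{q_1}{2(\alpha-\beta+z)}\Big)^{1/\alpha}\Big\rceil,\Big\lceil\Big(\tfrac{4(\alpha-\beta+z)}{q_1}\Big)^{1/(1-\alpha)}\Big\rceil\Big\},\quad K_\beta(z)=\max\Big\{\Big\lceil\Big(\tfrac{q_2}{\alpha-\beta+z}\Big)^{1/\beta}\Big\rceil,\Big\lceil\Big(\tfrac{4(\alpha-\beta+z)}{q_2}\Big)^{1/(1-\beta)}\Big\rceil\Big\},$$ $N'$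 is the maximum of: (a) $K^{\rm eig}_\alpha$, $K^{\rm eig}_\beta$, $K_\alpha(0)$, $\kappa\big(\alpha,\frac{4V_\theta p}{\alpha r_\theta^2}\big)$, $\kappa\big(\beta,\frac{4V_wp}{\beta r_w^2}\big)$, $(p-1)^{-1/(p-1)}$, and $\big[\frac23\tilde C_\theta+\frac23\tilde C_w\frac{r_w}{r_\theta}\big]^{1/(\alpha-\beta)}$ with $\tilde C_\theta=\|W_1\|\|W_2^{-1}\|\frac{e^{q_2}}{q_2}C_R^\theta\|\Gamma_2\|D_w$ and $\tilde C_w=\|W_1\|\|W_2^{-1}\|\big[\frac52+\frac{2e^{q_1/2}}{q_1}C_TD_\theta C_R^w\big]$; (b) $1+\max\big\{K_\alpha(\beta/2),\,K_\beta(\beta/2),\,e^{1/\beta}\delta^{1/p}(4d^2)^{-1/p},\,2^{1/(\alpha-\beta)},\,(3\alpha/q_2)^{1/(1-\beta)}-2,\,\big(\frac{L_\theta c_\theta}{L_wc_w}\big)^{1/(\alpha-\beta)},\,\big(1+\frac{\alpha}{2q_{\min}}\big)^{1/(1-\alpha)}\big\}$; (c) $\kappa\big(\beta,\frac{p}{\beta}A_{4,0}^2\big)$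 and $\kappa\big(\alpha,\frac p\alpha\max\{C_bA_{4,0},A_{5,0}\}^2\big)$, where $A_{4,0}=\big(e+e^2D_w\|\Gamma_2\|\frac{2e^{q_2/2}}{q_2}\big)S\sqrt{V_w}+C_R^wr_wA_2^{\ell^*}$ and $A_{5,0}=\sqrt{4V_\theta}$; (d) $x^x$ with $x=(A_4'/s_w)^{2/\beta}$, $y^y$ with $y=(A_5'/s_\theta)^{2/\alpha}$, $e^{1/\beta}$ and $(2/\beta)^{2/\beta}$. -/

import Mathlib

open MeasureTheory Matrix
open scoped ProbabilityTheory

noncomputable section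

namespace TwoTimescale

/-- `ℝ^d` with its Euclidean norm. -/
abbrev E (d : ℕ) : Type := EuclideanSpace ℝ (Fin d)

/-- The matrix `A`, acting on Euclidean space. -/
abbrev act {d : ℕ} (A : Matrix (Fin d) (Fin d) ℝ) : E d →L[ℝ] E d :=
  Matrix.toEuclideanCLM (n := Fin d) (𝕜 := ℝ) A

/-- The spectral (Euclidean operator) norm of a matrix. -/
def opNorm {d : ℕ} (A : Matrix (Fin d) (Fin d) ℝ) : ℝ := ‖act A‖

/-- Positive definiteness, without symmetry. -/
def PosDefNS {d : ℕ} (A : Matrix (Fin d) (Fin d) ℝ) : Prop :=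
  ∀ x : Fin d → ℝ, x ≠ 0 → 0 < x ⬝ᵥ (A *ᵥ x)

/-- Smallest real eigenvalue (used for symmetric matrices only). -/
def lamMin {d : ℕ} (A : Matrix (Fin d) (Fin d) ℝ) : ℝ := sInf (spectrum ℝ A)

/-- Largest real eigenvalue (used for symmetric matrices only). -/
def lamMax {d : ℕ} (A : Matrix (Fin d) (Fin d) ℝ) : ℝ := sSup (spectrum ℝ A)

/-! ### The sparsely projected iteration and its noise -/

/-- Projection onto the closed ball of radius `R` around the origin. -/
def ballProj {d : ℕ} (R : ℝ) (x : E d) : E d := min 1 (R / ‖x‖) • x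

open Classical in
/-- Sparse projection: project iff `n = k ^ k - 1` for some positive integer `k`. -/
def sparseProj {d : ℕ} (n : ℕ) (R : ℝ) (x : E d) : E d :=
  if ∃ k : ℕ, 0 < k ∧ n + 1 = k ^ k then ballProj R x else x

/-- `σ(θ₀, w₀, M¹₁, M²₁, …, M¹ₙ, M²ₙ)`. -/
@[reducible] def noiseSigma {d : ℕ} {Ω : Type*} (θ₀ w₀ : Ω → E d) (M₁ M₂ : ℕ → Ω → E d) (n : ℕ) :
    MeasurableSpace Ω :=
  MeasurableSpace.comap θ₀ inferInstance ⊔ MeasurableSpace.comap w₀ inferInstance ⊔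
    ⨆ k ∈ Finset.Icc 1 n,
      (MeasurableSpace.comap (M₁ k) inferInstance ⊔ MeasurableSpace.comap (M₂ k) inferInstance)

/-- `M₁, M₂` (indexed from `1`) are `(θₙ, wₙ)`-dominated martingale differences with
parameters `m₁, m₂`. -/
structure DominatedMartingaleDiff {d : ℕ} {Ω : Type*} [MeasurableSpace Ω] (μ : Measure Ω)
    (θ w M₁ M₂ : ℕ → Ω → E d) (m₁ m₂ : ℝ) : Prop where
  measurable_θ₀ : Measurable (θ 0)
  measurable_w₀ : Measurable (w 0)
  measurable₁ : ∀ n, Measurable (M₁ (n + 1))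
  measurable₂ : ∀ n, Measurable (M₂ (n + 1))
  integrable₁ : ∀ n, Integrable (M₁ (n + 1)) μ
  integrable₂ : ∀ n, Integrable (M₂ (n + 1)) μ
  condExp₁ : ∀ n, μ[M₁ (n + 1) | noiseSigma (θ 0) (w 0) M₁ M₂ n] =ᵐ[μ] 0
  condExp₂ : ∀ n, μ[M₂ (n + 1) | noiseSigma (θ 0) (w 0) M₁ M₂ n] =ᵐ[μ] 0
  bound₁ : ∀ n, ∀ᵐ ω ∂μ, ‖M₁ (n + 1) ω‖ ≤ m₁ * (1 + ‖θ n ω‖ + ‖w n ω‖)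
  bound₂ : ∀ n, ∀ᵐ ω ∂μ, ‖M₂ (n + 1) ω‖ ≤ m₂ * (1 + ‖θ n ω‖ + ‖w n ω‖)

/-! ### Scalar building blocks of the constants -/

/-- The step `(n + 1) ^ (-γ)`. -/
def step (γ : ℝ) (n : ℕ) : ℝ := ((n : ℝ) + 1) ^ (-γ)

/-- `exp (-q ∑_{k=1}^{n-1} (k + 1) ^ (-γ))`. -/
def expDecay (γ q : ℝ) (n : ℕ) : ℝ :=
  Real.exp (-q * ∑ k ∈ Finset.Ico 1 n, ((k : ℝ) + 1) ^ (-γ))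

/-- The least `K ≥ 1` with `expDecay γ q n ≤ n ^ (-γ)` for all `n ≥ K`. -/
def KDecay (γ q : ℝ) : ℕ :=
  sInf {K : ℕ | 1 ≤ K ∧ ∀ n : ℕ, K ≤ n → expDecay γ q n ≤ (n : ℝ) ^ (-γ)}

/-- `max_{1 ≤ i ≤ K} i ^ γ * expDecay γ q i`, with `K = KDecay γ q`. -/
def CDecay (γ q : ℝ) : ℝ :=
  sSup ((fun i : ℕ => (i : ℝ) ^ γ * expDecay γ q i) '' Set.Icc 1 (KDecay γ q))

/-- `C(γ, q) e^q / q`. -/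
def CVar (γ q : ℝ) : ℝ := CDecay γ q * Real.exp q / q

/-- `q = λ_min(A + Aᵀ) / 4`. -/
def rate {d : ℕ} (A : Matrix (Fin d) (Fin d) ℝ) : ℝ := lamMin (A + Aᵀ) / 4

/-- The least `K` with
`(n + 1) ^ (-γ) ≤ (λ_min(A + Aᵀ) - 2 q) / λ_max(Aᵀ A)` for all `n ≥ K`. -/
def KEig {d : ℕ} (γ : ℝ) (A : Matrix (Fin d) (Fin d) ℝ) : ℕ :=
  sInf {K : ℕ | ∀ n : ℕ, K ≤ n →
    step γ n ≤ (lamMin (A + Aᵀ) - 2 * rate A) / lamMax (Aᵀ * A)}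

/-- `⌈(λ_max(Aᵀ A) / (λ_min(A + Aᵀ) - 2 q)) ^ (1 / γ)⌉`. -/
def KProd {d : ℕ} (γ : ℝ) (A : Matrix (Fin d) (Fin d) ℝ) : ℕ :=
  ⌈(lamMax (Aᵀ * A) / (lamMin (A + Aᵀ) - 2 * rate A)) ^ (1 / γ)⌉₊

/-- `max {1, √(max_{ℓ₁ ≤ ℓ₂ ≤ K} ∏_{ℓ₁ ≤ ℓ ≤ ℓ₂} exp ((ℓ + 1) ^ (-γ) (μ + 2 q)))}` with
`μ = -λ_min(A + Aᵀ) + λ_max(Aᵀ A)` and `K = KProd γ A`. -/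
def CProd {d : ℕ} (γ : ℝ) (A : Matrix (Fin d) (Fin d) ℝ) : ℝ :=
  max 1 (Real.sqrt (sSup {x : ℝ | ∃ l₁ l₂ : ℕ, l₁ ≤ l₂ ∧ l₂ ≤ KProd γ A ∧
    x = ∏ l ∈ Finset.Icc l₁ l₂,
      Real.exp (step γ l * (-lamMin (A + Aᵀ) + lamMax (Aᵀ * A) + 2 * rate A))}))

/-- `C ^ (1/γ) * [2 ln (2 C a ^ (γ/p))]₊ ^ (1/γ)`. -/
def KLog (γ p a C : ℝ) : ℝ :=
  C ^ (1 / γ) * (max 0 (2 * Real.log (2 * C * a ^ (γ / p)))) ^ (1 / γ)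

/-- `x ^ x` with `x = y ^ (2 / γ)`. -/
def KSelf (γ y : ℝ) : ℝ := (y ^ (2 / γ)) ^ (y ^ (2 / γ))

/-- While the iterates stay bounded, `‖θ - θ*‖` is at most `CRθ` times its bound right after a
projection. -/
def CRθ : ℝ := 3

/-! ### The problem data -/

/-- The data of a linear two-timescale problem: drift `hᵢ(θ, w) = vᵢ - Γᵢ θ - Wᵢ w`, stepsize
exponents, `p`, confidence `δ`, noise parameters and projection radii. No condition is imposed
on them here. -/
structure Problem (d : ℕ) where
  v₁ : E d
  v₂ : E d
  Γ₁ : Matrix (Fin d) (Fin d) ℝ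
  Γ₂ : Matrix (Fin d) (Fin d) ℝ
  W₁ : Matrix (Fin d) (Fin d) ℝ
  W₂ : Matrix (Fin d) (Fin d) ℝ
  α : ℝ
  β : ℝ
  p : ℝ
  δ : ℝ
  m₁ : ℝ
  m₂ : ℝ
  Rθ : ℝ
  Rw : ℝ

namespace Problem

variable {d : ℕ} (P : Problem d)

/-- `h₁(θ, w)`. -/
def h₁ (θ w : E d) : E d := P.v₁ - act P.Γ₁ θ - act P.W₁ w

/-- `h₂(θ, w)`. -/
def h₂ (θ w : E d) : E d := P.v₂ - act P.Γ₂ θ - act P.W₂ w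

/-- `X₁ = Γ₁ - W₁ W₂⁻¹ Γ₂`. -/
def X₁ : Matrix (Fin d) (Fin d) ℝ := P.Γ₁ - P.W₁ * P.W₂⁻¹ * P.Γ₂

/-- `b₁ = v₁ - W₁ W₂⁻¹ v₂`. -/
def b₁ : E d := P.v₁ - act (P.W₁ * P.W₂⁻¹) P.v₂

/-- `θ* = X₁⁻¹ b₁`. -/
def θstar : E d := act P.X₁⁻¹ P.b₁

/-- `w* = W₂⁻¹ (v₂ - Γ₂ θ*)`. -/
def wstar : E d := act P.W₂⁻¹ (P.v₂ - act P.Γ₂ P.θstar)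

/-! ### The constants -/

/-- `ν(n; γ) = (n + 1) ^ (-γ / 2) √(ln (4 d² (n + 1) ^ p / δ))`. -/
def ν (n : ℕ) (γ : ℝ) : ℝ :=
  ((n : ℝ) + 1) ^ (-γ / 2) * Real.sqrt (Real.log (4 * (d : ℝ) ^ 2 * ((n : ℝ) + 1) ^ P.p / P.δ))

/-- Bound on `‖θ - θ*‖` right after a projection. -/
def rθ : ℝ := P.Rθ + ‖P.θstar‖

/-- Bound on `‖w - w*‖` right after a projection. -/
def rw : ℝ := P.Rw + ‖P.wstar‖

/-- Radius of a ball around `θ*` inside the projection ball. -/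
def sθ : ℝ := P.Rθ - ‖P.θstar‖

/-- Radius of a ball around `w*` inside the projection ball. -/
def sw : ℝ := P.Rw - ‖P.wstar‖

def q₁ : ℝ := rate P.X₁
def q₂ : ℝ := rate P.W₂
def qmin : ℝ := min P.q₁ P.q₂

/-- `Cθ` with `∏ ‖I - α_k X₁‖ ≤ Cθ exp (-q₁ ∑ α_k)`. -/
def Dθ : ℝ := CProd P.α P.X₁

/-- `C_w` with `∏ ‖I - β_k W₂‖ ≤ C_w exp (-q₂ ∑ β_k)`. -/
def Dw : ℝ := CProd P.β P.W₂

/-- The analogue of `CRθ` for `w`. -/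
def CRw : ℝ :=
  3 / 2 + Real.exp P.q₂ / P.q₂ * opNorm P.Γ₂ * P.Dw * CRθ * (P.rθ / P.rw)

/-- Bound on `1 + ‖θ‖ + ‖w‖` while the iterates stay bounded. -/
def B : ℝ := 1 + CRθ * P.rθ + P.CRw * P.rw + ‖P.θstar‖ + ‖P.wstar‖

def Lθ : ℝ := 2 * (P.Dθ * (P.m₁ + P.m₂ * opNorm P.W₁ * opNorm P.W₂⁻¹) * P.B) ^ 2
def Lw : ℝ := 2 * (P.Dw * P.m₂ * P.B) ^ 2

/-- `d³ Lθ C(α, q₁) e^{q₁} / q₁`. -/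
def Vθ : ℝ := (d : ℝ) ^ 3 * P.Lθ * CVar P.α P.q₁

/-- `d³ L_w C(β, q₂) e^{q₂} / q₂`. -/
def Vw : ℝ := (d : ℝ) ^ 3 * P.Lw * CVar P.β P.q₂

def CT : ℝ := opNorm P.X₁ + 2 * (P.α - P.β) * (1 + opNorm P.X₁)

def Ca : ℝ := P.Dθ * max (opNorm (P.W₁ * P.W₂⁻¹)) 1
def Cb : ℝ :=
  opNorm (P.W₁ * P.W₂⁻¹) * (1 + 2 * Real.exp (P.q₁ / 2) / P.q₁ * P.CT * P.Dθ)
def CInt : ℝ := 2 * Real.exp (P.q₂ / 2) / P.q₂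

def ellStar : ℕ := ⌈P.β / (2 * (P.α - P.β))⌉₊

def A₁'' : ℝ := P.Dw * opNorm P.Γ₂ * P.CInt
def A₂ : ℝ :=
  Real.exp (P.q₁ + 2 * (P.α - P.β)) * P.Dw * opNorm P.Γ₂ * P.Cb *
    (2 * Real.exp (P.q₂ / 2) / P.q₂)
def A₃ : ℝ := P.CRw * P.rw

/-- `∑_{i < ℓ*} A₂ ^ i`. -/
def SA : ℝ := ∑ i ∈ Finset.range P.ellStar, P.A₂ ^ i

def A₄C₁ : ℝ :=
  (P.Dw * opNorm P.Γ₂ *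
      (P.rθ + P.Ca * Real.exp P.q₁ * (2 * Real.exp (P.qmin / 2) / P.qmin) * (P.rθ + P.rw)) +
    P.Dw * P.rw) * Real.exp 1 * P.SA
def A₅C₁ : ℝ := P.Ca * (CRθ * P.rθ + P.CRw * P.rw)
def A₄C₀ : ℝ :=
  (Real.exp 1 + Real.exp 2 * P.A₁'') * (P.SA * Real.sqrt P.Vw) + P.A₃ * P.A₂ ^ P.ellStar
def A₅C₀ : ℝ := Real.sqrt (4 * P.Vθ)

def A₄' : ℝ := P.A₄C₁ + 1
def A₅' : ℝ := 4 + 2 * P.A₅C₁ + 2 * P.Cb * P.A₄C₁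

/-! ### The lower bounds on the index -/

/-- `K_α(z)`, ensuring `α`-moderateness. -/
def KModα (z : ℝ) : ℕ :=
  max ⌈(P.q₁ / (2 * (P.α - P.β + z))) ^ (1 / P.α)⌉₊
    ⌈(4 * (P.α - P.β + z) / P.q₁) ^ (1 / (1 - P.α))⌉₊

/-- `K_β(z)`, ensuring `β`-moderateness. -/
def KModβ (z : ℝ) : ℕ :=
  max ⌈(P.q₂ / (P.α - P.β + z)) ^ (1 / P.β)⌉₊
    ⌈(4 * (P.α - P.β + z) / P.q₂) ^ (1 / (1 - P.β))⌉₊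

/-- `4 d² / δ`. -/
def a : ℝ := 4 * (d : ℝ) ^ 2 / P.δ

def KEpsα : ℝ := KLog P.α P.p P.a (4 * P.Vθ * P.p / (P.α * P.rθ ^ 2))
def KEpsβ : ℝ := KLog P.β P.p P.a (4 * P.Vw * P.p / (P.β * P.rw ^ 2))

def CLargeθ : ℝ :=
  opNorm P.W₁ * opNorm P.W₂⁻¹ * (Real.exp P.q₂ / P.q₂) * CRθ * opNorm P.Γ₂ * P.Dw
def CLargew : ℝ :=
  opNorm P.W₁ * opNorm P.W₂⁻¹ *
    (5 / 2 + 2 * Real.exp (P.q₁ / 2) / P.q₁ * P.CT * P.Dθ * P.CRw)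
def KLarge : ℝ :=
  (2 / 3 * P.CLargeθ + 2 / 3 * P.CLargew * (P.rw / P.rθ)) ^ (1 / (P.α - P.β))

def KInta : ℝ := 2 ^ (1 / (P.α - P.β))
def KIntb : ℝ := (3 * P.α / P.q₂) ^ (1 / (1 - P.β)) - 2

def KDoma : ℝ := (P.Lθ * CVar P.α P.q₁ / (P.Lw * CVar P.β P.q₂)) ^ (1 / (P.α - P.β))
def KDomb : ℝ := (1 + P.α / (2 * P.qmin)) ^ (1 / (1 - P.α))

/-- Threshold for the iterates to remain bounded with high probability. -/
def NBdd : ℝ :=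
  max (KEig P.α P.X₁ : ℝ) <| max (KEig P.β P.W₂ : ℝ) <| max (P.KModα 0 : ℝ) <|
    max P.KEpsα <| max P.KEpsβ <| max P.KLarge ((P.p - 1) ^ (-1 / (P.p - 1)))

/-- Threshold for the convergence rates on the event that the iterates remain bounded. -/
def NRate : ℝ :=
  (max (P.KModα (P.β / 2) : ℝ) <| max (P.KModβ (P.β / 2) : ℝ) <|
    max (Real.exp (1 / P.β) * P.δ ^ (1 / P.p) / (4 * (d : ℝ) ^ 2) ^ (1 / P.p)) <|
    max P.KInta <| max P.KIntb <| max P.KDoma P.KDomb) + 1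

def KAa : ℝ := KLog P.β P.p P.a (P.p * P.A₄C₀ ^ 2 / P.β)
def KAb : ℝ := KLog P.α P.p P.a (P.p * (max (P.Cb * P.A₄C₀) P.A₅C₀) ^ 2 / P.α)

def Kw : ℝ := KSelf P.β (P.A₄' / P.sw)
def Kθ : ℝ := KSelf P.α (P.A₅' / P.sθ)

def N' : ℝ :=
  max P.NBdd <| max P.NRate <| max P.KAa <| max P.KAb <| max P.Kw <| max P.Kθ <|
    max (Real.exp (1 / P.β)) ((2 / P.β) ^ (2 / P.β))

/-- The least index `n ≥ N'` of the form `k ^ k - 1`. -/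
def N : ℕ := sInf {n : ℕ | P.N' ≤ (n : ℝ) ∧ ∃ k : ℕ, 0 < k ∧ n + 1 = k ^ k}

/-- The constant of the `θ` rate. -/
def Cθ : ℝ := P.A₅' / P.ν P.N P.α

/-- The constant of the `w` rate. -/
def Cw : ℝ := P.A₄' / P.ν P.N P.β

end Problem

end TwoTimescale

end

noncomputable section

namespace TwoTimescale

/-! ### Spectral bounds for matrices -/

section Matrices

variable {d : ℕ}

/-! Write t = θ' - θ*, v = w' - w* and Y = W₁W₂⁻¹. The drift of t contains -W₁v, and v decays only
at the rate of the other timescale. Passing to b = t - κₙYv, with κₙ₊₁ = αₙ/βₙ, removes this term: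
it cancels against Y applied to -W₂v, Γ₁ turns into X₁, and the coupling that remains is of order
αₙκₙ‖Yv‖ (`θ_recursion`, `norm_coupling_le`). So b is propagated by I - αₙX₁, and v by I - βₙW₂ with
forcing -βₙΓ₂t. From N on the steps are so small that each of these maps is by itself a contraction,
with factor 1 - q₁αₙ or 1 - q₂βₙ (`norm_id_sub_smul_act_le`); no products of matrices have to be
estimated.

The noise is split off by linearity. Two linear recursions with the same matrices, zero at N and
driven only by martingale differences, carry it. Their driving noise is switched off once the
iterates have left fixed balls around (θ*, w*); this is decided by the past, so conditional means
stay zero while the noise becomes bounded. A sub-Gaussian bound on the moment generating function,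
with variance proxy proportional to the current step size, passes through the recursion
(`integral_exp_inner_recursion_le`). The noise at time n then exceeds its rate with probability at
most δ(n+1)^(-p), and the sum of these over n > N is below δ.

Outside this exceptional event the argument is deterministic. By induction, `Inv` holds for the
noiseless parts of v and b. Its absolute bounds keep the iterates in the balls, so the noise is
never switched off. Its rate bounds are multiples of `gw` and `gκ`, which decay more slowly than the
contractions allow (`gw_succ`, `gκ_succ`). The feedback from v to t and back to v carries the small
factor κ at N, so the constants close up (`Γ₂_mul_le`).

Projection is needed once, at N, to bound the starting point. If N + 1 = k^k, then by any later
projection time ν has dropped by a factor of at least k^(γ/2), so the iterates already lie inside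
the projection balls and nothing is changed (`mul_ν_le_of_projection`). The constants of the
statement are larger than those that this argument produces; a group of lemmas only checks this
domination. -/

lemma act_add (A B : Matrix (Fin d) (Fin d) ℝ) : act (A + B) = act A + act B :=
  map_add (Matrix.toEuclideanCLM (n := Fin d) (𝕜 := ℝ)) A B

lemma act_neg (A : Matrix (Fin d) (Fin d) ℝ) : act (-A) = -act A :=
  map_neg (Matrix.toEuclideanCLM (n := Fin d) (𝕜 := ℝ)) A

lemma act_sub (A B : Matrix (Fin d) (Fin d) ℝ) : act (A - B) = act A - act B :=
  map_sub (Matrix.toEuclideanCLM (n := Fin d) (𝕜 := ℝ)) A B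

lemma act_mul (A B : Matrix (Fin d) (Fin d) ℝ) : act (A * B) = act A * act B :=
  map_mul (Matrix.toEuclideanCLM (n := Fin d) (𝕜 := ℝ)) A B

lemma act_smul_one (c : ℝ) : act (c • (1 : Matrix (Fin d) (Fin d) ℝ)) = c • 1 := by
  rw [← map_one (Matrix.toEuclideanCLM (n := Fin d) (𝕜 := ℝ))]
  exact map_smul (Matrix.toEuclideanCLM (n := Fin d) (𝕜 := ℝ)) c 1

lemma act_one : act (1 : Matrix (Fin d) (Fin d) ℝ) = 1 :=
  map_one (Matrix.toEuclideanCLM (n := Fin d) (𝕜 := ℝ))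

/-- Subtracting `lamMin A` times the identity shifts the spectrum into the nonnegative reals, so the
difference is positive semidefinite. -/
lemma lamMin_mul_sq_norm_le {A : Matrix (Fin d) (Fin d) ℝ} (hA : A.IsHermitian) (x : E d) :
    lamMin A * ‖x‖ ^ 2 ≤ inner ℝ x (act A x) := by
  have hps : (A - lamMin A • (1 : Matrix (Fin d) (Fin d) ℝ)).PosSemidef := by
    rw [Matrix.posSemidef_iff_isHermitian_and_spectrum_nonneg]
    refine ⟨hA.sub (by simp [Matrix.IsHermitian]), fun μ hμ => ?_⟩
    rw [← Algebra.algebraMap_eq_smul_one, sub_eq_neg_add, ← spectrum.add_mem_iff] at hμ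
    have hb : BddBelow (spectrum ℝ A) := by
      rw [hA.spectrum_real_eq_range_eigenvalues]
      exact (Set.finite_range _).bddBelow
    have h := csInf_le hb hμ
    have h' : lamMin A ≤ μ + lamMin A := h
    change 0 ≤ μ
    linarith
  have h := hps.dotProduct_mulVec_nonneg (WithLp.ofLp x)
  have e : inner ℝ x (act A x) - lamMin A * ‖x‖ ^ 2 =
      inner ℝ x (act (A - lamMin A • (1 : Matrix (Fin d) (Fin d) ℝ)) x) := by
    rw [act_sub, act_smul_one, _root_.sub_apply, inner_sub_right]
    simp [real_inner_smul_right]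
  rw [Matrix.inner_toEuclideanCLM, Matrix.inner_toEuclideanCLM] at e
  rw [Matrix.inner_toEuclideanCLM]
  simp only [star_trivial] at h
  linarith

lemma inner_le_lamMax_mul_sq_norm {A : Matrix (Fin d) (Fin d) ℝ} (hA : A.IsHermitian) (x : E d) :
    inner ℝ x (act A x) ≤ lamMax A * ‖x‖ ^ 2 := by
  have h := lamMin_mul_sq_norm_le hA.neg x
  have e : lamMin (-A) = -lamMax A := by
    rw [lamMin, lamMax, ← spectrum.neg_eq, Real.sInf_neg]
  rw [e, act_neg, _root_.neg_apply, inner_neg_right] at h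
  linarith

lemma inner_act_transpose (A : Matrix (Fin d) (Fin d) ℝ) (x y : E d) :
    inner ℝ x (act Aᵀ y) = inner ℝ (act A x) y := by
  rw [Matrix.inner_toEuclideanCLM, real_inner_comm, Matrix.inner_toEuclideanCLM,
    Matrix.dotProduct_mulVec, Matrix.vecMul_transpose, dotProduct_comm]

lemma lamMin_sym_mul_sq_norm_le (A : Matrix (Fin d) (Fin d) ℝ) (x : E d) :
    lamMin (A + Aᵀ) * ‖x‖ ^ 2 ≤ 2 * inner ℝ x (act A x) := by
  have hA : (A + Aᵀ).IsHermitian := by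
    rw [Matrix.IsHermitian, Matrix.conjTranspose_eq_transpose_of_trivial, Matrix.transpose_add,
      Matrix.transpose_transpose, add_comm]
  have h := lamMin_mul_sq_norm_le hA x
  rw [act_add, _root_.add_apply, inner_add_right, inner_act_transpose,
    real_inner_comm] at h
  rw [real_inner_comm x (act A x)] at *
  linarith

lemma sq_norm_act_le (A : Matrix (Fin d) (Fin d) ℝ) (x : E d) :
    ‖act A x‖ ^ 2 ≤ lamMax (Aᵀ * A) * ‖x‖ ^ 2 := by
  have hA : (Aᵀ * A).IsHermitian := by
    have := Matrix.isHermitian_conjTranspose_mul_self A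
    rwa [Matrix.conjTranspose_eq_transpose_of_trivial] at this
  have h := inner_le_lamMax_mul_sq_norm hA x
  rwa [act_mul, mul_apply_eq_comp, inner_act_transpose,
    real_inner_self_eq_norm_sq] at h

lemma PosDefNS.rate_pos (hd : 0 < d) {A : Matrix (Fin d) (Fin d) ℝ} (hA : PosDefNS A) :
    0 < rate A := by
  have hh : (A + Aᵀ).IsHermitian := by
    rw [Matrix.IsHermitian, Matrix.conjTranspose_eq_transpose_of_trivial, Matrix.transpose_add,
      Matrix.transpose_transpose, add_comm]
  have hp : (A + Aᵀ).PosDef := by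
    refine Matrix.PosDef.of_dotProduct_mulVec_pos hh fun x hx => ?_
    have := hA x hx
    rw [star_trivial, Matrix.add_mulVec, dotProduct_add, Matrix.dotProduct_mulVec x Aᵀ,
      Matrix.vecMul_transpose, dotProduct_comm _ x]
    linarith
  have : Nonempty (Fin d) := ⟨⟨0, hd⟩⟩
  have hm : lamMin (A + Aᵀ) ∈ Set.range hh.eigenvalues := by
    rw [lamMin, hh.spectrum_real_eq_range_eigenvalues]
    exact (Set.range_nonempty _).csInf_mem (Set.finite_range _)
  obtain ⟨i, hi⟩ := hm
  have := hp.eigenvalues_pos i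
  rw [rate]
  linarith

lemma PosDefNS.isUnit_det {A : Matrix (Fin d) (Fin d) ℝ} (hA : PosDefNS A) : IsUnit A.det := by
  rw [isUnit_iff_ne_zero]
  intro h
  obtain ⟨x, hx, hx'⟩ := Matrix.exists_mulVec_eq_zero_iff.2 h
  have := hA x hx
  rw [hx', dotProduct_zero] at this
  exact lt_irrefl _ this

/-- On a unit vector, 2q ≤ ⟨x, Ax⟩ ≤ ‖Ax‖. This forces every admissible step to satisfy qs ≤ 1/2, so
that the contraction factors are positive. -/
lemma four_mul_sq_rate_le (hd : 0 < d) {A : Matrix (Fin d) (Fin d) ℝ} (hA : PosDefNS A) :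
    4 * rate A ^ 2 ≤ lamMax (Aᵀ * A) := by
  have hq := hA.rate_pos hd
  have : Nontrivial (E d) := by
    have : Nonempty (Fin d) := ⟨⟨0, hd⟩⟩
    infer_instance
  obtain ⟨x, hx⟩ := exists_norm_eq (E d) zero_le_one
  have h1 := lamMin_sym_mul_sq_norm_le A x
  have h2 := sq_norm_act_le A x
  have h3 := real_inner_le_norm x (act A x)
  rw [hx] at *
  have : 2 * rate A ≤ ‖act A x‖ := by
    rw [rate]
    linarith
  nlinarith

/-- Expand the square: the inner product contributes -4qs, and the restriction on s makes the
quadratic term at most 2qs, which leaves 1 - 2qs ≤ (1 - qs)². -/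
lemma norm_id_sub_smul_act_le (hd : 0 < d) {A : Matrix (Fin d) (Fin d) ℝ} (hA : PosDefNS A)
    {s : ℝ} (hs : 0 ≤ s) (h : s ≤ (lamMin (A + Aᵀ) - 2 * rate A) / lamMax (Aᵀ * A)) :
    rate A * s ≤ 1 / 2 ∧ ∀ x : E d, ‖x - s • act A x‖ ≤ (1 - rate A * s) * ‖x‖ := by
  have hq := hA.rate_pos hd
  have h4 := four_mul_sq_rate_le hd hA
  have hl : 0 < lamMax (Aᵀ * A) := by nlinarith
  have e : lamMin (A + Aᵀ) = 4 * rate A := by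
    rw [rate]; ring
  rw [le_div_iff₀ hl, e] at h
  have hqs : rate A * s ≤ 1 / 2 := by
    by_contra hc
    push Not at hc
    nlinarith
  refine ⟨hqs, fun x => ?_⟩
  have h1 := lamMin_sym_mul_sq_norm_le A x
  have h2 := sq_norm_act_le A x
  refine abs_le_of_sq_le_sq' ?_ (mul_nonneg (by linarith) (norm_nonneg x)) |>.2
  rw [norm_sub_sq_real, real_inner_smul_right, norm_smul, mul_pow, Real.norm_eq_abs, sq_abs]
  rw [e] at h1
  have h5 : s ^ 2 * ‖act A x‖ ^ 2 ≤ 2 * rate A * s * ‖x‖ ^ 2 := by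
    calc s ^ 2 * ‖act A x‖ ^ 2 ≤ s ^ 2 * (lamMax (Aᵀ * A) * ‖x‖ ^ 2) := by gcongr
      _ = s * (s * lamMax (Aᵀ * A)) * ‖x‖ ^ 2 := by ring
      _ ≤ s * (4 * rate A - 2 * rate A) * ‖x‖ ^ 2 := by gcongr
      _ = _ := by ring
  nlinarith [mul_le_mul_of_nonneg_left h1 hs, sq_nonneg (rate A * s * ‖x‖)]

/-- The steps tend to 0 and the bound is positive, so the infimum defining `KEig` is attained. -/
lemma step_le_of_KEig_le (hd : 0 < d) {A : Matrix (Fin d) (Fin d) ℝ} (hA : PosDefNS A) {γ : ℝ}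
    (hγ : 0 < γ) {n : ℕ} (hn : KEig γ A ≤ n) :
    step γ n ≤ (lamMin (A + Aᵀ) - 2 * rate A) / lamMax (Aᵀ * A) := by
  have hq := hA.rate_pos hd
  have h4 := four_mul_sq_rate_le hd hA
  have hl : 0 < lamMax (Aᵀ * A) := by nlinarith
  have e : lamMin (A + Aᵀ) = 4 * rate A := by
    rw [rate]; ring
  have hne : {K : ℕ | ∀ n : ℕ, K ≤ n →
      step γ n ≤ (lamMin (A + Aᵀ) - 2 * rate A) / lamMax (Aᵀ * A)}.Nonempty := by
    have ht : Filter.Tendsto (fun n : ℕ => step γ n) Filter.atTop (nhds 0) := by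
      have := (tendsto_rpow_neg_atTop hγ).comp
        (Filter.tendsto_atTop_add_const_right _ (1 : ℝ) tendsto_natCast_atTop_atTop)
      exact this
    have hpos : 0 < (lamMin (A + Aᵀ) - 2 * rate A) / lamMax (Aᵀ * A) :=
      div_pos (by rw [e]; linarith) hl
    have := ht.eventually_le_const hpos
    exact Filter.eventually_atTop.1 this
  exact Nat.sInf_mem hne n hn

lemma one_le_CProd (γ : ℝ) (A : Matrix (Fin d) (Fin d) ℝ) : 1 ≤ CProd γ A := le_max_left _ _

lemma opNorm_nonneg (A : Matrix (Fin d) (Fin d) ℝ) : 0 ≤ opNorm A := norm_nonneg _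

lemma opNorm_mul_le (A B : Matrix (Fin d) (Fin d) ℝ) : opNorm (A * B) ≤ opNorm A * opNorm B := by
  rw [opNorm, act_mul]
  exact norm_mul_le _ _

lemma norm_act_le (A : Matrix (Fin d) (Fin d) ℝ) (x : E d) : ‖act A x‖ ≤ opNorm A * ‖x‖ :=
  (act A).le_opNorm x

end Matrices

/-! ### Projections -/

lemma norm_ballProj_le {d : ℕ} {R : ℝ} (hR : 0 ≤ R) (x : E d) : ‖ballProj R x‖ ≤ R := by
  rw [ballProj, norm_smul, Real.norm_of_nonneg (le_min zero_le_one (by positivity))]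
  by_cases hx : ‖x‖ = 0
  · simpa [hx] using hR
  · calc min 1 (R / ‖x‖) * ‖x‖ ≤ R / ‖x‖ * ‖x‖ := by gcongr; exact min_le_right _ _
      _ = R := div_mul_cancel₀ _ hx

lemma ballProj_eq_self {d : ℕ} {R : ℝ} {x : E d} (h : ‖x‖ ≤ R) : ballProj R x = x := by
  by_cases hx : x = 0
  · simp [ballProj, hx]
  · rw [ballProj, min_eq_left, one_smul]
    rwa [one_le_div (norm_pos_iff.2 hx)]

lemma measurable_sparseProj {d : ℕ} (n : ℕ) (R : ℝ) : Measurable (sparseProj (d := d) n R) := by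
  unfold sparseProj ballProj
  split_ifs
  · fun_prop
  · exact measurable_id

/-! ### Concentration of linear recursions driven by bounded martingale differences -/

section Concentration

variable {Ω : Type*}

/-- The chord bound for `exp` on `[-1, 1]`. -/
lemma exp_mul_le_cosh_add (s x : ℝ) (hx : |x| ≤ 1) :
    Real.exp (s * x) ≤ Real.cosh s + x * Real.sinh s := by
  rw [abs_le] at hx
  have hconv := convexOn_exp.2
  have h := hconv (Set.mem_univ s) (Set.mem_univ (-s)) (a := (1 + x) / 2)
    (b := (1 - x) / 2) (by linarith) (by linarith) (by ring)
  simp only [smul_eq_mul] at h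
  have e : (1 + x) / 2 * s + (1 - x) / 2 * -s = s * x := by ring
  rw [e] at h
  rw [Real.cosh_eq, Real.sinh_eq]
  linarith

variable {F : Type*} [NormedAddCommGroup F] [InnerProductSpace ℝ F] [CompleteSpace F]

/-- Hoeffding's lemma, with a weight Z known at time m in place of conditioning. The chord bound is
affine in ξ, its linear part integrates to zero against Z, and cosh u ≤ exp(u²/2). -/
lemma integral_mul_exp_inner_le {m : MeasurableSpace Ω} {m0 : MeasurableSpace Ω} {μ : Measure Ω}
    [IsProbabilityMeasure μ] (hm : m ≤ m0) {Z : Ω → ℝ} {ξ : Ω → F}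
    {c : ℝ} (hc : 0 < c) (hZm : StronglyMeasurable[m] Z) (hZ : Integrable Z μ) (hZ0 : ∀ ω, 0 ≤ Z ω)
    (hξi : Integrable ξ μ) (hξ : ∀ᵐ ω ∂μ, ‖ξ ω‖ ≤ c) (hξ0 : μ[ξ | m] =ᵐ[μ] 0) (x : F) :
    Integrable (fun ω => Z ω * Real.exp (inner ℝ x (ξ ω))) μ ∧
    ∫ ω, Z ω * Real.exp (inner ℝ x (ξ ω)) ∂μ ≤
      Real.exp (‖x‖ ^ 2 * c ^ 2 / 2) * ∫ ω, Z ω ∂μ := by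
  have hin : AEStronglyMeasurable (fun ω => inner ℝ x (ξ ω)) μ :=
    (innerSL ℝ x).continuous.comp_aestronglyMeasurable hξi.1
  have hb : ∀ᵐ ω ∂μ, |inner ℝ x (ξ ω)| ≤ ‖x‖ * c := by
    filter_upwards [hξ] with ω hω
    exact (abs_real_inner_le_norm _ _).trans (by gcongr)
  have hint : Integrable (fun ω => Z ω * Real.exp (inner ℝ x (ξ ω))) μ := by
    refine hZ.mul_bdd (c := Real.exp (‖x‖ * c)) (Real.continuous_exp.comp_aestronglyMeasurable hin)
      ?_
    filter_upwards [hb] with ω hω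
    rw [Real.norm_of_nonneg (Real.exp_pos _).le]
    exact Real.exp_le_exp.2 ((le_abs_self _).trans hω)
  refine ⟨hint, ?_⟩
  have hZξ : Integrable (fun ω => Z ω • ξ ω) μ := by
    exact hZ.smul_bdd c hξi.1 hξ
  have hzero : ∫ ω, Z ω • ξ ω ∂μ = 0 := by
    have h1 := condExp_smul_of_aestronglyMeasurable_left (m := m) (μ := μ)
      hZm.aestronglyMeasurable hZξ hξi
    rw [← integral_condExp hm]
    have h2 : μ[fun ω => Z ω • ξ ω | m] =ᵐ[μ] 0 := by
      refine h1.trans ?_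
      filter_upwards [hξ0] with ω hω
      simp [hω]
    rw [integral_congr_ae h2]
    simp
  have hzero' : ∫ ω, Z ω * inner ℝ x (ξ ω) ∂μ = 0 := by
    have := integral_inner (𝕜 := ℝ) hZξ x
    rw [hzero, inner_zero_right] at this
    rw [← this]
    simp only [real_inner_smul_right]
  have hZin : Integrable (fun ω => Z ω * inner ℝ x (ξ ω)) μ := hZ.mul_bdd (c := ‖x‖ * c) hin hb
  -- The chord bound below is scaled by ‖x‖c, which must not vanish.
  by_cases hx : x = 0
  · simp [hx]
  have hxc : 0 < ‖x‖ * c := mul_pos (norm_pos_iff.2 hx) hc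
  calc ∫ ω, Z ω * Real.exp (inner ℝ x (ξ ω)) ∂μ
      ≤ ∫ ω, (Real.cosh (‖x‖ * c) * Z ω +
          Real.sinh (‖x‖ * c) / (‖x‖ * c) * (Z ω * inner ℝ x (ξ ω))) ∂μ := by
        refine integral_mono_ae hint ((hZ.const_mul _).add (hZin.const_mul _)) ?_
        filter_upwards [hb] with ω hω
        have := exp_mul_le_cosh_add (‖x‖ * c) (inner ℝ x (ξ ω) / (‖x‖ * c))
          (by rwa [abs_div, abs_of_pos hxc, div_le_one hxc])
        rw [mul_div_cancel₀ _ hxc.ne'] at this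
        calc _ ≤ Z ω * _ := mul_le_mul_of_nonneg_left this (hZ0 ω)
          _ = _ := by ring
    _ = Real.cosh (‖x‖ * c) * ∫ ω, Z ω ∂μ := by
        rw [integral_add (hZ.const_mul _) (hZin.const_mul _), integral_const_mul,
          integral_const_mul, hzero', mul_zero, add_zero]
    _ ≤ _ := by
        gcongr
        · exact integral_nonneg hZ0
        · refine (Real.cosh_le_exp_half_sq _).trans_eq ?_
          rw [mul_pow]

variable {m0 : MeasurableSpace Ω} {μ : Measure Ω} [IsProbabilityMeasure μ]

/-- A linear recursion driven by bounded martingale differences has sub-Gaussian marginals. -/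
lemma integral_exp_inner_recursion_le {ℱ : ℕ → MeasurableSpace Ω} (hℱ : ∀ n, ℱ n ≤ m0)
    {n₀ : ℕ} {L ξ : ℕ → Ω → F} {T : ℕ → F →L[ℝ] F} {c s τ : ℕ → ℝ}
    (hL₀ : ∀ ω, L n₀ ω = 0) (hL : ∀ n ≥ n₀, ∀ ω, L (n + 1) ω = T n (L n ω) + ξ n ω)
    (hLm : ∀ n ≥ n₀, StronglyMeasurable[ℱ n] (L n)) (hc : ∀ n, 0 < c n)
    (hξi : ∀ n, Integrable (ξ n) μ) (hξ : ∀ n, ∀ᵐ ω ∂μ, ‖ξ n ω‖ ≤ c n)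
    (hξ0 : ∀ n, μ[ξ n | ℱ n] =ᵐ[μ] 0) (hT : ∀ n ≥ n₀, ‖T n‖ ≤ τ n)
    (hs₀ : 0 ≤ s n₀) (hs : ∀ n ≥ n₀, τ n ^ 2 * s n + c n ^ 2 ≤ s (n + 1)) :
    ∀ n ≥ n₀, 0 ≤ s n ∧ ∀ x : F, Integrable (fun ω => Real.exp (inner ℝ x (L n ω))) μ ∧
      ∫ ω, Real.exp (inner ℝ x (L n ω)) ∂μ ≤ Real.exp (‖x‖ ^ 2 * s n / 2) := by
  intro n hn
  induction n, hn using Nat.le_induction with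
  | base =>
    refine ⟨hs₀, fun x => ?_⟩
    simp only [hL₀, inner_zero_right, Real.exp_zero]
    refine ⟨integrable_const _, ?_⟩
    simp only [integral_const, probReal_univ, smul_eq_mul, mul_one, Real.one_le_exp_iff]
    positivity
  | succ n hn ih =>
    obtain ⟨hsn, ih⟩ := ih
    refine ⟨le_trans (by positivity) (hs n hn), fun x => ?_⟩
    -- Moving `T n` to the test vector turns the past into a weight of the same exponential form.
    -- This is why the induction hypothesis is needed for all test vectors.
    set y := (T n).adjoint x
    have hy : ‖y‖ ≤ τ n * ‖x‖ := by
      refine ((T n).adjoint.le_opNorm x).trans ?_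
      rw [LinearIsometryEquiv.norm_map]
      gcongr
      exact hT n hn
    have e : ∀ ω, Real.exp (inner ℝ x (L (n + 1) ω)) =
        Real.exp (inner ℝ y (L n ω)) * Real.exp (inner ℝ x (ξ n ω)) := by
      intro ω
      rw [hL n hn, inner_add_right, Real.exp_add, ContinuousLinearMap.adjoint_inner_left]
    simp only [e]
    have hsm : StronglyMeasurable[ℱ n] (fun ω => Real.exp (inner ℝ y (L n ω))) :=
      (Real.continuous_exp.comp (innerSL ℝ y).continuous).comp_stronglyMeasurable (hLm n hn)
    obtain ⟨h1, h2⟩ := integral_mul_exp_inner_le (hℱ n) (hc n) hsm (ih y).1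
      (fun ω => (Real.exp_pos _).le) (hξi n) (hξ n) (hξ0 n) x
    refine ⟨h1, h2.trans ?_⟩
    calc _ ≤ Real.exp (‖x‖ ^ 2 * c n ^ 2 / 2) * Real.exp (‖y‖ ^ 2 * s n / 2) := by
          gcongr
          exact (ih y).2
      _ = Real.exp ((‖x‖ ^ 2 * c n ^ 2 + ‖y‖ ^ 2 * s n) / 2) := by
          rw [← Real.exp_add]
          ring_nf
      _ ≤ _ := by
          gcongr
          calc _ ≤ ‖x‖ ^ 2 * c n ^ 2 + (τ n * ‖x‖) ^ 2 * s n := by gcongr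
            _ = ‖x‖ ^ 2 * (τ n ^ 2 * s n + c n ^ 2) := by ring
            _ ≤ _ := by gcongr; exact hs n hn

lemma measureReal_inner_ge_le {F : Type*} [NormedAddCommGroup F] [InnerProductSpace ℝ F] {L : Ω → F} {s : ℝ} (hs : 0 < s)
    (h : ∀ x : F, Integrable (fun ω => Real.exp (inner ℝ x (L ω))) μ ∧
      ∫ ω, Real.exp (inner ℝ x (L ω)) ∂μ ≤ Real.exp (‖x‖ ^ 2 * s / 2))
    {x : F} (hx : ‖x‖ = 1) {ε : ℝ} (hε : 0 ≤ ε) :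
    μ.real {ω | ε ≤ inner ℝ x (L ω)} ≤ Real.exp (-(ε ^ 2 / (2 * s))) := by
  -- The Chernoff parameter ε/s minimizes -λε + λ²s/2.
  have h1 := h ((ε / s) • x)
  have e : (fun ω => Real.exp (inner ℝ ((ε / s) • x) (L ω))) =
      fun ω => Real.exp ((ε / s) * inner ℝ x (L ω)) := by
    funext ω
    rw [real_inner_smul_left]
  rw [e] at h1
  refine (ProbabilityTheory.measure_ge_le_exp_mul_mgf (X := fun ω => inner ℝ x (L ω)) ε
    (div_nonneg hε hs.le) h1.1).trans ?_
  rw [ProbabilityTheory.mgf]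
  calc _ ≤ Real.exp (-(ε / s) * ε) * Real.exp (‖(ε / s) • x‖ ^ 2 * s / 2) := by
        gcongr
        exact h1.2
    _ = _ := by
        rw [← Real.exp_add, norm_smul, hx, mul_one, Real.norm_eq_abs, sq_abs]
        congr 1
        field_simp
        ring

/-- A vector of norm above ε has a coordinate of absolute value at least ε/√d; a union bound over
the 2d signed coordinate directions does the rest. -/
lemma measureReal_norm_gt_le {d : ℕ} (hd : 0 < d) {L : Ω → E d} {s : ℝ} (hs : 0 < s)
    (h : ∀ x : E d, Integrable (fun ω => Real.exp (inner ℝ x (L ω))) μ ∧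
      ∫ ω, Real.exp (inner ℝ x (L ω)) ∂μ ≤ Real.exp (‖x‖ ^ 2 * s / 2))
    {ε : ℝ} (hε : 0 ≤ ε) :
    μ.real {ω | ε < ‖L ω‖} ≤ 2 * d * Real.exp (-(ε ^ 2 / (2 * d * s))) := by
  have hd' : (0 : ℝ) < d := by exact_mod_cast hd
  set e : Fin d → E d := fun i => EuclideanSpace.single i 1
  have hsub : {ω | ε < ‖L ω‖} ⊆ ⋃ i : Fin d,
      ({ω | ε / Real.sqrt d ≤ inner ℝ (e i) (L ω)} ∪
        {ω | ε / Real.sqrt d ≤ inner ℝ (-e i) (L ω)}) := by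
    intro ω hω
    by_contra hc
    simp only [Set.mem_iUnion, Set.mem_union, Set.mem_ofPred_eq, not_exists, not_or, not_le] at hc
    have hi : ∀ i, (L ω i) ^ 2 ≤ ε ^ 2 / d := by
      intro i
      obtain ⟨h1, h2⟩ := hc i
      rw [inner_neg_left] at h2
      simp only [e, EuclideanSpace.inner_single_left, map_one, one_mul] at h1 h2
      have : |L ω i| ≤ ε / Real.sqrt d := abs_le.2 ⟨by linarith, h1.le⟩
      calc (L ω i) ^ 2 = |L ω i| ^ 2 := (sq_abs _).symm
        _ ≤ (ε / Real.sqrt d) ^ 2 := by gcongr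
        _ = _ := by rw [div_pow, Real.sq_sqrt hd'.le]
    have : ‖L ω‖ ^ 2 ≤ ε ^ 2 := by
      rw [EuclideanSpace.real_norm_sq_eq]
      calc _ ≤ ∑ _i : Fin d, ε ^ 2 / d := Finset.sum_le_sum fun i _ => hi i
        _ = _ := by simp; field_simp
    exact absurd hω (not_lt.2 (abs_le_of_sq_le_sq' this hε).2)
  have hb : ∀ x : E d, ‖x‖ = 1 → μ.real {ω | ε / Real.sqrt d ≤ inner ℝ x (L ω)} ≤
      Real.exp (-(ε ^ 2 / (2 * d * s))) := by
    intro x hx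
    refine (measureReal_inner_ge_le hs h hx (by positivity)).trans_eq ?_
    rw [div_pow, Real.sq_sqrt hd'.le]
    congr 2
    field_simp
  have hn : ∀ i, ‖e i‖ = 1 := by intro i; simp [e]
  calc μ.real {ω | ε < ‖L ω‖} ≤ _ := measureReal_mono hsub
    _ ≤ ∑ i : Fin d, μ.real _ := measureReal_iUnion_fintype_le _
    _ ≤ ∑ _i : Fin d, 2 * Real.exp (-(ε ^ 2 / (2 * d * s))) := by
        refine Finset.sum_le_sum fun i _ => (measureReal_union_le _ _).trans ?_
        have h1 := hb (e i) (hn i)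
        have h2 := hb (-e i) (by rw [norm_neg, hn i])
        linarith
    _ = _ := by
        rw [Finset.sum_const, Finset.card_univ, Fintype.card_fin, nsmul_eq_mul]
        ring

end Concentration

/-! ### Scalar estimates -/

/-- With b = a^(γ/p), split ln(b x^γ) = ln(2cb) + ln(x^γ/(2c)). The threshold bounds c times the
first summand by x^γ/2, and ln u ≤ u - 1 does so for the second. -/
lemma mul_log_le_of_KLog_le {γ p a c x : ℝ} (hγ : 0 < γ) (ha : 0 < a) (hc : 0 < c)
    (hx : 0 < x) (h : KLog γ p a c ≤ x) :
    c * Real.log (a ^ (γ / p) * x ^ γ) ≤ x ^ γ := by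
  set b := a ^ (γ / p) with hb
  have hb0 : 0 < b := Real.rpow_pos_of_pos ha _
  have hy0 : 0 < x ^ γ := Real.rpow_pos_of_pos hx _
  have hmax : (0 : ℝ) ≤ max 0 (2 * Real.log (2 * c * b)) := le_max_left _ _
  have h1 : c * max 0 (2 * Real.log (2 * c * b)) ≤ x ^ γ := by
    have h2 := Real.rpow_le_rpow (by unfold KLog; positivity) h hγ.le
    rw [KLog, ← Real.mul_rpow hc.le hmax, ← Real.rpow_mul (by positivity),
      one_div_mul_cancel hγ.ne', Real.rpow_one] at h2
    exact h2
  have h3 : c * (2 * Real.log (2 * c * b)) ≤ x ^ γ :=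
    (mul_le_mul_of_nonneg_left (le_max_right _ _) hc.le).trans h1
  have h4 : Real.log (b * x ^ γ) = Real.log (2 * c * b) + Real.log (x ^ γ / (2 * c)) := by
    rw [← Real.log_mul (by positivity) (by positivity)]
    congr 1
    field_simp
  have h5 := Real.log_le_sub_one_of_pos (show 0 < x ^ γ / (2 * c) by positivity)
  have h6 : c * Real.log (x ^ γ / (2 * c)) ≤ c * (x ^ γ / (2 * c) - 1) := by gcongr
  have h7 : c * (x ^ γ / (2 * c) - 1) = x ^ γ / 2 - c := by field_simp
  rw [h4, mul_add]
  linarith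

/-- In one step a power x^(-s) loses at most the fraction s/x, since (1 + 1/x)^(-s) ≥ exp(-s/x) ≥ 1
- s/x. -/
lemma mul_one_sub_div_le_rpow_neg {x s : ℝ} (hx : 0 < x) (hs : 0 ≤ s) :
    x ^ (-s) * (1 - s / x) ≤ (x + 1) ^ (-s) := by
  have e : x + 1 = x * (1 + 1 / x) := by field_simp
  rw [e, Real.mul_rpow hx.le (by positivity)]
  gcongr
  rw [Real.rpow_def_of_pos (by positivity)]
  have h1 := Real.log_le_sub_one_of_pos (show 0 < 1 + 1 / x by positivity)
  have h2 : s * Real.log (1 + 1 / x) ≤ s * (1 / x) := by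
    gcongr
    linarith
  have h3 := Real.add_one_le_exp (Real.log (1 + 1 / x) * -s)
  have h4 : s * (1 / x) = s / x := by ring
  linarith

/-- A telescoping substitute for comparing the sum of (x + 1)^(-p) with an integral. -/
lemma sub_one_mul_rpow_neg_le {x p : ℝ} (hx : 0 < x) (hp : 1 < p) :
    (p - 1) * (x + 1) ^ (-p) ≤ x ^ (1 - p) - (x + 1) ^ (1 - p) := by
  have hu : 0 < x + 1 := by linarith
  have e : x = (x + 1) * (x / (x + 1)) := by field_simp
  have e2 : x ^ (1 - p) = (x + 1) ^ (1 - p) * (x / (x + 1)) ^ (1 - p) := by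
    rw [← Real.mul_rpow hu.le (by positivity), ← e]
  have e3 : (x + 1) ^ (-p) = (x + 1) ^ (1 - p) * (1 / (x + 1)) := by
    rw [show -p = (1 - p) - 1 by ring, Real.rpow_sub_one hu.ne']
    ring
  have h1 : 1 + (p - 1) / (x + 1) ≤ (x / (x + 1)) ^ (1 - p) := by
    rw [Real.rpow_def_of_pos (by positivity)]
    have h1 := Real.log_le_sub_one_of_pos (show 0 < x / (x + 1) by positivity)
    have h2 : x / (x + 1) - 1 = -(1 / (x + 1)) := by field_simp; ring
    rw [h2] at h1
    have h3 := Real.add_one_le_exp (Real.log (x / (x + 1)) * (1 - p))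
    have h4 : (p - 1) * Real.log (x / (x + 1)) ≤ (p - 1) * -(1 / (x + 1)) :=
      mul_le_mul_of_nonneg_left h1 (by linarith)
    have h5 : (p - 1) * -(1 / (x + 1)) = -((p - 1) / (x + 1)) := by ring
    linarith
  rw [e2, e3]
  have h6 : 0 < (x + 1) ^ (1 - p) := by positivity
  have h7 := mul_le_mul_of_nonneg_left h1 h6.le
  calc _ = (x + 1) ^ (1 - p) * (1 + (p - 1) / (x + 1)) - (x + 1) ^ (1 - p) := by ring
    _ ≤ _ := by linarith

/-- The bound S does not depend on the number of terms, so the inequality is still strict for the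
infinite union of bad events. -/
lemma exists_sum_rpow_neg_le_lt_one {p : ℝ} (hp : 1 < p) {n₀ : ℕ}
    (h : (p - 1) ^ (-1 / (p - 1)) ≤ n₀) :
    ∃ S < 1, ∀ M : ℕ, ∑ k ∈ Finset.range M, (((n₀ + 1 + k : ℕ) : ℝ) + 1) ^ (-p) ≤ S := by
  have hp' : 0 < p - 1 := by linarith
  refine ⟨((n₀ : ℝ) + 1) ^ (1 - p) / (p - 1), ?_, fun M => ?_⟩
  · rw [div_lt_one hp']
    have h1 : (p - 1) ^ (-1 / (p - 1)) < (n₀ : ℝ) + 1 := by linarith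
    have h2 := Real.rpow_lt_rpow_of_neg (Real.rpow_pos_of_pos hp' _) h1
      (show 1 - p < 0 by linarith)
    rwa [← Real.rpow_mul hp'.le, show -1 / (p - 1) * (1 - p) = 1 by field_simp; ring,
      Real.rpow_one] at h2
  · rw [le_div_iff₀ hp', Finset.sum_mul]
    have hk : ∀ k ∈ Finset.range M, (((n₀ + 1 + k : ℕ) : ℝ) + 1) ^ (-p) * (p - 1) ≤
        -((((n₀ + 1 + (k + 1) : ℕ) : ℝ)) ^ (1 - p) - (((n₀ + 1 + k : ℕ) : ℝ)) ^ (1 - p)) := by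
      intro k _
      have := sub_one_mul_rpow_neg_le (x := ((n₀ + 1 + k : ℕ) : ℝ)) (by positivity) hp
      push_cast at *
      rw [add_assoc ((n₀ : ℝ) + 1) k 1] at *
      linarith
    refine (Finset.sum_le_sum hk).trans ?_
    rw [Finset.sum_neg_distrib,
      Finset.sum_range_sub (fun k => (((n₀ + 1 + k : ℕ) : ℝ)) ^ (1 - p))]
    have : 0 ≤ (((n₀ + 1 + M : ℕ) : ℝ)) ^ (1 - p) := by positivity
    push_cast at *
    rw [add_zero]
    linarith

/-- The term i = 1 equals 1. It belongs to the range of the maximum only if `KDecay` is not the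
default value 0; hence the proof that its defining set is nonempty, which rests on ln n =
o(n^(1-γ)). -/
lemma one_le_CDecay {γ q : ℝ} (hγ₀ : 0 < γ) (hγ₁ : γ < 1) (hq : 0 < q) : 1 ≤ CDecay γ q := by
  have hne : {K : ℕ | 1 ≤ K ∧ ∀ n : ℕ, K ≤ n → expDecay γ q n ≤ (n : ℝ) ^ (-γ)}.Nonempty := by
    have hlog := ((isLittleO_log_rpow_atTop (sub_pos.2 hγ₁)).comp_tendsto
      tendsto_natCast_atTop_atTop).bound (show 0 < q / (2 * γ) by positivity)
    obtain ⟨K, hK⟩ := Filter.eventually_atTop.1 (hlog.and (Filter.eventually_ge_atTop 2))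
    refine ⟨max 1 K, le_max_left _ _, fun n hn => ?_⟩
    obtain ⟨h1, h2⟩ := hK n ((le_max_right _ _).trans hn)
    have hn2 : (2 : ℝ) ≤ n := by exact_mod_cast h2
    have hn0 : (0 : ℝ) < n := by linarith
    simp only [Function.comp_apply] at h1
    rw [Real.norm_of_nonneg (show 0 ≤ (n : ℝ) ^ (1 - γ) by positivity)] at h1
    have h3 : Real.log n ≤ q / (2 * γ) * (n : ℝ) ^ (1 - γ) := (le_abs_self _).trans h1
    have h4 : ((n : ℝ) - 1) * (n : ℝ) ^ (-γ) ≤ ∑ k ∈ Finset.Ico 1 n, ((k : ℝ) + 1) ^ (-γ) := by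
      have : ∀ k ∈ Finset.Ico 1 n, (n : ℝ) ^ (-γ) ≤ ((k : ℝ) + 1) ^ (-γ) := by
        intro k hk
        rw [Finset.mem_Ico] at hk
        refine Real.rpow_le_rpow_of_nonpos (by positivity) ?_ (by linarith)
        exact_mod_cast hk.2
      have h := Finset.card_nsmul_le_sum _ _ _ this
      rwa [Nat.card_Ico, nsmul_eq_mul, Nat.cast_sub (by omega), Nat.cast_one] at h
    have h5 : (n : ℝ) ^ (1 - γ) = n * (n : ℝ) ^ (-γ) := by
      rw [sub_eq_add_neg, Real.rpow_add hn0, Real.rpow_one]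
    have h6 : γ * Real.log n ≤ q * (((n : ℝ) - 1) * (n : ℝ) ^ (-γ)) := by
      calc γ * Real.log n ≤ γ * (q / (2 * γ) * (n : ℝ) ^ (1 - γ)) := by gcongr
        _ = q * ((n / 2 : ℝ) * (n : ℝ) ^ (-γ)) := by rw [h5]; field_simp
        _ ≤ _ := by
          gcongr
          linarith
    rw [expDecay, Real.rpow_def_of_pos hn0]
    refine Real.exp_le_exp.2 ?_
    have h7 := mul_le_mul_of_nonneg_left h4 hq.le
    linarith
  have hK : 1 ≤ KDecay γ q := (Nat.sInf_mem hne).1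
  have hfin : (Set.Icc 1 (KDecay γ q)).Finite := Set.finite_Icc _ _
  refine le_csSup (hfin.image _).bddAbove ⟨1, ⟨le_rfl, hK⟩, ?_⟩
  simp [expDecay]

lemma lt_of_rpow_self_lt {y : ℝ} {k : ℕ} (hk : 0 < k) (h : y ^ y < (k : ℝ) ^ k) : y < k := by
  by_contra hc
  push Not at hc
  have hk1 : (1 : ℝ) ≤ k := by exact_mod_cast hk
  have : (k : ℝ) ^ k ≤ y ^ y := by
    calc (k : ℝ) ^ k = (k : ℝ) ^ (k : ℝ) := (Real.rpow_natCast _ _).symm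
      _ ≤ (k : ℝ) ^ y := Real.rpow_le_rpow_of_exponent_le hk1 hc
      _ ≤ y ^ y := Real.rpow_le_rpow (by positivity) hc (by linarith)
  linarith

/-- Between two indices `k ^ k - 1 < m ^ m - 1` of the projection times, the rate `ν ^ 2`
decreases by a factor of `k ^ γ` at least. -/
lemma rpow_neg_mul_log_ratio_le {γ p a : ℝ} {k m : ℕ} (hγ : 0 < γ) (hp : 0 < p) (ha : 1 ≤ a)
    (hk : 3 ≤ k) (hkγ : 2 ≤ k * γ) (hkm : k + 1 ≤ m) :
    (k : ℝ) ^ γ * (((m : ℝ) ^ m) ^ (-γ) * Real.log (a * ((m : ℝ) ^ m) ^ p)) ≤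
      ((k : ℝ) ^ k) ^ (-γ) * Real.log (a * ((k : ℝ) ^ k) ^ p) := by
  have hk3 : (3 : ℝ) ≤ k := by exact_mod_cast hk
  have hk0 : (0 : ℝ) < k := by linarith
  have hm0 : (0 : ℝ) < m := by exact_mod_cast (by omega : 0 < m)
  have hkm' : (k : ℝ) + 1 ≤ m := by exact_mod_cast hkm
  have hr1 : 1 ≤ (m : ℝ) / k := by
    rw [one_le_div hk0]
    linarith
  have hlk : 1 ≤ Real.log k := by
    rw [Real.le_log_iff_exp_le hk0]
    linarith [Real.exp_one_lt_d9]
  -- This expresses that ln x / x decreases, and uses ln k ≥ 1, hence k ≥ 3.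
  have hlm : Real.log m ≤ m / k * Real.log k := by
    have h1 : Real.log m = Real.log (m / k) + Real.log k := by
      rw [Real.log_div hm0.ne' hk0.ne']
      ring
    have h2 := Real.log_le_sub_one_of_pos (show 0 < (m : ℝ) / k by positivity)
    nlinarith
  have hlog : ∀ j : ℕ, (0 : ℝ) < j → Real.log (a * ((j : ℝ) ^ j) ^ p) =
      Real.log a + p * (j * Real.log j) := by
    intro j hj
    rw [Real.log_mul (by positivity) (by positivity), Real.log_rpow (by positivity), Real.log_pow]
  have hA : 0 ≤ Real.log a := Real.log_nonneg ha
  have h1 : Real.log (a * ((m : ℝ) ^ m) ^ p) ≤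
      ((m : ℝ) / k) ^ 2 * Real.log (a * ((k : ℝ) ^ k) ^ p) := by
    rw [hlog m hm0, hlog k hk0, mul_add]
    refine add_le_add (le_mul_of_one_le_left hA (one_le_pow₀ hr1)) ?_
    calc p * (m * Real.log m) ≤ p * (m * (m / k * Real.log k)) := by gcongr
      _ = _ := by field_simp
  -- The growth of the logarithm costs (m/k)², at most (m/k)^(kγ) since kγ ≥ 2. The powers pay for
  -- it and for the extra k^γ because m^k · k ≤ m^(k+1) ≤ m^m.
  have h2 : ((m : ℝ) / k) ^ 2 ≤ ((m : ℝ) ^ m / ((k : ℝ) ^ k * k)) ^ γ := by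
    calc ((m : ℝ) / k) ^ 2 = ((m : ℝ) / k) ^ (2 : ℝ) := (Real.rpow_natCast _ 2).symm
      _ ≤ ((m : ℝ) / k) ^ (k * γ) := Real.rpow_le_rpow_of_exponent_le hr1 hkγ
      _ = (((m : ℝ) / k) ^ k) ^ γ := by rw [Real.rpow_mul (by positivity), Real.rpow_natCast]
      _ ≤ _ := by
        gcongr
        rw [le_div_iff₀ (by positivity)]
        calc ((m : ℝ) / k) ^ k * ((k : ℝ) ^ k * k) = (m : ℝ) ^ k * k := by
              rw [div_pow]
              field_simp
          _ ≤ (m : ℝ) ^ k * m := by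
              gcongr
              linarith
          _ = (m : ℝ) ^ (k + 1) := (pow_succ _ _).symm
          _ ≤ (m : ℝ) ^ m := pow_le_pow_right₀ (by linarith) hkm
  have hL : 0 ≤ Real.log (a * ((k : ℝ) ^ k) ^ p) := by
    rw [hlog k hk0]
    positivity
  calc _ ≤ (k : ℝ) ^ γ * (((m : ℝ) ^ m) ^ (-γ) *
        (((m : ℝ) ^ m / ((k : ℝ) ^ k * k)) ^ γ * Real.log (a * ((k : ℝ) ^ k) ^ p))) := by
        gcongr
        exact h1.trans (by gcongr)
    _ = _ := by
        rw [Real.div_rpow (by positivity) (by positivity), Real.mul_rpow (by positivity) hk0.le,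
          Real.rpow_neg (by positivity), Real.rpow_neg (by positivity)]
        have := Real.rpow_pos_of_pos hk0 γ
        have := Real.rpow_pos_of_pos (pow_pos hk0 k) γ
        have := Real.rpow_pos_of_pos (pow_pos hm0 m) γ
        field_simp

/-! ### Standing assumptions on the problem data. -/

namespace Problem

/-- The standing assumptions on the problem data. -/
structure Valid {d : ℕ} (P : Problem d) : Prop where
  hd : 0 < d
  hW₂ : PosDefNS P.W₂
  hX₁ : PosDefNS P.X₁
  hβ : 0 < P.β
  hαβ : P.β < P.α
  hα : P.α < 1
  hp : 1 < P.p
  hδ₀ : 0 < P.δ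
  hδ₁ : P.δ < 1
  hm₁ : 0 < P.m₁
  hm₂ : 0 < P.m₂
  hRθ : ‖P.θstar‖ < P.Rθ
  hRw : ‖P.wstar‖ < P.Rw

variable {d : ℕ} (P : Problem d)

/-- `ln (4 d² (n + 1) ^ p / δ)`. -/
def logTerm (n : ℕ) : ℝ := Real.log (4 * (d : ℝ) ^ 2 * ((n : ℝ) + 1) ^ P.p / P.δ)

/-- The ratio `α_{n-1} / β_{n-1}` of the two step sizes. -/
def κ (n : ℕ) : ℝ := (n : ℝ) ^ (-(P.α - P.β))

variable {P}

namespace Valid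

variable (h : P.Valid)
include h

/-! ### Signs of the constants -/

lemma α_pos : 0 < P.α := h.hβ.trans h.hαβ

lemma β_lt_one : P.β < 1 := h.hαβ.trans h.hα

lemma q₁_pos : 0 < P.q₁ := h.hX₁.rate_pos h.hd

lemma q₂_pos : 0 < P.q₂ := h.hW₂.rate_pos h.hd

lemma qmin_pos : 0 < P.qmin := lt_min h.q₁_pos h.q₂_pos

lemma sθ_pos : 0 < P.sθ := sub_pos.2 h.hRθ

lemma sw_pos : 0 < P.sw := sub_pos.2 h.hRw

lemma Rθ_pos : 0 < P.Rθ := (norm_nonneg _).trans_lt h.hRθ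

lemma Rw_pos : 0 < P.Rw := (norm_nonneg _).trans_lt h.hRw

lemma rθ_pos : 0 < P.rθ := add_pos_of_pos_of_nonneg h.Rθ_pos (norm_nonneg _)

lemma rw_pos : 0 < P.rw := add_pos_of_pos_of_nonneg h.Rw_pos (norm_nonneg _)

omit h in
lemma one_le_Dθ : 1 ≤ P.Dθ := one_le_CProd _ _

omit h in
lemma one_le_Dw : 1 ≤ P.Dw := one_le_CProd _ _

lemma CT_nonneg : 0 ≤ P.CT := by
  have h1 := h.hαβ
  have h2 := opNorm_nonneg P.X₁
  have : 0 ≤ 2 * (P.α - P.β) * (1 + opNorm P.X₁) := by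
    apply mul_nonneg <;> linarith
  unfold CT
  linarith

/-- The bound `Cb` dominates the gain of the coupling from `w` to `θ`. -/
lemma mul_one_add_le_Cb : opNorm (P.W₁ * P.W₂⁻¹) * (1 + 2 * P.CT / P.q₁) ≤ P.Cb := by
  have hq := h.q₁_pos
  have hC := h.CT_nonneg
  unfold Cb
  refine mul_le_mul_of_nonneg_left ?_ (opNorm_nonneg _)
  have h1 : 1 ≤ Real.exp (P.q₁ / 2) := Real.one_le_exp (by linarith)
  have h2 : 1 ≤ Real.exp (P.q₁ / 2) * P.Dθ := one_le_mul_of_one_le_of_one_le h1 one_le_Dθ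
  have h3 : 2 * P.CT / P.q₁ * 1 ≤ 2 * P.CT / P.q₁ * (Real.exp (P.q₁ / 2) * P.Dθ) := by gcongr
  calc _ = 1 + 2 * P.CT / P.q₁ * 1 := by ring
    _ ≤ 1 + 2 * P.CT / P.q₁ * (Real.exp (P.q₁ / 2) * P.Dθ) := by linarith
    _ = _ := by ring

lemma Cb_nonneg : 0 ≤ P.Cb := by
  refine le_trans ?_ h.mul_one_add_le_Cb
  have := h.q₁_pos
  have := h.CT_nonneg
  have := opNorm_nonneg (P.W₁ * P.W₂⁻¹)
  positivity

lemma A₂_nonneg : 0 ≤ P.A₂ := by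
  have := h.q₂_pos
  have := h.Cb_nonneg
  have := opNorm_nonneg P.Γ₂
  have := zero_le_one.trans (one_le_Dw (P := P))
  unfold A₂
  positivity

lemma one_le_SA : 1 ≤ P.SA := by
  have hl : 0 < P.ellStar := by
    refine Nat.ceil_pos.2 (div_pos h.hβ ?_)
    linarith [h.hαβ]
  have := Finset.single_le_sum (f := fun i => P.A₂ ^ i)
    (fun i _ => pow_nonneg h.A₂_nonneg i) (Finset.mem_range.2 hl)
  simpa [SA] using this

lemma CRw_mul_rw : P.CRw * P.rw =
    3 / 2 * P.rw + Real.exp P.q₂ / P.q₂ * opNorm P.Γ₂ * P.Dw * 3 * P.rθ := by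
  have := h.rw_pos
  unfold CRw CRθ
  field_simp

/-- The budget for ‖v‖: r_w from the position at N, r_w/2 for the noise, and 3r_θ‖Γ₂‖/q₂ as the
equilibrium of a contraction of rate q₂ under the forcing Γ₂t with ‖t‖ ≤ 3r_θ. -/
lemma three_halves_add_le_CRw_mul_rw :
    3 / 2 * P.rw + 3 * P.rθ * opNorm P.Γ₂ / P.q₂ ≤ P.CRw * P.rw := by
  have := h.rw_pos
  have := h.rθ_pos
  have := h.q₂_pos
  have := opNorm_nonneg P.Γ₂
  rw [h.CRw_mul_rw]
  have h1 : 1 ≤ Real.exp P.q₂ := Real.one_le_exp (by linarith)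
  have h2 : 1 ≤ Real.exp P.q₂ * P.Dw := one_le_mul_of_one_le_of_one_le h1 one_le_Dw
  have h3 : 3 * P.rθ * opNorm P.Γ₂ / P.q₂ * 1 ≤
      3 * P.rθ * opNorm P.Γ₂ / P.q₂ * (Real.exp P.q₂ * P.Dw) := by gcongr
  have e : Real.exp P.q₂ / P.q₂ * opNorm P.Γ₂ * P.Dw * 3 * P.rθ =
    3 * P.rθ * opNorm P.Γ₂ / P.q₂ * (Real.exp P.q₂ * P.Dw) := by ring
  linarith

lemma CRw_mul_rw_pos : 0 < P.CRw * P.rw := by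
  refine lt_of_lt_of_le ?_ h.three_halves_add_le_CRw_mul_rw
  have := h.rw_pos
  have := h.rθ_pos
  have := h.q₂_pos
  have := opNorm_nonneg P.Γ₂
  positivity

lemma one_le_B : 1 ≤ P.B := by
  have := h.CRw_mul_rw_pos
  have := h.rθ_pos
  have := norm_nonneg P.θstar
  have := norm_nonneg P.wstar
  unfold B CRθ
  linarith

omit h in
-- Because single steps contract, the variance proxy of the noise needs only the factor 1/q.
lemma div_q_le_CVar {γ q : ℝ} (hγ₀ : 0 < γ) (hγ₁ : γ < 1) (hq : 0 < q) : 1 / q ≤ CVar γ q := by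
  have h1 := one_le_CDecay hγ₀ hγ₁ hq
  have h2 : 1 ≤ Real.exp q := Real.one_le_exp hq.le
  unfold CVar
  gcongr
  exact one_le_mul_of_one_le_of_one_le h1 h2

lemma CVarα_pos : 0 < CVar P.α P.q₁ :=
  lt_of_lt_of_le (one_div_pos.2 h.q₁_pos) (div_q_le_CVar h.α_pos h.hα h.q₁_pos)

lemma CVarβ_pos : 0 < CVar P.β P.q₂ :=
  lt_of_lt_of_le (one_div_pos.2 h.q₂_pos) (div_q_le_CVar h.hβ h.β_lt_one h.q₂_pos)

lemma cθ_pos : 0 < (P.m₁ + P.m₂ * opNorm P.W₁ * opNorm P.W₂⁻¹) * P.B := by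
  have := h.hm₁
  have := h.hm₂
  have := h.one_le_B
  have := opNorm_nonneg P.W₁
  have := opNorm_nonneg P.W₂⁻¹
  positivity

lemma cw_pos : 0 < P.m₂ * P.B := by
  have := h.hm₂
  have := h.one_le_B
  positivity

lemma Lθ_ge : 2 * ((P.m₁ + P.m₂ * opNorm P.W₁ * opNorm P.W₂⁻¹) * P.B) ^ 2 ≤ P.Lθ := by
  have := h.cθ_pos
  unfold Lθ
  rw [mul_assoc P.Dθ]
  refine mul_le_mul_of_nonneg_left (pow_le_pow_left₀ this.le ?_ 2) zero_le_two
  exact le_mul_of_one_le_left this.le one_le_Dθ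

lemma Lw_ge : 2 * (P.m₂ * P.B) ^ 2 ≤ P.Lw := by
  have := h.cw_pos
  unfold Lw
  rw [mul_assoc P.Dw]
  refine mul_le_mul_of_nonneg_left (pow_le_pow_left₀ this.le ?_ 2) zero_le_two
  exact le_mul_of_one_le_left this.le one_le_Dw

lemma Lθ_pos : 0 < P.Lθ := by
  have := h.cθ_pos
  exact lt_of_lt_of_le (by positivity) h.Lθ_ge

lemma Lw_pos : 0 < P.Lw := by
  have := h.cw_pos
  exact lt_of_lt_of_le (by positivity) h.Lw_ge

lemma d_pos : (0 : ℝ) < d := by exact_mod_cast h.hd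

lemma one_le_d : (1 : ℝ) ≤ d := by exact_mod_cast h.hd

lemma Vθ_pos : 0 < P.Vθ := by
  have := h.Lθ_pos
  have := h.CVarα_pos
  have := h.d_pos
  unfold Vθ
  positivity

lemma Vw_pos : 0 < P.Vw := by
  have := h.Lw_pos
  have := h.CVarβ_pos
  have := h.d_pos
  unfold Vw
  positivity

/-- The left side is what the tail bound demands: a variance proxy c²/q per unit of step size, times
the 2d in the exponent of `measureReal_norm_gt_le`. -/
lemma Vθ_ge :
    2 * d * (((P.m₁ + P.m₂ * opNorm P.W₁ * opNorm P.W₂⁻¹) * P.B) ^ 2 / P.q₁) ≤ P.Vθ := by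
  have hc := h.cθ_pos
  have hq := h.q₁_pos
  have hd := h.one_le_d
  have hL := h.Lθ_pos
  calc _ = (d : ℝ) * (2 * ((P.m₁ + P.m₂ * opNorm P.W₁ * opNorm P.W₂⁻¹) * P.B) ^ 2) *
        (1 / P.q₁) := by ring
    _ ≤ (d : ℝ) ^ 3 * P.Lθ * CVar P.α P.q₁ := by
        gcongr
        · exact le_self_pow₀ hd (by norm_num)
        · exact h.Lθ_ge
        · exact div_q_le_CVar h.α_pos h.hα hq

lemma Vw_ge : 2 * d * ((P.m₂ * P.B) ^ 2 / P.q₂) ≤ P.Vw := by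
  have hc := h.cw_pos
  have hq := h.q₂_pos
  have hd := h.one_le_d
  have hL := h.Lw_pos
  calc _ = (d : ℝ) * (2 * (P.m₂ * P.B) ^ 2) * (1 / P.q₂) := by ring
    _ ≤ (d : ℝ) ^ 3 * P.Lw * CVar P.β P.q₂ := by
        gcongr
        · exact le_self_pow₀ hd (by norm_num)
        · exact h.Lw_ge
        · exact div_q_le_CVar h.hβ h.β_lt_one hq

lemma A₄C₀_ge :
    (Real.exp 1 + Real.exp 2 * (2 * opNorm P.Γ₂ / P.q₂)) * Real.sqrt P.Vw ≤ P.A₄C₀ := by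
  have hq := h.q₂_pos
  have hG := opNorm_nonneg P.Γ₂
  have h1 : 1 ≤ Real.exp (P.q₂ / 2) := Real.one_le_exp (by linarith)
  have h2 : 1 ≤ Real.exp (P.q₂ / 2) * P.Dw := one_le_mul_of_one_le_of_one_le h1 one_le_Dw
  have h3 : 2 * opNorm P.Γ₂ / P.q₂ * 1 ≤
      2 * opNorm P.Γ₂ / P.q₂ * (Real.exp (P.q₂ / 2) * P.Dw) := by gcongr
  have h4 : 2 * opNorm P.Γ₂ / P.q₂ ≤ P.A₁'' := by
    unfold A₁'' CInt
    refine le_trans (by linarith) (h3.trans_eq (by ring))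
  have h5 : 0 ≤ P.A₃ * P.A₂ ^ P.ellStar :=
    mul_nonneg h.CRw_mul_rw_pos.le (pow_nonneg h.A₂_nonneg _)
  have h6 : Real.sqrt P.Vw ≤ P.SA * Real.sqrt P.Vw :=
    le_mul_of_one_le_left (Real.sqrt_nonneg _) h.one_le_SA
  have h7 : 0 ≤ 2 * opNorm P.Γ₂ / P.q₂ := by positivity
  have h8 : 0 ≤ P.A₁'' := h7.trans h4
  unfold A₄C₀
  calc _ ≤ (Real.exp 1 + Real.exp 2 * P.A₁'') * (P.SA * Real.sqrt P.Vw) := by gcongr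
    _ ≤ _ := by linarith

lemma A₄C₀_pos : 0 < P.A₄C₀ := by
  refine lt_of_lt_of_le ?_ h.A₄C₀_ge
  have := h.q₂_pos
  have := opNorm_nonneg P.Γ₂
  have := Real.sqrt_pos.2 h.Vw_pos
  positivity

lemma A₅C₀_pos : 0 < P.A₅C₀ := Real.sqrt_pos.2 (by linarith [h.Vθ_pos])

/-- The left side is what `Kz_add_le` needs. Every factor dropped from the right side is at least 1,
and `qmin` is at most q₂. -/
lemma A₄C₁_ge : Real.exp 1 *
    (opNorm P.Γ₂ * (2 / P.q₂ * (P.rθ + max (opNorm (P.W₁ * P.W₂⁻¹)) 1 * P.rw)) + P.rw) ≤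
      P.A₄C₁ := by
  have hq := h.q₂_pos
  have hq1 := h.q₁_pos
  have hqm := h.qmin_pos
  have hqm2 : P.qmin ≤ P.q₂ := min_le_right _ _
  have hG := opNorm_nonneg P.Γ₂
  have hrθ := h.rθ_pos
  have hrw := h.rw_pos
  set M := max (opNorm (P.W₁ * P.W₂⁻¹)) 1 with hM
  have hM1 : 1 ≤ M := le_max_right _ _
  have hCa : M ≤ P.Ca := le_mul_of_one_le_left (by linarith) one_le_Dθ
  have h1 : 1 ≤ Real.exp (P.qmin / 2) := Real.one_le_exp (by linarith)
  have h2 : 1 ≤ Real.exp P.q₁ := Real.one_le_exp (by linarith)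
  have h3 : P.rθ + M * P.rw ≤ P.Ca * (P.rθ + P.rw) := by
    calc P.rθ + M * P.rw ≤ M * P.rθ + M * P.rw := by
          have := le_mul_of_one_le_left hrθ.le hM1
          linarith
      _ = M * (P.rθ + P.rw) := by ring
      _ ≤ _ := by gcongr
  have h4 : 2 / P.q₂ * (P.rθ + M * P.rw) ≤
      P.rθ + P.Ca * Real.exp P.q₁ * (2 * Real.exp (P.qmin / 2) / P.qmin) * (P.rθ + P.rw) := by
    calc 2 / P.q₂ * (P.rθ + M * P.rw) ≤ 2 / P.qmin * (P.Ca * (P.rθ + P.rw)) := by gcongr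
      _ ≤ 2 / P.qmin * (P.Ca * (P.rθ + P.rw)) * (Real.exp P.q₁ * Real.exp (P.qmin / 2)) := by
          refine le_mul_of_one_le_right ?_ (one_le_mul_of_one_le_of_one_le h2 h1)
          have : 0 ≤ P.Ca := by linarith
          positivity
      _ = P.Ca * Real.exp P.q₁ * (2 * Real.exp (P.qmin / 2) / P.qmin) * (P.rθ + P.rw) := by ring
      _ ≤ _ := by linarith
  set Z := P.rθ + P.Ca * Real.exp P.q₁ * (2 * Real.exp (P.qmin / 2) / P.qmin) * (P.rθ + P.rw)
    with hZ
  have hZ0 : 0 ≤ Z := le_trans (by positivity) h4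
  have h5 : opNorm P.Γ₂ * (2 / P.q₂ * (P.rθ + M * P.rw)) + P.rw ≤
      P.Dw * opNorm P.Γ₂ * Z + P.Dw * P.rw := by
    have h6 : opNorm P.Γ₂ * (2 / P.q₂ * (P.rθ + M * P.rw)) ≤ opNorm P.Γ₂ * Z := by gcongr
    have h7 : opNorm P.Γ₂ * Z ≤ P.Dw * (opNorm P.Γ₂ * Z) :=
      le_mul_of_one_le_left (by positivity) one_le_Dw
    have h8 : P.rw ≤ P.Dw * P.rw := le_mul_of_one_le_left hrw.le one_le_Dw
    linarith
  have h9 : 0 ≤ opNorm P.Γ₂ * (2 / P.q₂ * (P.rθ + M * P.rw)) + P.rw := by positivity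
  unfold A₄C₁
  rw [mul_assoc _ (Real.exp 1) P.SA, mul_comm (Real.exp 1)]
  refine mul_le_mul h5 ?_ (Real.exp_pos 1).le (h9.trans h5)
  exact le_mul_of_one_le_right (Real.exp_pos 1).le h.one_le_SA

lemma A₅C₁_ge : P.rθ + opNorm (P.W₁ * P.W₂⁻¹) * P.rw ≤ P.A₅C₁ := by
  have hrθ := h.rθ_pos
  have hrw := h.rw_pos
  have hM0 := opNorm_nonneg (P.W₁ * P.W₂⁻¹)
  set M := max (opNorm (P.W₁ * P.W₂⁻¹)) 1 with hM
  have hM1 : 1 ≤ M := le_max_right _ _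
  have hCa : M ≤ P.Ca := le_mul_of_one_le_left (by linarith) one_le_Dθ
  have h1 : P.rw ≤ P.CRw * P.rw := by
    refine le_trans ?_ h.three_halves_add_le_CRw_mul_rw
    have := h.q₂_pos
    have := opNorm_nonneg P.Γ₂
    have : 0 ≤ 3 * P.rθ * opNorm P.Γ₂ / P.q₂ := by positivity
    linarith
  have h2 : opNorm (P.W₁ * P.W₂⁻¹) * P.rw ≤ M * P.rw := by
    gcongr
    exact le_max_left _ _
  have h3 := le_mul_of_one_le_left hrθ.le hM1
  unfold A₅C₁ CRθ
  calc _ ≤ M * (P.rθ + P.rw) := by linarith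
    _ ≤ P.Ca * (3 * P.rθ + P.CRw * P.rw) := by
      have : P.rθ ≤ 3 * P.rθ := by linarith
      have : 0 ≤ P.Ca := by linarith
      gcongr

lemma A₄C₁_nonneg : 0 ≤ P.A₄C₁ := by
  refine le_trans ?_ h.A₄C₁_ge
  have := h.q₂_pos
  have := opNorm_nonneg P.Γ₂
  have := h.rθ_pos
  have := h.rw_pos
  positivity

lemma A₄'_pos : 0 < P.A₄' := by
  have := h.A₄C₁_nonneg
  unfold A₄'
  linarith

lemma A₅'_pos : 0 < P.A₅' := by
  have := h.A₄C₁_nonneg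
  have := h.Cb_nonneg
  have h1 := h.A₅C₁_ge
  have := h.rθ_pos
  have := h.rw_pos
  have := opNorm_nonneg (P.W₁ * P.W₂⁻¹)
  have : 0 ≤ P.rθ + opNorm (P.W₁ * P.W₂⁻¹) * P.rw := by positivity
  have : 0 ≤ P.A₅C₁ := this.trans h1
  unfold A₅'
  positivity

end Valid

variable {d : ℕ} {P : Problem d}

namespace Valid

variable (h : P.Valid)
include h

/-! ### Consequences of the index thresholds -/

omit h in
lemma N_spec : P.N' ≤ P.N ∧ ∃ k : ℕ, 0 < k ∧ P.N + 1 = k ^ k := by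
  have hne : {n : ℕ | P.N' ≤ (n : ℝ) ∧ ∃ k : ℕ, 0 < k ∧ n + 1 = k ^ k}.Nonempty := by
    obtain ⟨k, hk⟩ := exists_nat_ge P.N'
    have h1 : k + 1 + 1 ≤ (k + 2) ^ (k + 2) := Nat.le_self_pow (by omega) _
    refine ⟨(k + 2) ^ (k + 2) - 1, ?_, k + 2, by omega, by omega⟩
    refine hk.trans ?_
    exact_mod_cast (by omega : k ≤ (k + 2) ^ (k + 2) - 1)
  exact Nat.sInf_mem hne

omit h in
lemma thresholds :
    ((KEig P.α P.X₁ : ℝ) ≤ P.N ∧ (KEig P.β P.W₂ : ℝ) ≤ P.N ∧ P.KEpsα ≤ P.N ∧ P.KEpsβ ≤ P.N ∧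
      P.KLarge ≤ P.N ∧ (P.p - 1) ^ (-1 / (P.p - 1)) ≤ P.N) ∧
    (P.KModα (P.β / 2) : ℝ) + 1 ≤ P.N ∧ (P.KModβ (P.β / 2) : ℝ) + 1 ≤ P.N ∧ P.KDoma ≤ P.N ∧
    P.KAa ≤ P.N ∧ P.KAb ≤ P.N ∧ P.Kw ≤ P.N ∧ P.Kθ ≤ P.N ∧ (2 / P.β) ^ (2 / P.β) ≤ P.N := by
  have h1 := (N_spec (P := P)).1
  unfold N' NBdd NRate at h1
  rw [← max_add_add_right] at h1
  simp only [max_le_iff, ← le_sub_iff_add_le] at h1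
  obtain ⟨⟨a1, a2, -, a4, a5, a6, a7⟩, ⟨b1, b2⟩, c1, c2, c3, c4, -, c6⟩ := h1
  refine ⟨⟨a1, a2, a4, a5, a6, a7⟩, le_sub_iff_add_le.1 b1, le_sub_iff_add_le.1 b2.1, ?_,
    c1, c2, c3, c4, c6⟩
  linarith [b2.2.2.2.2.1]

/-- The base `k` of `N + 1 = k ^ k`. -/
lemma exists_base : ∃ k : ℕ, 3 ≤ k ∧ P.N + 1 = k ^ k ∧ 2 ≤ k * P.β ∧
    (P.A₄' / P.sw) ^ (2 / P.β) ≤ k ∧ (P.A₅' / P.sθ) ^ (2 / P.α) ≤ k := by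
  obtain ⟨-, -, -, -, -, -, h1, h2, h3⟩ := thresholds (P := P)
  obtain ⟨k, hk0, hk⟩ := (N_spec (P := P)).2
  have hβ := h.hβ
  -- A threshold of the form y^y ≤ N < k^k becomes y < k.
  have key : ∀ y : ℝ, y ^ y ≤ P.N → y < k := by
    intro y hy
    apply lt_of_rpow_self_lt hk0
    have : ((k : ℝ) ^ k) = P.N + 1 := by exact_mod_cast hk.symm
    rw [this]
    linarith
  have h4 := key _ h3
  have h5 : (2 : ℝ) < k := by
    refine lt_trans ?_ h4
    rw [lt_div_iff₀ hβ]
    linarith [h.β_lt_one]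
  rw [div_lt_iff₀ hβ] at h4
  refine ⟨k, ?_, hk, h4.le, (key _ h1).le, (key _ h2).le⟩
  exact_mod_cast h5

lemma three_le_N : 3 ≤ P.N := by
  obtain ⟨k, hk, he, -⟩ := h.exists_base
  have h1 : 3 ^ 3 ≤ k ^ k := (Nat.pow_le_pow_left hk 3).trans (Nat.pow_le_pow_right (by omega) hk)
  omega

lemma contraction_α {n : ℕ} (hn : P.N ≤ n) : P.q₁ * step P.α n ≤ 1 / 2 ∧
    ∀ x : E d, ‖x - step P.α n • act P.X₁ x‖ ≤ (1 - P.q₁ * step P.α n) * ‖x‖ := by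
  refine norm_id_sub_smul_act_le h.hd h.hX₁ (by unfold step; positivity)
    (step_le_of_KEig_le h.hd h.hX₁ h.α_pos ?_)
  have := (thresholds (P := P)).1.1
  exact (by exact_mod_cast this : KEig P.α P.X₁ ≤ P.N).trans hn

lemma contraction_β {n : ℕ} (hn : P.N ≤ n) : P.q₂ * step P.β n ≤ 1 / 2 ∧
    ∀ x : E d, ‖x - step P.β n • act P.W₂ x‖ ≤ (1 - P.q₂ * step P.β n) * ‖x‖ := by
  refine norm_id_sub_smul_act_le h.hd h.hW₂ (by unfold step; positivity)
    (step_le_of_KEig_le h.hd h.hW₂ h.hβ ?_)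
  have := (thresholds (P := P)).1.2.1
  exact (by exact_mod_cast this : KEig P.β P.W₂ ≤ P.N).trans hn

omit h in
-- Converts a threshold into the statement that the relative decrease z/x of a power is at most a
-- quarter of the contraction rate q x^(-γ), which is possible because γ < 1.
lemma div_le_of_rpow_le {γ q z x : ℝ} (hγ : γ < 1) (hq : 0 < q) (hz : 0 ≤ z) (hx : 0 < x)
    (hle : (4 * z / q) ^ (1 / (1 - γ)) ≤ x) : z / x ≤ q / 4 * x ^ (-γ) := by
  have hγ' : 0 < 1 - γ := by linarith
  have h0 : 0 ≤ 4 * z / q := by positivity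
  have h1 := Real.rpow_le_rpow (Real.rpow_nonneg h0 _) hle hγ'.le
  rw [← Real.rpow_mul h0, one_div_mul_cancel hγ'.ne', Real.rpow_one, div_le_iff₀ hq] at h1
  have h2 : x ^ (1 - γ) = x * x ^ (-γ) := by
    rw [sub_eq_add_neg, Real.rpow_add hx, Real.rpow_one]
  rw [div_le_iff₀ hx]
  rw [h2] at h1
  linarith

lemma div_le_α {x : ℝ} (hx : P.N ≤ x) :
    (P.α - P.β + P.β / 2) / x ≤ P.q₁ / 4 * x ^ (-P.α) := by
  have h3 : (3 : ℝ) ≤ P.N := by exact_mod_cast h.three_le_N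
  have hαβ := h.hαβ
  have hβ := h.hβ
  refine div_le_of_rpow_le h.hα h.q₁_pos (by linarith) (by linarith) ?_
  have h1 := (thresholds (P := P)).2.1
  have h2 : (4 * (P.α - P.β + P.β / 2) / P.q₁) ^ (1 / (1 - P.α)) ≤ P.KModα (P.β / 2) := by
    refine (Nat.le_ceil _).trans ?_
    exact_mod_cast le_max_right _ _
  linarith

lemma div_le_β {x : ℝ} (hx : P.N ≤ x) :
    (P.α - P.β + P.β / 2) / x ≤ P.q₂ / 4 * x ^ (-P.β) := by
  have h3 : (3 : ℝ) ≤ P.N := by exact_mod_cast h.three_le_N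
  have hαβ := h.hαβ
  have hβ := h.hβ
  refine div_le_of_rpow_le h.β_lt_one h.q₂_pos (by linarith) (by linarith) ?_
  have h1 := (thresholds (P := P)).2.2.1
  have h2 : (4 * (P.α - P.β + P.β / 2) / P.q₂) ^ (1 / (1 - P.β)) ≤ P.KModβ (P.β / 2) := by
    refine (Nat.le_ceil _).trans ?_
    exact_mod_cast le_max_right _ _
  linarith

omit h in
lemma step_pos (γ : ℝ) (n : ℕ) : 0 < step γ n := by unfold step; positivity

/-- The relative decrease α/(n+1) is at most half of the contraction rate, which lets a variance
proxy proportional to the step size propagate. -/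
lemma step_succ_α {n : ℕ} (hn : P.N ≤ n) :
    step P.α n * (1 - P.q₁ * step P.α n / 2) ≤ step P.α (n + 1) := by
  have hn' : (P.N : ℝ) ≤ n := by exact_mod_cast hn
  have h1 := h.div_le_α (x := (n : ℝ) + 1) (by linarith)
  have h2 := mul_one_sub_div_le_rpow_neg (x := (n : ℝ) + 1) (s := P.α) (by positivity) h.α_pos.le
  have h3 : P.α / ((n : ℝ) + 1) ≤ 2 * ((P.α - P.β + P.β / 2) / ((n : ℝ) + 1)) := by
    rw [← mul_div_assoc]
    gcongr
    linarith [h.hαβ]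
  have h4 := step_pos P.α n
  unfold step at *
  push_cast
  refine le_trans (mul_le_mul_of_nonneg_left ?_ h4.le) h2
  linarith

lemma step_succ_β {n : ℕ} (hn : P.N ≤ n) :
    step P.β n * (1 - P.q₂ * step P.β n / 2) ≤ step P.β (n + 1) := by
  have hn' : (P.N : ℝ) ≤ n := by exact_mod_cast hn
  have h1 := h.div_le_β (x := (n : ℝ) + 1) (by linarith)
  have h2 := mul_one_sub_div_le_rpow_neg (x := (n : ℝ) + 1) (s := P.β) (by positivity) h.hβ.le
  have h3 : P.β / ((n : ℝ) + 1) ≤ 2 * ((P.α - P.β + P.β / 2) / ((n : ℝ) + 1)) := by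
    rw [← mul_div_assoc]
    gcongr
    linarith [h.hαβ]
  have h4 := step_pos P.β n
  unfold step at *
  push_cast
  refine le_trans (mul_le_mul_of_nonneg_left ?_ h4.le) h2
  linarith

/-! ### The rate functions -/

omit h in
lemma ν_eq (n : ℕ) (γ : ℝ) :
    P.ν n γ = ((n : ℝ) + 1) ^ (-(γ / 2)) * Real.sqrt (P.logTerm n) := by
  rw [ν, logTerm, neg_div]

lemma one_le_a : 1 ≤ P.a := by
  have h1 := h.one_le_d
  rw [a, one_le_div h.hδ₀]
  have := h.hδ₁
  nlinarith

omit h in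
lemma logTerm_eq (n : ℕ) : P.logTerm n = Real.log (P.a * ((n : ℝ) + 1) ^ P.p) := by
  rw [logTerm, a]
  congr 1
  ring

lemma logTerm_mono {m n : ℕ} (hmn : m ≤ n) : P.logTerm m ≤ P.logTerm n := by
  have h1 := h.one_le_a
  have h2 := h.hp
  rw [logTerm_eq, logTerm_eq]
  gcongr

lemma logTerm_pos (n : ℕ) : 0 < P.logTerm n := by
  have h1 := h.one_le_d
  refine Real.log_pos ?_
  rw [lt_div_iff₀ h.hδ₀, one_mul]
  have h2 : 1 ≤ ((n : ℝ) + 1) ^ P.p := Real.one_le_rpow (by simp) (by linarith [h.hp])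
  have := h.hδ₁
  have h3 : 1 ≤ (d : ℝ) ^ 2 := one_le_pow₀ h1
  have h4 : 1 ≤ (d : ℝ) ^ 2 * ((n : ℝ) + 1) ^ P.p := one_le_mul_of_one_le_of_one_le h3 h2
  linarith

lemma ν_pos (n : ℕ) (γ : ℝ) : 0 < P.ν n γ := by
  have := h.logTerm_pos n
  rw [ν_eq]
  positivity

lemma ν_sq (n : ℕ) (γ : ℝ) : P.ν n γ ^ 2 = step γ n * P.logTerm n := by
  rw [ν_eq, mul_pow, Real.sq_sqrt (h.logTerm_pos n).le, ← Real.rpow_natCast, ← Real.rpow_mul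
    (by positivity), step]
  congr 2
  push_cast
  ring

omit h in
lemma ν_α_eq (n : ℕ) : P.ν n P.α = P.ν n P.β * ((n : ℝ) + 1) ^ (-((P.α - P.β) / 2)) := by
  rw [ν_eq, ν_eq, mul_right_comm, ← Real.rpow_add (by positivity)]
  congr 2
  ring

/-- The logarithm in ν increases, so only the power can decrease. -/
lemma ν_succ_ge (n : ℕ) {γ : ℝ} (hγ : 0 ≤ γ) :
    P.ν n γ * (1 - γ / 2 / ((n : ℝ) + 1)) ≤ P.ν (n + 1) γ := by
  rw [ν_eq, ν_eq]
  have h1 := mul_one_sub_div_le_rpow_neg (x := (n : ℝ) + 1) (s := γ / 2) (by positivity)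
    (by linarith)
  have h2 := Real.sqrt_le_sqrt (h.logTerm_mono (Nat.le_succ n))
  push_cast
  calc _ = ((n : ℝ) + 1) ^ (-(γ / 2)) * (1 - γ / 2 / ((n : ℝ) + 1)) * √(P.logTerm n) := by ring
    _ ≤ ((n : ℝ) + 1 + 1) ^ (-(γ / 2)) * √(P.logTerm n) := by gcongr
    _ ≤ _ := by gcongr

omit h in
lemma κ_nonneg (n : ℕ) : 0 ≤ P.κ n := by unfold κ; positivity

lemma κ_pos {n : ℕ} (hn : P.N ≤ n) : 0 < P.κ n := by
  have : (0 : ℝ) < n := by exact_mod_cast (by have := h.three_le_N; omega : 0 < n)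
  unfold κ
  positivity

lemma κ_succ_ge {n : ℕ} (hn : P.N ≤ n) :
    P.κ n * (1 - (P.α - P.β) / n) ≤ P.κ (n + 1) := by
  have : (0 : ℝ) < n := by exact_mod_cast (by have := h.three_le_N; omega : 0 < n)
  have := mul_one_sub_div_le_rpow_neg this (sub_nonneg.2 h.hαβ.le)
  simpa [κ] using this

lemma κ_anti {m n : ℕ} (hm : P.N ≤ m) (hmn : m ≤ n) : P.κ n ≤ P.κ m := by
  have h0 : (0 : ℝ) < m := by exact_mod_cast (by have := h.three_le_N; omega : 0 < m)
  refine Real.rpow_le_rpow_of_nonpos h0 (by exact_mod_cast hmn) (by linarith [h.hαβ])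

lemma κ_le_one : P.κ P.N ≤ 1 := by
  have := h.three_le_N
  refine Real.rpow_le_one_of_one_le_of_nonpos ?_ (by linarith [h.hαβ])
  exact_mod_cast (by omega : 1 ≤ P.N)

lemma ν_β_succ {n : ℕ} (hn : P.N ≤ n) :
    P.ν n P.β * (1 - P.q₂ * step P.β n / 4) ≤ P.ν (n + 1) P.β := by
  refine le_trans ?_ (h.ν_succ_ge n h.hβ.le)
  have hn' : (P.N : ℝ) ≤ n := by exact_mod_cast hn
  have h1 := h.div_le_β (x := (n : ℝ) + 1) (by linarith)
  have h2 := h.ν_pos n P.β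
  have h3 : P.β / 2 / ((n : ℝ) + 1) ≤ (P.α - P.β + P.β / 2) / ((n : ℝ) + 1) := by
    gcongr
    linarith [h.hαβ]
  unfold step
  refine mul_le_mul_of_nonneg_left ?_ h2.le
  linarith

/-- The exponents α - β of κ and β/2 of ν add up to the value in the threshold `KModα (β/2)`. -/
lemma κ_mul_ν_succ {n : ℕ} (hn : P.N ≤ n) :
    P.κ n * P.ν n P.β * (1 - P.q₁ * step P.α n / 3) ≤ P.κ (n + 1) * P.ν (n + 1) P.β := by
  have h3 : (3 : ℝ) ≤ n := by exact_mod_cast h.three_le_N.trans hn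
  have hn' : (P.N : ℝ) ≤ n := by exact_mod_cast hn
  have hκ := h.κ_pos hn
  have hν := h.ν_pos n P.β
  have hαβ := h.hαβ
  have hβ := h.hβ
  have hα := h.hα
  have h1 := h.κ_succ_ge hn
  have h2 := h.ν_succ_ge n h.hβ.le
  have a1 : 0 ≤ 1 - (P.α - P.β) / n := by
    rw [sub_nonneg, div_le_one (by linarith)]
    linarith
  have a2 : 0 ≤ 1 - P.β / 2 / ((n : ℝ) + 1) := by
    rw [sub_nonneg, div_le_one (by linarith)]
    linarith
  have h4 := mul_le_mul h1 h2 (mul_nonneg hν.le a2) (κ_nonneg _)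
  refine le_trans ?_ h4
  have h5 : (P.α - P.β + P.β / 2) / n ≤ P.q₁ * step P.α n / 3 := by
    have h6 := h.div_le_α (x := (n : ℝ) + 1) (by linarith)
    -- The base of κ is n and not n + 1; with n ≥ 3 this costs 4/3 and turns the quarter into a
    -- third.
    have h7 : (P.α - P.β + P.β / 2) / n ≤ 4 / 3 * ((P.α - P.β + P.β / 2) / ((n : ℝ) + 1)) := by
      rw [← mul_div_assoc, div_le_div_iff₀ (by linarith) (by linarith)]
      nlinarith
    unfold step
    linarith
  have h8 : P.β / 2 / ((n : ℝ) + 1) ≤ P.β / 2 / n := by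
    gcongr
    linarith
  have h9 : (P.α - P.β + P.β / 2) / n = (P.α - P.β) / n + P.β / 2 / n := by rw [add_div]
  have h10 : 0 ≤ (P.α - P.β) / n * (P.β / 2 / ((n : ℝ) + 1)) := by
    have : 0 ≤ P.α - P.β := by linarith
    positivity
  calc _ ≤ P.κ n * P.ν n P.β *
        ((1 - (P.α - P.β) / n) * (1 - P.β / 2 / ((n : ℝ) + 1))) := by
        gcongr
        linarith
    _ = _ := by ring

/-- The rate of the coupling term is dominated by the rate of `θ`. -/
lemma κ_mul_ν_le {n : ℕ} (hn : P.N ≤ n) :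
    P.κ n * P.ν n P.β * P.ν P.N P.α ≤ P.κ P.N * P.ν P.N P.β * P.ν n P.α := by
  have h3 : (3 : ℝ) ≤ P.N := by exact_mod_cast h.three_le_N
  have hn' : (P.N : ℝ) ≤ n := by exact_mod_cast hn
  have h1 := h.ν_pos n P.β
  have h2 := h.ν_pos P.N P.β
  have hαβ := h.hαβ
  rw [ν_α_eq, ν_α_eq]
  have e : ∀ x : ℝ, 0 ≤ x → x ^ (-(P.α - P.β)) = (x ^ 2) ^ (-((P.α - P.β) / 2)) := by
    intro x hx
    rw [← Real.rpow_natCast, ← Real.rpow_mul hx]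
    congr 1
    push_cast
    ring
  have key : P.κ n * ((P.N : ℝ) + 1) ^ (-((P.α - P.β) / 2)) ≤
      P.κ P.N * ((n : ℝ) + 1) ^ (-((P.α - P.β) / 2)) := by
    unfold κ
    rw [e n (by positivity), e P.N (by positivity), ← Real.mul_rpow (by positivity) (by positivity),
      ← Real.mul_rpow (by positivity) (by positivity)]
    refine Real.rpow_le_rpow_of_nonpos (by positivity) ?_ (by linarith)
    -- The hint is the factorization n²(N+1) - N²(n+1) = (n - N)(nN + n + N).
    nlinarith [mul_nonneg (sub_nonneg.2 hn') (by positivity : (0 : ℝ) ≤ n * P.N + n + P.N)]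
  calc _ = P.ν n P.β * P.ν P.N P.β *
        (P.κ n * ((P.N : ℝ) + 1) ^ (-((P.α - P.β) / 2))) := by ring
    _ ≤ P.ν n P.β * P.ν P.N P.β * (P.κ P.N * ((n : ℝ) + 1) ^ (-((P.α - P.β) / 2))) := by gcongr
    _ = _ := by ring

lemma κ_mul_ν_N_le : P.κ P.N * P.ν P.N P.β ≤ P.ν P.N P.α := by
  have h3 : (3 : ℝ) ≤ P.N := by exact_mod_cast h.three_le_N
  have h2 := h.ν_pos P.N P.β
  have hαβ := h.hαβ
  rw [ν_α_eq, mul_comm]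
  gcongr
  have e : P.κ P.N = ((P.N : ℝ) ^ 2) ^ (-((P.α - P.β) / 2)) := by
    unfold κ
    rw [← Real.rpow_natCast, ← Real.rpow_mul (by positivity)]
    congr 1
    push_cast
    ring
  rw [e]
  refine Real.rpow_le_rpow_of_nonpos (by positivity) ?_ (by linarith)
  nlinarith

/-- Since a^(γ/p)(n+1)^γ is the power γ/p of a(n+1)^p, the logarithm in the `KLog` estimate is γ/p
times the one in ν², and the factor p/γ in the threshold cancels. -/
lemma mul_ν_le_one {γ c : ℝ} (hγ : 0 < γ) (hc : 0 < c) {n : ℕ}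
    (hn : KLog γ P.p P.a (P.p * c ^ 2 / γ) ≤ n) : c * P.ν n γ ≤ 1 := by
  have hp : 0 < P.p := by linarith [h.hp]
  have ha : 0 < P.a := by linarith [h.one_le_a]
  have h1 := mul_log_le_of_KLog_le hγ ha (by positivity) (show (0 : ℝ) < n + 1 by positivity)
    (hn.trans (by simp))
  have h2 : Real.log (P.a ^ (γ / P.p) * ((n : ℝ) + 1) ^ γ) = γ / P.p * P.logTerm n := by
    rw [logTerm_eq, ← Real.log_rpow (by positivity), Real.mul_rpow ha.le (by positivity),
      ← Real.rpow_mul (by positivity)]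
    congr 3
    field_simp
  rw [h2] at h1
  have h3 : (c * P.ν n γ) ^ 2 ≤ 1 := by
    rw [mul_pow, h.ν_sq, step, Real.rpow_neg (by positivity)]
    have h4 : 0 < ((n : ℝ) + 1) ^ γ := by positivity
    rw [show P.p * c ^ 2 / γ * (γ / P.p * P.logTerm n) = c ^ 2 * P.logTerm n by field_simp] at h1
    calc _ = c ^ 2 * P.logTerm n / ((n : ℝ) + 1) ^ γ := by ring
      _ ≤ 1 := (div_le_one h4).2 h1
  exact (sq_le_one_iff₀ (mul_nonneg hc.le (h.ν_pos n γ).le)).1 h3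

lemma sqrt_Vw_mul_ν_le {n : ℕ} (hn : P.N ≤ n) : Real.sqrt P.Vw * P.ν n P.β ≤ P.rw / 2 := by
  have hr := h.rw_pos
  have hV := Real.sqrt_pos.2 h.Vw_pos
  have hβ := h.hβ
  have h1 : P.KEpsβ ≤ n := (thresholds (P := P)).1.2.2.2.1.trans (by exact_mod_cast hn)
  unfold KEpsβ at h1
  -- This c makes p c²/β the last argument in `KEpsβ`.
  have h2 := h.mul_ν_le_one (c := 2 * Real.sqrt P.Vw / P.rw) hβ (by positivity) (n := n) (by
    rw [div_pow, mul_pow, Real.sq_sqrt h.Vw_pos.le]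
    convert h1 using 2
    field_simp
    ring)
  rw [div_mul_eq_mul_div, div_le_one hr] at h2
  linarith

lemma sqrt_Vθ_mul_ν_le {n : ℕ} (hn : P.N ≤ n) : Real.sqrt P.Vθ * P.ν n P.α ≤ P.rθ / 2 := by
  have hr := h.rθ_pos
  have hV := Real.sqrt_pos.2 h.Vθ_pos
  have hα := h.α_pos
  have h1 : P.KEpsα ≤ n := (thresholds (P := P)).1.2.2.1.trans (by exact_mod_cast hn)
  unfold KEpsα at h1
  have h2 := h.mul_ν_le_one (c := 2 * Real.sqrt P.Vθ / P.rθ) hα (by positivity) (n := n) (by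
    rw [div_pow, mul_pow, Real.sq_sqrt h.Vθ_pos.le]
    convert h1 using 2
    field_simp
    ring)
  rw [div_mul_eq_mul_div, div_le_one hr] at h2
  linarith

lemma A₄C₀_mul_ν_le : P.A₄C₀ * P.ν P.N P.β ≤ 1 :=
  h.mul_ν_le_one h.hβ h.A₄C₀_pos (thresholds (P := P)).2.2.2.2.1

lemma max_mul_ν_le : max (P.Cb * P.A₄C₀) P.A₅C₀ * P.ν P.N P.α ≤ 1 :=
  h.mul_ν_le_one h.α_pos (lt_max_of_lt_right h.A₅C₀_pos) (thresholds (P := P)).2.2.2.2.2.1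

/-- The noise in θ enters the recursion of w through Γ₂t; it has to be dominated by the rate of w.
-/
lemma sqrt_Vθ_mul_ν_le_sqrt_Vw {n : ℕ} (hn : P.N ≤ n) :
    Real.sqrt P.Vθ * P.ν n P.α ≤ Real.sqrt P.Vw * P.ν n P.β := by
  have hs : 0 < P.α - P.β := by linarith [h.hαβ]
  have hLθ := h.Lθ_pos
  have hLw := h.Lw_pos
  have hcθ := h.CVarα_pos
  have hcw := h.CVarβ_pos
  have hd := h.d_pos
  have h0 : (0 : ℝ) < (n : ℝ) + 1 := by positivity
  have h1 : P.KDoma ≤ (n : ℝ) + 1 := by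
    have h1 := (thresholds (P := P)).2.2.2.1
    have : (P.N : ℝ) ≤ n := by exact_mod_cast hn
    linarith
  unfold KDoma at h1
  have hx : 0 ≤ P.Lθ * CVar P.α P.q₁ / (P.Lw * CVar P.β P.q₂) := by positivity
  have h2 := Real.rpow_le_rpow (Real.rpow_nonneg hx _) h1 hs.le
  rw [← Real.rpow_mul hx, one_div_mul_cancel hs.ne', Real.rpow_one,
    div_le_iff₀ (by positivity)] at h2
  have h3 : P.Vθ ≤ ((n : ℝ) + 1) ^ (P.α - P.β) * P.Vw := by
    unfold Vθ Vw
    calc _ = (d : ℝ) ^ 3 * (P.Lθ * CVar P.α P.q₁) := by ring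
      _ ≤ (d : ℝ) ^ 3 * (((n : ℝ) + 1) ^ (P.α - P.β) * (P.Lw * CVar P.β P.q₂)) := by gcongr
      _ = _ := by ring
  refine abs_le_of_sq_le_sq' ?_ (mul_nonneg (Real.sqrt_nonneg _) (h.ν_pos _ _).le) |>.2
  rw [mul_pow, mul_pow, Real.sq_sqrt h.Vθ_pos.le, Real.sq_sqrt h.Vw_pos.le, h.ν_sq, h.ν_sq,
    ← mul_assoc, ← mul_assoc]
  refine mul_le_mul_of_nonneg_right ?_ (h.logTerm_pos n).le
  unfold step
  calc P.Vθ * ((n : ℝ) + 1) ^ (-P.α) ≤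
        ((n : ℝ) + 1) ^ (P.α - P.β) * P.Vw * ((n : ℝ) + 1) ^ (-P.α) := by gcongr
    _ = P.Vw * (((n : ℝ) + 1) ^ (P.α - P.β) * ((n : ℝ) + 1) ^ (-P.α)) := by ring
    _ = _ := by
      rw [← Real.rpow_add h0]
      congr 2
      ring

/-- `KLarge` makes the whole influence of v on t cost at most half of the bound 3r_θ. -/
lemma κ_mul_Cb_le :
    P.κ P.N * (P.Cb * (P.CRw * P.rw) + opNorm (P.W₁ * P.W₂⁻¹) * P.rw) ≤ 3 / 2 * P.rθ := by
  have hs : 0 < P.α - P.β := by linarith [h.hαβ]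
  have hrθ := h.rθ_pos
  have hrw := h.rw_pos
  have hq₁ := h.q₁_pos
  have hq₂ := h.q₂_pos
  have hW₁ := opNorm_nonneg P.W₁
  have hW₂ := opNorm_nonneg P.W₂⁻¹
  have hΓ := opNorm_nonneg P.Γ₂
  have hC := h.CT_nonneg
  have hDw := zero_le_one.trans (one_le_Dw (P := P))
  have hDθ := zero_le_one.trans (one_le_Dθ (P := P))
  have hV := h.CRw_mul_rw_pos
  have hCR : 0 < P.CRw := pos_of_mul_pos_left hV hrw.le
  have hN : (0 : ℝ) < P.N := by exact_mod_cast (by have := h.three_le_N; omega : 0 < P.N)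
  have h1 := (thresholds (P := P)).1.2.2.2.2.1
  unfold KLarge at h1
  set X := 2 / 3 * P.CLargeθ + 2 / 3 * P.CLargew * (P.rw / P.rθ) with hX
  have hX0 : 0 ≤ X := by
    rw [hX]
    unfold CLargeθ CLargew CRθ
    positivity
  have h2 := Real.rpow_le_rpow (Real.rpow_nonneg hX0 _) h1 hs.le
  rw [← Real.rpow_mul hX0, one_div_mul_cancel hs.ne', Real.rpow_one] at h2
  have h3 : P.κ P.N * X ≤ 1 := by
    unfold κ
    rw [Real.rpow_neg hN.le, inv_mul_le_one₀ (by positivity)]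
    exact h2
  have h4 : P.Cb * (P.CRw * P.rw) + opNorm (P.W₁ * P.W₂⁻¹) * P.rw ≤ 3 / 2 * P.rθ * X := by
    have e : 3 / 2 * P.rθ * X = opNorm P.W₁ * opNorm P.W₂⁻¹ *
        ((1 + 2 * Real.exp (P.q₁ / 2) / P.q₁ * P.CT * P.Dθ) * (P.CRw * P.rw) + P.rw) := by
      have e1 := h.CRw_mul_rw
      rw [hX]
      unfold CLargeθ CLargew CRθ
      field_simp at e1 ⊢
      linear_combination (-opNorm P.W₁ * opNorm P.W₂⁻¹ * P.q₁) * e1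
    rw [e]
    unfold Cb
    rw [mul_assoc, ← mul_add]
    gcongr
    exact opNorm_mul_le _ _
  calc _ ≤ P.κ P.N * (3 / 2 * P.rθ * X) := mul_le_mul_of_nonneg_left h4 (κ_nonneg _)
    _ = 3 / 2 * P.rθ * (P.κ P.N * X) := by ring
    _ ≤ 3 / 2 * P.rθ * 1 := by gcongr
    _ = _ := mul_one _

/-- The small-gain condition for the loop from v to t and back. It needs no threshold of its own,
because the bound for ‖v‖ contains 3r_θ‖Γ₂‖/q₂. -/
lemma κ_mul_Cb_mul_le : P.κ P.N * P.Cb * opNorm P.Γ₂ ≤ P.q₂ / 2 := by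
  have hrθ := h.rθ_pos
  have hq₂ := h.q₂_pos
  have h1 := h.κ_mul_Cb_le
  have h2 := h.three_halves_add_le_CRw_mul_rw
  have hrw := h.rw_pos
  have hκ := κ_nonneg (P := P) P.N
  have hCb := h.Cb_nonneg
  have hy := opNorm_nonneg (P.W₁ * P.W₂⁻¹)
  have h3 : P.κ P.N * (P.Cb * (3 * P.rθ * opNorm P.Γ₂ / P.q₂)) ≤ 3 / 2 * P.rθ := by
    refine le_trans ?_ h1
    gcongr
    have : 0 ≤ opNorm (P.W₁ * P.W₂⁻¹) * P.rw := by positivity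
    have : P.Cb * (3 * P.rθ * opNorm P.Γ₂ / P.q₂) ≤ P.Cb * (P.CRw * P.rw) := by
      gcongr
      linarith
    linarith
  have e : P.κ P.N * (P.Cb * (3 * P.rθ * opNorm P.Γ₂ / P.q₂)) =
    (3 * P.rθ / P.q₂) * (P.κ P.N * P.Cb * opNorm P.Γ₂) := by ring
  rw [e, ← le_div_iff₀' (by positivity)] at h3
  refine h3.trans_eq ?_
  field_simp

/-- At later projection times the rates are inside the projection balls. -/
lemma mul_ν_le_of_projection {γ A s : ℝ} (hγ : 0 < γ) (hA : 0 < A) (hs : 0 < s)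
    {k n m : ℕ} (hk3 : 3 ≤ k) (hkN : P.N + 1 = k ^ k) (hkγ : 2 ≤ k * γ)
    (h1 : (A / s) ^ (2 / γ) ≤ k) (hn : P.N < n) (hm : n + 1 = m ^ m) :
    A * P.ν n γ ≤ s * P.ν P.N γ := by
  have hk0 : (0 : ℝ) < k := by exact_mod_cast (by omega : 0 < k)
  have hp : 0 < P.p := by linarith [h.hp]
  have hkm : k + 1 ≤ m := by
    by_contra hc
    have hmk : m ≤ k := by omega
    have : m ^ m ≤ k ^ k :=
      (Nat.pow_le_pow_left hmk m).trans (Nat.pow_le_pow_right (by omega) hmk)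
    omega
  have h2 := rpow_neg_mul_log_ratio_le (γ := γ) hγ hp h.one_le_a hk3 hkγ hkm
  have e1 : ((m : ℝ) ^ m) = n + 1 := by exact_mod_cast hm.symm
  have e2 : ((k : ℝ) ^ k) = P.N + 1 := by exact_mod_cast hkN.symm
  rw [e1, e2, ← logTerm_eq, ← logTerm_eq] at h2
  have h3 : (A / s) ^ 2 ≤ (k : ℝ) ^ γ := by
    have h4 := Real.rpow_le_rpow (by positivity) h1 hγ.le
    rwa [← Real.rpow_mul (by positivity), div_mul_cancel₀ _ hγ.ne', Real.rpow_two] at h4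
  refine abs_le_of_sq_le_sq' ?_ (mul_nonneg hs.le (h.ν_pos _ _).le) |>.2
  rw [mul_pow, mul_pow, h.ν_sq, h.ν_sq]
  have h5 : 0 ≤ step γ n * P.logTerm n := mul_nonneg (step_pos _ _).le (h.logTerm_pos n).le
  calc A ^ 2 * (step γ n * P.logTerm n) = s ^ 2 * ((A / s) ^ 2 * (step γ n * P.logTerm n)) := by
        field_simp
    _ ≤ s ^ 2 * ((k : ℝ) ^ γ * (step γ n * P.logTerm n)) := by gcongr
    _ ≤ _ := mul_le_mul_of_nonneg_left h2 (sq_nonneg s)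

lemma A₄'_mul_ν_le {n m : ℕ} (hn : P.N < n) (hm : n + 1 = m ^ m) :
    P.A₄' * P.ν n P.β ≤ P.sw * P.ν P.N P.β := by
  obtain ⟨k, hk3, hkN, hkβ, h1, -⟩ := h.exists_base
  exact h.mul_ν_le_of_projection h.hβ h.A₄'_pos h.sw_pos hk3 hkN hkβ h1 hn hm

lemma A₅'_mul_ν_le {n m : ℕ} (hn : P.N < n) (hm : n + 1 = m ^ m) :
    P.A₅' * P.ν n P.α ≤ P.sθ * P.ν P.N P.α := by
  obtain ⟨k, hk3, hkN, hkβ, -, h1⟩ := h.exists_base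
  refine h.mul_ν_le_of_projection h.α_pos h.A₅'_pos h.sθ_pos hk3 hkN (hkβ.trans ?_) h1 hn hm
  have := h.hαβ
  gcongr

end Valid

/-! ### Normalized rates and the induction invariant. -/

variable {d : ℕ} (P : Problem d)

/-- The coupling matrix `W₁ W₂⁻¹`. -/
def Y : Matrix (Fin d) (Fin d) ℝ := P.W₁ * P.W₂⁻¹

/-- The rate of `w`, normalized at `N`. -/
def gw (n : ℕ) : ℝ := P.ν n P.β / P.ν P.N P.β

/-- The rate of `θ`, normalized at `N`. -/
def gθ (n : ℕ) : ℝ := P.ν n P.α / P.ν P.N P.α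

/-- The rate of the coupling term, normalized at `N`. -/
def gκ (n : ℕ) : ℝ := P.κ n / P.κ P.N * P.gw n

/-- The bound on the noise part of `w` at the index `N`. -/
def noiseBound : ℝ := Real.sqrt P.Vw * P.ν P.N P.β

/-- The constant in the rate of the noiseless part of `w`. -/
def Kz : ℝ :=
  4 * opNorm P.Γ₂ / P.q₂ * (P.rθ + P.κ P.N * opNorm P.Y * P.rw + P.noiseBound) +
    2 * P.noiseBound + P.rw

/-- The constant in the rate of the noiseless part of the decoupled `θ`. -/
def Kb : ℝ :=
  P.rθ + P.κ P.N * opNorm P.Y * P.rw +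
    3 / 2 * (P.κ P.N * (P.CT * opNorm P.Y / P.q₁) * (P.Kz + P.noiseBound))

/-- The induction invariant: bounds on the noiseless parts of the deviations `t = θ - θ*` and
`v = w - w*`, with noise parts `lθ` and `lw`. -/
structure Inv (n : ℕ) (t v lθ lw : E d) : Prop where
  z_le : ‖v - lw‖ ≤ P.rw + 3 * P.rθ * opNorm P.Γ₂ / P.q₂
  z_rate : ‖v - lw‖ ≤ P.Kz * P.gw n
  b_le : ‖t - P.κ n • act P.Y v - lθ‖ ≤ P.rθ + P.κ P.N * opNorm P.Y * P.rw +
    P.κ P.N * (P.CT * opNorm P.Y / P.q₁) * (P.CRw * P.rw)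
  b_rate : ‖t - P.κ n • act P.Y v - lθ‖ ≤ P.Kb * P.gκ n

variable {P}

namespace Valid

variable (h : P.Valid)
include h

/-! ### The decoupled recursion -/

lemma act_W₂_wstar : act P.W₂ P.wstar = P.v₂ - act P.Γ₂ P.θstar := by
  rw [wstar, ← mul_apply_eq_comp, ← act_mul, Matrix.mul_nonsing_inv _ h.hW₂.isUnit_det, act_one,
    one_apply_eq_self]

lemma act_X₁_θstar : act P.X₁ P.θstar = P.b₁ := by
  rw [θstar, ← mul_apply_eq_comp, ← act_mul, Matrix.mul_nonsing_inv _ h.hX₁.isUnit_det, act_one,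
    one_apply_eq_self]

lemma act_Y_act_W₂ (x : E d) : act P.Y (act P.W₂ x) = act P.W₁ x := by
  rw [← mul_apply_eq_comp, ← act_mul, Y, Matrix.mul_assoc,
    Matrix.nonsing_inv_mul _ h.hW₂.isUnit_det, Matrix.mul_one]

omit h in
lemma act_X₁ (x : E d) : act P.X₁ x = act P.Γ₁ x - act P.Y (act P.Γ₂ x) := by
  rw [X₁, act_sub, _root_.sub_apply, act_mul, mul_apply_eq_comp, Y]

lemma h₂_eq (θ w : E d) :
    P.h₂ θ w = -act P.Γ₂ (θ - P.θstar) - act P.W₂ (w - P.wstar) := by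
  rw [h₂, map_sub, map_sub, h.act_W₂_wstar]
  abel

lemma h₁_eq (θ w : E d) :
    P.h₁ θ w = -act P.Γ₁ (θ - P.θstar) - act P.W₁ (w - P.wstar) := by
  have h1 := h.act_X₁_θstar
  rw [act_X₁, b₁] at h1
  have h2 : act P.W₁ P.wstar = act P.Y P.v₂ - act P.Y (act P.Γ₂ P.θstar) := by
    rw [← h.act_Y_act_W₂, h.act_W₂_wstar, map_sub]
  have h3 : P.v₁ = act P.Γ₁ P.θstar - act P.Y (act P.Γ₂ P.θstar) + act P.Y P.v₂ :=
    sub_eq_iff_eq_add.1 h1.symm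
  rw [h₁, map_sub, map_sub, h2, h3]
  abel

omit h in
lemma step_α_eq (n : ℕ) : step P.α n = P.κ (n + 1) * step P.β n := by
  unfold step κ
  push_cast
  rw [← Real.rpow_add (by positivity)]
  congr 1
  ring

lemma w_recursion (n : ℕ) (θ w M : E d) :
    w + step P.β n • (P.h₂ θ w + M) - P.wstar =
      (w - P.wstar - step P.β n • act P.W₂ (w - P.wstar)) -
        step P.β n • act P.Γ₂ (θ - P.θstar) + step P.β n • M := by
  rw [h.h₂_eq]
  module

/-- Since κₙ₊₁βₙ = αₙ and YW₂ = W₁, the terms in W₁v cancel, and Γ₁t - YΓ₂t = X₁t. Rewriting t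
through the decoupled variable leaves the last bracket. -/
lemma θ_recursion (n : ℕ) (θ w M₁ M₂ : E d) :
    θ + step P.α n • (P.h₁ θ w + M₁) - P.θstar -
        P.κ (n + 1) • act P.Y (w + step P.β n • (P.h₂ θ w + M₂) - P.wstar) =
      ((θ - P.θstar - P.κ n • act P.Y (w - P.wstar)) -
        step P.α n • act P.X₁ (θ - P.θstar - P.κ n • act P.Y (w - P.wstar))) +
      step P.α n • (M₁ - act P.Y M₂) +
      ((P.κ n - P.κ (n + 1)) • act P.Y (w - P.wstar) -
        (step P.α n * P.κ n) • act P.X₁ (act P.Y (w - P.wstar))) := by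
  rw [h.w_recursion, h.h₁_eq]
  set t := θ - P.θstar with ht
  set v := w - P.wstar
  have e : θ = t + P.θstar := by rw [ht]; abel
  rw [e]
  simp only [map_sub, map_add, map_smul, h.act_Y_act_W₂, step_α_eq n]
  rw [act_X₁ t]
  module

/-- The relative decrease of κ is at most (α - β)/n, which is at most 2(α - β) steps because α < 1;
so both terms are of order αₙκₙ. -/
lemma norm_coupling_le {n : ℕ} (hn : P.N ≤ n) (x : E d) :
    ‖(P.κ n - P.κ (n + 1)) • x - (step P.α n * P.κ n) • act P.X₁ x‖ ≤
      step P.α n * P.κ n * P.CT * ‖x‖ := by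
  have hκ := h.κ_pos hn
  have hα := step_pos P.α n
  have hαβ := h.hαβ
  have hα1 := h.hα
  have h3 : (3 : ℝ) ≤ n := by exact_mod_cast h.three_le_N.trans hn
  have h1 := h.κ_succ_ge hn
  have h2 : 0 ≤ P.κ n - P.κ (n + 1) := sub_nonneg.2 (h.κ_anti hn (Nat.le_succ n))
  have h4 : (P.α - P.β) / n ≤ 2 * (P.α - P.β) * step P.α n := by
    have h5 : ((n : ℝ) + 1)⁻¹ ≤ step P.α n := by
      rw [step, ← Real.rpow_neg_one]
      exact Real.rpow_le_rpow_of_exponent_le (by linarith) (by linarith)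
    have h6 : (n : ℝ)⁻¹ ≤ 2 * ((n : ℝ) + 1)⁻¹ := by
      rw [← div_eq_mul_inv, ← one_div, div_le_div_iff₀ (by linarith) (by linarith)]
      linarith
    rw [div_eq_mul_inv]
    have h7 : 0 ≤ P.α - P.β := by linarith
    calc _ ≤ (P.α - P.β) * (2 * step P.α n) := by
          gcongr
          linarith
      _ = _ := by ring
  have h8 : P.κ n - P.κ (n + 1) ≤ P.κ n * (2 * (P.α - P.β) * step P.α n) := by
    have := mul_le_mul_of_nonneg_left h4 hκ.le
    linarith
  have hX := opNorm_nonneg P.X₁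
  have hx := norm_nonneg x
  refine (norm_sub_le _ _).trans ?_
  rw [norm_smul, norm_smul, Real.norm_of_nonneg h2, Real.norm_of_nonneg (by positivity)]
  calc _ ≤ P.κ n * (2 * (P.α - P.β) * step P.α n) * ‖x‖ +
        step P.α n * P.κ n * (opNorm P.X₁ * ‖x‖) := by
        gcongr
        exact norm_act_le _ _
    _ = step P.α n * P.κ n * (opNorm P.X₁ + 2 * (P.α - P.β)) * ‖x‖ := by ring
    _ ≤ _ := by
        gcongr
        unfold CT
        have : 0 ≤ 2 * (P.α - P.β) * opNorm P.X₁ := by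
          apply mul_nonneg _ hX
          linarith
        linarith

/-! ### Properties of the normalized rates -/

lemma gw_nonneg (n : ℕ) : 0 ≤ P.gw n := (div_pos (h.ν_pos _ _) (h.ν_pos _ _)).le

lemma gθ_nonneg (n : ℕ) : 0 ≤ P.gθ n := (div_pos (h.ν_pos _ _) (h.ν_pos _ _)).le

lemma gw_N : P.gw P.N = 1 := div_self (h.ν_pos _ _).ne'

lemma gκ_N : P.gκ P.N = 1 := by
  rw [gκ, h.gw_N, div_self (h.κ_pos le_rfl).ne', one_mul]

lemma gκ_nonneg {n : ℕ} : 0 ≤ P.gκ n :=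
  mul_nonneg (div_nonneg (κ_nonneg _) (κ_nonneg _)) (h.gw_nonneg n)

lemma gκ_le_gw {n : ℕ} (hn : P.N ≤ n) : P.gκ n ≤ P.gw n :=
  mul_le_of_le_one_left (h.gw_nonneg n) ((div_le_one (h.κ_pos le_rfl)).2 (h.κ_anti le_rfl hn))

lemma κ_mul_gw (n : ℕ) : P.κ n * P.gw n = P.κ P.N * P.gκ n := by
  have := h.κ_pos le_rfl
  rw [gκ]
  field_simp

lemma gκ_le_gθ {n : ℕ} (hn : P.N ≤ n) : P.gκ n ≤ P.gθ n := by
  have h1 := h.κ_mul_ν_le hn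
  have h2 := h.κ_pos (le_refl P.N)
  have h3 := h.ν_pos P.N P.β
  have h4 := h.ν_pos P.N P.α
  rw [gκ, gw, gθ, div_mul_div_comm, div_le_div_iff₀ (by positivity) h4]
  linarith

lemma gw_succ {n : ℕ} (hn : P.N ≤ n) :
    P.gw n * (1 - P.q₂ * step P.β n / 4) ≤ P.gw (n + 1) := by
  have h1 := h.ν_β_succ hn
  have h3 := h.ν_pos P.N P.β
  rw [gw, gw, div_mul_eq_mul_div]
  gcongr

lemma gκ_succ {n : ℕ} (hn : P.N ≤ n) :
    P.gκ n * (1 - P.q₁ * step P.α n / 3) ≤ P.gκ (n + 1) := by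
  have h1 := h.κ_mul_ν_succ hn
  have h2 := h.κ_pos (le_refl P.N)
  have h3 := h.ν_pos P.N P.β
  rw [gκ, gκ, gw, gw, div_mul_div_comm, div_mul_div_comm, div_mul_eq_mul_div]
  gcongr

lemma noiseBound_pos : 0 < P.noiseBound := mul_pos (Real.sqrt_pos.2 h.Vw_pos) (h.ν_pos _ _)

lemma noiseBound_mul_gw (n : ℕ) : P.noiseBound * P.gw n = Real.sqrt P.Vw * P.ν n P.β := by
  have := h.ν_pos P.N P.β
  rw [noiseBound, gw]
  field_simp

/-! ### The constants of the invariant -/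

lemma Kz_nonneg : 0 ≤ P.Kz := by
  have := h.noiseBound_pos
  have := h.rθ_pos
  have := h.rw_pos
  have := h.q₂_pos
  have := opNorm_nonneg P.Γ₂
  have := opNorm_nonneg P.Y
  have := κ_nonneg (P := P) P.N
  unfold Kz
  positivity

lemma rw_le_Kz : P.rw ≤ P.Kz := by
  have := h.noiseBound_pos
  have := h.rθ_pos
  have := h.rw_pos
  have := h.q₂_pos
  have := opNorm_nonneg P.Γ₂
  have := opNorm_nonneg P.Y
  have := κ_nonneg (P := P) P.N
  unfold Kz
  have : 0 ≤ 4 * opNorm P.Γ₂ / P.q₂ *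
    (P.rθ + P.κ P.N * opNorm P.Y * P.rw + P.noiseBound) := by positivity
  linarith

lemma Kb_nonneg : 0 ≤ P.Kb := by
  have := h.noiseBound_pos
  have := h.Kz_nonneg
  have := h.rθ_pos
  have := h.rw_pos
  have := h.q₁_pos
  have := h.CT_nonneg
  have := opNorm_nonneg P.Y
  have := κ_nonneg (P := P) P.N
  unfold Kb
  positivity

/-- The coupling enters `Kb` with factor 3/2, and `Cb` has room for the factor 2. -/
lemma Kb_add_le : P.Kb + P.κ P.N * opNorm P.Y * (P.Kz + P.noiseBound) ≤
    P.rθ + P.κ P.N * opNorm P.Y * P.rw + P.κ P.N * P.Cb * (P.Kz + P.noiseBound) := by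
  have hE := h.noiseBound_pos
  have hK := h.Kz_nonneg
  have hq := h.q₁_pos
  have hC := h.CT_nonneg
  have hy := opNorm_nonneg P.Y
  have hκ := κ_nonneg (P := P) P.N
  have h1 : opNorm P.Y * (1 + 2 * P.CT / P.q₁) ≤ P.Cb := h.mul_one_add_le_Cb
  have h2 : 0 ≤ P.κ P.N * (P.Kz + P.noiseBound) := by positivity
  have h3 := mul_le_mul_of_nonneg_left h1 h2
  have h4 : 0 ≤ P.κ P.N * (P.CT * opNorm P.Y / P.q₁) * (P.Kz + P.noiseBound) := by positivity
  have e : P.κ P.N * (P.Kz + P.noiseBound) * (opNorm P.Y * (1 + 2 * P.CT / P.q₁)) =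
    P.κ P.N * opNorm P.Y * (P.Kz + P.noiseBound) +
      2 * (P.κ P.N * (P.CT * opNorm P.Y / P.q₁) * (P.Kz + P.noiseBound)) := by ring
  unfold Kb
  linarith

/-- `Kz` also occurs on the left. The small-gain condition bounds that occurrence by q₂/2 times `Kz`
plus noise; the 4 and the 2 in the definition of `Kz` make the rest fit into a further quarter. -/
lemma Γ₂_mul_le : opNorm P.Γ₂ * (P.Kb + P.κ P.N * opNorm P.Y * (P.Kz + P.noiseBound) +
    P.noiseBound) ≤ 3 / 4 * P.q₂ * P.Kz := by
  have hE := h.noiseBound_pos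
  have hK := h.Kz_nonneg
  have hq := h.q₂_pos
  have hG := opNorm_nonneg P.Γ₂
  have hrw := h.rw_pos
  have h1 := h.Kb_add_le
  have h2 := mul_le_mul_of_nonneg_right h.κ_mul_Cb_mul_le (add_nonneg hK hE.le)
  have e : P.q₂ * P.Kz =
    4 * (opNorm P.Γ₂ * (P.rθ + P.κ P.N * opNorm P.Y * P.rw + P.noiseBound)) +
      P.q₂ * (2 * P.noiseBound) + P.q₂ * P.rw := by
    unfold Kz
    field_simp
  have h3 := mul_le_mul_of_nonneg_left h1 hG
  have h4 : 0 < P.q₂ * P.rw := by positivity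
  linarith

/-- The noise is proportional to ν at N and goes into the A₄C₀ term, apart from one copy, which is
at most r_w/2 and goes into A₄C₁. -/
lemma Kz_add_le : P.Kz + P.noiseBound ≤ P.A₄C₁ + P.A₄C₀ * P.ν P.N P.β := by
  have hE := h.noiseBound_pos
  have hEr : P.noiseBound ≤ P.rw / 2 := h.sqrt_Vw_mul_ν_le le_rfl
  have hq := h.q₂_pos
  have hG := opNorm_nonneg P.Γ₂
  have hy : 0 ≤ opNorm P.Y := opNorm_nonneg P.Y
  have hrθ := h.rθ_pos
  have hrw := h.rw_pos
  have hν := h.ν_pos P.N P.β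
  have hκ := κ_nonneg (P := P) P.N
  have h1 := h.A₄C₁_ge
  have h2 := mul_le_mul_of_nonneg_right h.A₄C₀_ge hν.le
  have he : 2 ≤ Real.exp 1 := by
    have := Real.add_one_le_exp (1 : ℝ)
    linarith
  have he2 : 2 ≤ Real.exp 2 := by
    have := Real.add_one_le_exp (2 : ℝ)
    linarith
  set M := max (opNorm (P.W₁ * P.W₂⁻¹)) 1 with hM
  have h3 : P.κ P.N * opNorm P.Y * P.rw ≤ M * P.rw := by
    have h5 : opNorm P.Y ≤ M := le_max_left _ _
    have h6 := h.κ_le_one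
    calc _ ≤ 1 * M * P.rw := by gcongr
      _ = _ := by ring
  have h4 : 4 * opNorm P.Γ₂ / P.q₂ * (P.rθ + P.κ P.N * opNorm P.Y * P.rw) +
      (P.rw + P.noiseBound) ≤ P.A₄C₁ := by
    refine le_trans ?_ h1
    calc _ ≤ 4 * opNorm P.Γ₂ / P.q₂ * (P.rθ + M * P.rw) + 2 * P.rw := by
          gcongr
          linarith
      _ = 2 * (opNorm P.Γ₂ * (2 / P.q₂ * (P.rθ + M * P.rw)) + P.rw) := by ring
      _ ≤ _ := by
          have hM1 : 1 ≤ M := le_max_right _ _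
          gcongr
  have h5 : (4 * opNorm P.Γ₂ / P.q₂ + 2) * P.noiseBound ≤ P.A₄C₀ * P.ν P.N P.β := by
    refine le_trans ?_ h2
    rw [mul_assoc]
    refine mul_le_mul_of_nonneg_right ?_ hE.le
    have h6 : 2 * (2 * opNorm P.Γ₂ / P.q₂) ≤ Real.exp 2 * (2 * opNorm P.Γ₂ / P.q₂) := by gcongr
    have e : 4 * opNorm P.Γ₂ / P.q₂ = 2 * (2 * opNorm P.Γ₂ / P.q₂) := by ring
    linarith
  unfold Kz
  linarith

lemma Kz_add_le_A₄' : P.Kz + P.noiseBound ≤ P.A₄' := by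
  have h1 := h.Kz_add_le
  have h2 := h.A₄C₀_mul_ν_le
  unfold A₄'
  linarith

lemma sqrt_Vθ_mul_ν_N_le : Real.sqrt P.Vθ * P.ν P.N P.α ≤ 1 := by
  have hν := h.ν_pos P.N P.α
  refine le_trans ?_ h.max_mul_ν_le
  gcongr
  refine le_trans ?_ (le_max_right _ _)
  unfold A₅C₀
  refine Real.sqrt_le_sqrt ?_
  linarith [h.Vθ_pos]

/-- The factor κ at N turns ν for β into at most ν for α, so thresholds (c) reduce the two
contributions of noise to at most 1 each. -/
lemma Kb_add_le_A₅' : P.Kb + P.κ P.N * opNorm P.Y * (P.Kz + P.noiseBound) +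
    Real.sqrt P.Vθ * P.ν P.N P.α ≤ P.A₅' := by
  have h1 := h.Kb_add_le
  have h2 := h.Kz_add_le
  have h3 := h.sqrt_Vθ_mul_ν_N_le
  have hCb := h.Cb_nonneg
  have hκ := κ_nonneg (P := P) P.N
  have hκ1 := h.κ_le_one
  have hA := h.A₄C₁_nonneg
  have hA0 := h.A₄C₀_pos
  have hy := opNorm_nonneg P.Y
  have hrw := h.rw_pos
  have hrθ := h.rθ_pos
  have h4 : P.rθ + opNorm P.Y * P.rw ≤ P.A₅C₁ := h.A₅C₁_ge
  have h5 : P.κ P.N * P.Cb * (P.Kz + P.noiseBound) ≤ P.Cb * P.A₄C₁ + 1 := by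
    calc _ ≤ P.κ P.N * P.Cb * (P.A₄C₁ + P.A₄C₀ * P.ν P.N P.β) := by gcongr
      _ = P.κ P.N * (P.Cb * P.A₄C₁) + P.Cb * P.A₄C₀ * (P.κ P.N * P.ν P.N P.β) := by ring
      _ ≤ 1 * (P.Cb * P.A₄C₁) + P.Cb * P.A₄C₀ * P.ν P.N P.α := by
          gcongr
          exact h.κ_mul_ν_N_le
      _ ≤ P.Cb * P.A₄C₁ + max (P.Cb * P.A₄C₀) P.A₅C₀ * P.ν P.N P.α := by
          have := h.ν_pos P.N P.α
          rw [one_mul]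
          gcongr
          exact le_max_left _ _
      _ ≤ _ := by linarith [h.max_mul_ν_le]
  have h6 : P.κ P.N * opNorm P.Y * P.rw ≤ opNorm P.Y * P.rw := by
    rw [mul_assoc]
    exact mul_le_of_le_one_left (by positivity) hκ1
  have h7 : 0 ≤ P.Cb * P.A₄C₁ := by positivity
  have h8 : 0 ≤ opNorm P.Y * P.rw := by positivity
  unfold A₅'
  linarith

/-! ### The invariant implies the bounds and is preserved -/

section Bounds

variable {n : ℕ} (hn : P.N ≤ n) {t v lθ lw : E d} (hlθ : ‖lθ‖ ≤ Real.sqrt P.Vθ * P.ν n P.α)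
  (hlw : ‖lw‖ ≤ Real.sqrt P.Vw * P.ν n P.β) (hI : P.Inv n t v lθ lw)

include hn hlw hI

lemma norm_v_le : ‖v‖ ≤ P.CRw * P.rw := by
  have h1 := norm_le_norm_sub_add v lw
  have h2 := hI.z_le
  have h3 := h.sqrt_Vw_mul_ν_le hn
  have h4 := h.three_halves_add_le_CRw_mul_rw
  linarith

omit hn in
lemma norm_v_le_rate : ‖v‖ ≤ (P.Kz + P.noiseBound) * P.gw n := by
  have h1 := norm_le_norm_sub_add v lw
  have h2 := hI.z_rate
  rw [add_mul, h.noiseBound_mul_gw]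
  linarith

omit h hn hlw hI in
lemma norm_t_le_add : ‖t‖ ≤ ‖t - P.κ n • act P.Y v - lθ‖ + ‖lθ‖ + P.κ n * opNorm P.Y * ‖v‖ := by
  have h1 := norm_le_norm_sub_add t (P.κ n • act P.Y v)
  have h2 := norm_le_norm_sub_add (t - P.κ n • act P.Y v) lθ
  rw [norm_smul, Real.norm_of_nonneg (κ_nonneg n)] at h1
  have h3 := mul_le_mul_of_nonneg_left (norm_act_le P.Y v) (κ_nonneg (P := P) n)
  linarith

omit hn in
lemma norm_v_le_A₄' : ‖v‖ ≤ P.A₄' * P.gw n :=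
  (h.norm_v_le_rate hlw hI).trans
    (mul_le_mul_of_nonneg_right h.Kz_add_le_A₄' (h.gw_nonneg n))

include hlθ

/-- The bound 3r_θ is r_θ from the position at N, r_θ/2 from the noise, and 3r_θ/2 for everything
that carries κ. -/
lemma norm_t_le : ‖t‖ ≤ 3 * P.rθ := by
  have hv := h.norm_v_le hn hlw hI
  have h1 := norm_t_le_add (P := P) (n := n) (t := t) (v := v) (lθ := lθ)
  have h2 := hI.b_le
  have h3 := h.sqrt_Vθ_mul_ν_le hn
  have h4 := h.κ_mul_Cb_le
  have hy := opNorm_nonneg P.Y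
  have hκ := κ_nonneg (P := P) P.N
  have hV := h.CRw_mul_rw_pos
  have hq := h.q₁_pos
  have hC := h.CT_nonneg
  have h5 : P.κ n * opNorm P.Y * ‖v‖ ≤ P.κ P.N * opNorm P.Y * (P.CRw * P.rw) := by
    gcongr
    exact h.κ_anti le_rfl hn
  have h6 : opNorm P.Y * (1 + 2 * P.CT / P.q₁) ≤ P.Cb := h.mul_one_add_le_Cb
  have h7 := mul_le_mul_of_nonneg_left h6 (mul_nonneg hκ hV.le)
  have h8 : 0 ≤ P.κ P.N * (P.CT * opNorm P.Y / P.q₁) * (P.CRw * P.rw) := by positivity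
  have e1 : P.κ P.N * (P.CRw * P.rw) * (opNorm P.Y * (1 + 2 * P.CT / P.q₁)) =
    P.κ P.N * opNorm P.Y * (P.CRw * P.rw) +
      2 * (P.κ P.N * (P.CT * opNorm P.Y / P.q₁) * (P.CRw * P.rw)) := by ring
  have e2 : P.κ P.N * (P.Cb * (P.CRw * P.rw) + opNorm (P.W₁ * P.W₂⁻¹) * P.rw) =
    P.κ P.N * (P.CRw * P.rw) * P.Cb + P.κ P.N * opNorm P.Y * P.rw := by
    unfold Y
    ring
  linarith

omit hn in
lemma norm_t_le_rate : ‖t‖ ≤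
    (P.Kb + P.κ P.N * opNorm P.Y * (P.Kz + P.noiseBound)) * P.gκ n +
      Real.sqrt P.Vθ * P.ν n P.α := by
  have hv := h.norm_v_le_rate hlw hI
  have h1 := norm_t_le_add (P := P) (n := n) (t := t) (v := v) (lθ := lθ)
  have h2 := hI.b_rate
  have hy := opNorm_nonneg P.Y
  have hκ := κ_nonneg (P := P) n
  have h3 : P.κ n * opNorm P.Y * ‖v‖ ≤
      P.κ n * opNorm P.Y * ((P.Kz + P.noiseBound) * P.gw n) := by gcongr
  have e : P.κ n * opNorm P.Y * ((P.Kz + P.noiseBound) * P.gw n) =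
    P.κ P.N * opNorm P.Y * (P.Kz + P.noiseBound) * P.gκ n := by
    linear_combination (opNorm P.Y * (P.Kz + P.noiseBound)) * h.κ_mul_gw n
  linarith

/-- The coupling rate `gκ` is below `gθ`, so the noise alone dictates the rate of θ. -/
lemma norm_t_le_A₅' : ‖t‖ ≤ P.A₅' * P.gθ n := by
  have h1 := h.norm_t_le_rate hlθ hlw hI
  have hν := h.ν_pos P.N P.α
  have e : Real.sqrt P.Vθ * P.ν n P.α = Real.sqrt P.Vθ * P.ν P.N P.α * P.gθ n := by
    rw [gθ]
    field_simp
  have h2 : 0 ≤ P.Kb + P.κ P.N * opNorm P.Y * (P.Kz + P.noiseBound) := by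
    have := h.noiseBound_pos
    have := h.Kz_nonneg
    have := h.Kb_nonneg
    have := opNorm_nonneg P.Y
    have := κ_nonneg (P := P) P.N
    positivity
  have h3 := mul_le_mul_of_nonneg_left (h.gκ_le_gθ hn) h2
  have h4 := mul_le_mul_of_nonneg_right h.Kb_add_le_A₅' (h.gθ_nonneg n)
  linarith

end Bounds

lemma inv_base {t v : E d} (ht : ‖t‖ ≤ P.rθ) (hv : ‖v‖ ≤ P.rw) : P.Inv P.N t v 0 0 := by
  have hE := h.noiseBound_pos
  have hK := h.Kz_nonneg
  have hrθ := h.rθ_pos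
  have hrw := h.rw_pos
  have hq₁ := h.q₁_pos
  have hq₂ := h.q₂_pos
  have hC := h.CT_nonneg
  have hy := opNorm_nonneg P.Y
  have hG := opNorm_nonneg P.Γ₂
  have hκ := κ_nonneg (P := P) P.N
  have hV := h.CRw_mul_rw_pos
  have hb : ‖t - P.κ P.N • act P.Y v‖ ≤ P.rθ + P.κ P.N * opNorm P.Y * P.rw := by
    refine (norm_sub_le _ _).trans (add_le_add ht ?_)
    rw [norm_smul, Real.norm_of_nonneg hκ, mul_assoc]
    gcongr
    exact (norm_act_le P.Y v).trans (by gcongr)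
  refine ⟨?_, ?_, ?_, ?_⟩
  · rw [sub_zero]
    have : 0 ≤ 3 * P.rθ * opNorm P.Γ₂ / P.q₂ := by positivity
    linarith
  · rw [sub_zero, h.gw_N, mul_one]
    exact hv.trans h.rw_le_Kz
  · rw [sub_zero]
    have : 0 ≤ P.κ P.N * (P.CT * opNorm P.Y / P.q₁) * (P.CRw * P.rw) := by positivity
    linarith
  · rw [sub_zero, h.gκ_N, mul_one]
    unfold Kb
    have : 0 ≤ P.κ P.N * (P.CT * opNorm P.Y / P.q₁) * (P.Kz + P.noiseBound) := by positivity
    linarith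

/-- One unprojected step preserves the invariant. -/
lemma inv_step {n : ℕ} (hn : P.N ≤ n) {θ w lθ lw M₁ M₂ : E d}
    (hlθ : ‖lθ‖ ≤ Real.sqrt P.Vθ * P.ν n P.α) (hlw : ‖lw‖ ≤ Real.sqrt P.Vw * P.ν n P.β)
    (hI : P.Inv n (θ - P.θstar) (w - P.wstar) lθ lw) :
    P.Inv (n + 1) (θ + step P.α n • (P.h₁ θ w + M₁) - P.θstar)
      (w + step P.β n • (P.h₂ θ w + M₂) - P.wstar)
      (lθ - step P.α n • act P.X₁ lθ + step P.α n • (M₁ - act P.Y M₂))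
      (lw - step P.β n • act P.W₂ lw + step P.β n • M₂) := by
  have hv := h.norm_v_le hn hlw hI
  have hvr := h.norm_v_le_rate hlw hI
  have ht := h.norm_t_le hn hlθ hlw hI
  have htr := h.norm_t_le_rate hlθ hlw hI
  set t := θ - P.θstar
  set v := w - P.wstar
  have hE := h.noiseBound_pos
  have hK := h.Kz_nonneg
  have hKb := h.Kb_nonneg
  have hrθ := h.rθ_pos
  have hrw := h.rw_pos
  have hq₁ := h.q₁_pos
  have hq₂ := h.q₂_pos
  have hC := h.CT_nonneg
  have hy := opNorm_nonneg P.Y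
  have hG := opNorm_nonneg P.Γ₂
  have hκ := κ_nonneg (P := P) P.N
  have hκn := κ_nonneg (P := P) n
  have hV := h.CRw_mul_rw_pos
  have hα := step_pos P.α n
  have hβ := step_pos P.β n
  obtain ⟨cα1, cα2⟩ := h.contraction_α hn
  obtain ⟨cβ1, cβ2⟩ := h.contraction_β hn
  have hz : ‖w + step P.β n • (P.h₂ θ w + M₂) - P.wstar -
      (lw - step P.β n • act P.W₂ lw + step P.β n • M₂)‖ ≤
      (1 - P.q₂ * step P.β n) * ‖v - lw‖ + step P.β n * (opNorm P.Γ₂ * ‖t‖) := by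
    -- The noise obeys the same recursion and cancels exactly.
    have e : w + step P.β n • (P.h₂ θ w + M₂) - P.wstar -
        (lw - step P.β n • act P.W₂ lw + step P.β n • M₂) =
        ((v - lw) - step P.β n • act P.W₂ (v - lw)) - step P.β n • act P.Γ₂ t := by
      rw [h.w_recursion, map_sub (act P.W₂) v lw]
      module
    rw [e]
    refine (norm_sub_le _ _).trans (add_le_add (cβ2 _) ?_)
    rw [norm_smul, Real.norm_of_nonneg hβ.le]
    gcongr
    exact norm_act_le _ _
  have hb : ‖θ + step P.α n • (P.h₁ θ w + M₁) - P.θstar -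
      P.κ (n + 1) • act P.Y (w + step P.β n • (P.h₂ θ w + M₂) - P.wstar) -
      (lθ - step P.α n • act P.X₁ lθ + step P.α n • (M₁ - act P.Y M₂))‖ ≤
      (1 - P.q₁ * step P.α n) * ‖t - P.κ n • act P.Y v - lθ‖ +
        step P.α n * P.κ n * P.CT * (opNorm P.Y * ‖v‖) := by
    have e : θ + step P.α n • (P.h₁ θ w + M₁) - P.θstar -
        P.κ (n + 1) • act P.Y (w + step P.β n • (P.h₂ θ w + M₂) - P.wstar) -
        (lθ - step P.α n • act P.X₁ lθ + step P.α n • (M₁ - act P.Y M₂)) =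
        ((t - P.κ n • act P.Y v - lθ) - step P.α n • act P.X₁ (t - P.κ n • act P.Y v - lθ)) +
        ((P.κ n - P.κ (n + 1)) • act P.Y v - (step P.α n * P.κ n) • act P.X₁ (act P.Y v)) := by
      rw [h.θ_recursion, map_sub (act P.X₁) _ lθ]
      module
    rw [e]
    refine (norm_add_le _ _).trans (add_le_add (cα2 _) ?_)
    refine (h.norm_coupling_le hn _).trans ?_
    gcongr
    exact norm_act_le _ _
  have d1 : 0 ≤ 1 - P.q₁ * step P.α n := by linarith
  have d2 : 0 ≤ 1 - P.q₂ * step P.β n := by linarith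
  refine ⟨hz.trans ?_, hz.trans ?_, hb.trans ?_, hb.trans ?_⟩
  -- The second summand is the equilibrium for forcing with ‖t‖ ≤ 3r_θ, so only the first one
  -- shrinks.
  · calc _ ≤ (1 - P.q₂ * step P.β n) * (P.rw + 3 * P.rθ * opNorm P.Γ₂ / P.q₂) +
          step P.β n * (opNorm P.Γ₂ * (3 * P.rθ)) := by
          gcongr
          exact hI.z_le
      _ = P.rw + 3 * P.rθ * opNorm P.Γ₂ / P.q₂ - P.q₂ * step P.β n * P.rw := by
          field_simp
          ring
      _ ≤ _ := by
          have : 0 ≤ P.q₂ * step P.β n * P.rw := by positivity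
          linarith
  -- Of the contraction rate q₂, the forcing uses three quarters; the last quarter covers the
  -- decrease of `gw`.
  · have h1 : opNorm P.Γ₂ * ‖t‖ ≤ 3 / 4 * P.q₂ * P.Kz * P.gw n := by
      have h2 : ‖t‖ ≤ (P.Kb + P.κ P.N * opNorm P.Y * (P.Kz + P.noiseBound) + P.noiseBound) *
          P.gw n := by
        have h3 := h.sqrt_Vθ_mul_ν_le_sqrt_Vw hn
        rw [← h.noiseBound_mul_gw] at h3
        have h4 : 0 ≤ P.Kb + P.κ P.N * opNorm P.Y * (P.Kz + P.noiseBound) := by positivity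
        have h5 := mul_le_mul_of_nonneg_left (h.gκ_le_gw hn) h4
        linarith
      have h6 := mul_le_mul_of_nonneg_right h.Γ₂_mul_le (h.gw_nonneg n)
      have h7 := mul_le_mul_of_nonneg_left h2 hG
      linarith
    calc _ ≤ (1 - P.q₂ * step P.β n) * (P.Kz * P.gw n) +
          step P.β n * (3 / 4 * P.q₂ * P.Kz * P.gw n) := by
          gcongr
          exact hI.z_rate
      _ = P.Kz * (P.gw n * (1 - P.q₂ * step P.β n / 4)) := by ring
      _ ≤ _ := mul_le_mul_of_nonneg_left (h.gw_succ hn) hK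
  · set b₀ := P.rθ + P.κ P.N * opNorm P.Y * P.rw with hb₀
    have hb₀' : 0 ≤ b₀ := by positivity
    calc _ ≤ (1 - P.q₁ * step P.α n) *
          (b₀ + P.κ P.N * (P.CT * opNorm P.Y / P.q₁) * (P.CRw * P.rw)) +
          step P.α n * P.κ P.N * P.CT * (opNorm P.Y * (P.CRw * P.rw)) := by
          gcongr
          · exact hI.b_le
          · exact h.κ_anti le_rfl hn
      _ = b₀ + P.κ P.N * (P.CT * opNorm P.Y / P.q₁) * (P.CRw * P.rw) -
          P.q₁ * step P.α n * b₀ := by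
          field_simp
          ring
      _ ≤ _ := by
          have : 0 ≤ P.q₁ * step P.α n * b₀ := by positivity
          linarith
  -- Two thirds of q₁ absorb the coupling, by the factor 3/2 in `Kb`; the last third covers the
  -- decrease of `gκ`.
  · have h1 : P.κ n * P.CT * (opNorm P.Y * ‖v‖) ≤ 2 / 3 * P.q₁ * P.Kb * P.gκ n := by
      calc _ ≤ P.κ n * P.CT * (opNorm P.Y * ((P.Kz + P.noiseBound) * P.gw n)) := by gcongr
        _ = P.κ P.N * P.CT * opNorm P.Y * (P.Kz + P.noiseBound) * P.gκ n := by
          linear_combination (P.CT * opNorm P.Y * (P.Kz + P.noiseBound)) * h.κ_mul_gw n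
        _ ≤ _ := by
          refine mul_le_mul_of_nonneg_right ?_ h.gκ_nonneg
          have e : 2 / 3 * P.q₁ * P.Kb = 2 / 3 * P.q₁ * (P.rθ + P.κ P.N * opNorm P.Y * P.rw) +
            P.κ P.N * P.CT * opNorm P.Y * (P.Kz + P.noiseBound) := by
            unfold Kb
            field_simp
          have : 0 ≤ 2 / 3 * P.q₁ * (P.rθ + P.κ P.N * opNorm P.Y * P.rw) := by positivity
          linarith
    have h2 := mul_le_mul_of_nonneg_left h1 hα.le
    calc _ ≤ (1 - P.q₁ * step P.α n) * (P.Kb * P.gκ n) +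
          step P.α n * (2 / 3 * P.q₁ * P.Kb * P.gκ n) := by
          refine add_le_add (mul_le_mul_of_nonneg_left hI.b_rate d1) ?_
          linarith
      _ = P.Kb * (P.gκ n * (1 - P.q₁ * step P.α n / 3)) := by ring
      _ ≤ _ := mul_le_mul_of_nonneg_left (h.gκ_succ hn) hKb

end Valid

end Problem

/-! ### Linear recursions driven by noise. -/

/-- The linear recursion `L (n + 1) = T n (L n) + ξ n` started at `0`. -/
def linRec {Ω F : Type*} [NormedAddCommGroup F] [NormedSpace ℝ F] (T : ℕ → F →L[ℝ] F)
    (ξ : ℕ → Ω → F) : ℕ → Ω → F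
  | 0 => 0
  | n + 1 => fun ω => T n (linRec T ξ n ω) + ξ n ω

section LinRec

variable {Ω F : Type*} [NormedAddCommGroup F] [NormedSpace ℝ F] {T : ℕ → F →L[ℝ] F}
  {ξ : ℕ → Ω → F}

lemma linRec_eq_zero {n₀ : ℕ} (hξ : ∀ n < n₀, ξ n = 0) {n : ℕ} (hn : n ≤ n₀) :
    linRec T ξ n = 0 := by
  induction n with
  | zero => rfl
  | succ n ih =>
    funext ω
    simp [linRec, ih (by omega), hξ n (by omega)]

lemma stronglyMeasurable_linRec {ℱ : ℕ → MeasurableSpace Ω} (hℱ : Monotone ℱ)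
    (hξ : ∀ n, StronglyMeasurable[ℱ (n + 1)] (ξ n)) (n : ℕ) :
    StronglyMeasurable[ℱ n] (linRec T ξ n) := by
  induction n with
  | zero => exact stronglyMeasurable_zero
  | succ n ih =>
    have h1 : StronglyMeasurable[ℱ (n + 1)] (linRec T ξ n) := ih.mono (hℱ (Nat.le_succ n))
    exact ((T n).continuous.comp_stronglyMeasurable h1).add (hξ n)

end LinRec

/-! ### The filtration of the noise -/

section NoiseSigma

variable {d : ℕ} {Ω : Type*} {θ₀ w₀ : Ω → E d} {M₁ M₂ : ℕ → Ω → E d}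

lemma noiseSigma_mono : Monotone (noiseSigma θ₀ w₀ M₁ M₂) := by
  intro m n hmn
  refine sup_le_sup_left ?_ _
  exact biSup_mono fun k hk => Finset.Icc_subset_Icc_right hmn hk

lemma noiseSigma_le {m0 : MeasurableSpace Ω} (hθ₀ : Measurable θ₀) (hw₀ : Measurable w₀)
    (h₁ : ∀ n, Measurable (M₁ (n + 1))) (h₂ : ∀ n, Measurable (M₂ (n + 1))) (n : ℕ) :
    noiseSigma θ₀ w₀ M₁ M₂ n ≤ m0 := by
  refine sup_le (sup_le hθ₀.comap_le hw₀.comap_le) (iSup₂_le fun k hk => ?_)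
  obtain ⟨j, rfl⟩ := Nat.exists_eq_add_of_le' (Finset.mem_Icc.1 hk).1
  exact sup_le (h₁ j).comap_le (h₂ j).comap_le

lemma measurable_noiseSigma_θ₀ (n : ℕ) : Measurable[noiseSigma θ₀ w₀ M₁ M₂ n] θ₀ :=
  Measurable.of_comap_le (le_sup_left.trans le_sup_left)

lemma measurable_noiseSigma_w₀ (n : ℕ) : Measurable[noiseSigma θ₀ w₀ M₁ M₂ n] w₀ :=
  Measurable.of_comap_le (le_sup_right.trans le_sup_left)

lemma measurable_noiseSigma₁ (n : ℕ) : Measurable[noiseSigma θ₀ w₀ M₁ M₂ (n + 1)] (M₁ (n + 1)) := by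
  refine Measurable.of_comap_le (le_trans ?_ le_sup_right)
  exact le_sup_left.trans (le_iSup₂_of_le (n + 1) (Finset.mem_Icc.2 ⟨by omega, le_rfl⟩) le_rfl)

lemma measurable_noiseSigma₂ (n : ℕ) : Measurable[noiseSigma θ₀ w₀ M₁ M₂ (n + 1)] (M₂ (n + 1)) := by
  refine Measurable.of_comap_le (le_trans ?_ le_sup_right)
  exact le_sup_right.trans (le_iSup₂_of_le (n + 1) (Finset.mem_Icc.2 ⟨by omega, le_rfl⟩) le_rfl)

end NoiseSigma

namespace Problem

/-! ### The stopped noise along a trajectory and its measurability. -/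

section Trajectory

variable {d : ℕ} (P : Problem d) {Ω : Type*} (θ w M₁ M₂ : ℕ → Ω → E d)

/-- The event that the iterates have stayed bounded from `N` up to `n`. -/
def bddEvent (n : ℕ) : Set Ω :=
  {ω | P.N ≤ n ∧ ∀ k, P.N ≤ k → k ≤ n →
    ‖θ k ω - P.θstar‖ ≤ 3 * P.rθ ∧ ‖w k ω - P.wstar‖ ≤ P.CRw * P.rw}

/-- The noise of the decoupled `θ` recursion, stopped when the iterates become large. -/
def ξθ (n : ℕ) : Ω → E d := (P.bddEvent θ w n).indicator
  (step P.α n • (M₁ (n + 1) - act P.Y ∘ M₂ (n + 1)))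

/-- The noise of the `w` recursion, stopped when the iterates become large. -/
def ξw (n : ℕ) : Ω → E d := (P.bddEvent θ w n).indicator (step P.β n • M₂ (n + 1))

/-- The accumulated noise in `θ`. -/
def noiseθ : ℕ → Ω → E d :=
  linRec (fun n => ContinuousLinearMap.id ℝ (E d) - step P.α n • act P.X₁) (P.ξθ θ w M₁ M₂)

/-- The accumulated noise in `w`. -/
def noisew : ℕ → Ω → E d :=
  linRec (fun n => ContinuousLinearMap.id ℝ (E d) - step P.β n • act P.W₂) (P.ξw θ w M₂)

/-- The event that the accumulated noise at `n` is large. -/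
def noiseEvent (n : ℕ) : Set Ω :=
  {ω | Real.sqrt P.Vθ * P.ν n P.α < ‖P.noiseθ θ w M₁ M₂ n ω‖} ∪
    {ω | Real.sqrt P.Vw * P.ν n P.β < ‖P.noisew θ w M₂ n ω‖}

variable {P θ w M₁ M₂}

lemma bddEvent_eq_empty {n : ℕ} (hn : n < P.N) : P.bddEvent θ w n = ∅ := by
  ext ω
  simp only [bddEvent, Set.mem_ofPred_eq, Set.mem_empty_iff_false, iff_false, not_and]
  omega

lemma noiseθ_N : P.noiseθ θ w M₁ M₂ P.N = 0 :=
  linRec_eq_zero (n₀ := P.N) (fun n hn => by rw [ξθ, bddEvent_eq_empty hn, Set.indicator_empty]; rfl)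
    le_rfl

lemma noisew_N : P.noisew θ w M₂ P.N = 0 :=
  linRec_eq_zero (n₀ := P.N) (fun n hn => by rw [ξw, bddEvent_eq_empty hn, Set.indicator_empty]; rfl)
    le_rfl

lemma measurable_iterates
    (hθ : ∀ n ω, θ (n + 1) ω = sparseProj (n + 1) P.Rθ
      (θ n ω + step P.α n • (P.h₁ (θ n ω) (w n ω) + M₁ (n + 1) ω)))
    (hw : ∀ n ω, w (n + 1) ω = sparseProj (n + 1) P.Rw
      (w n ω + step P.β n • (P.h₂ (θ n ω) (w n ω) + M₂ (n + 1) ω))) (n : ℕ) :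
    Measurable[noiseSigma (θ 0) (w 0) M₁ M₂ n] (θ n) ∧
      Measurable[noiseSigma (θ 0) (w 0) M₁ M₂ n] (w n) := by
  induction n with
  | zero => exact ⟨measurable_noiseSigma_θ₀ 0, measurable_noiseSigma_w₀ 0⟩
  | succ n ih =>
    obtain ⟨h1, h2⟩ := ih
    have hle := noiseSigma_mono (θ₀ := θ 0) (w₀ := w 0) (M₁ := M₁) (M₂ := M₂) (Nat.le_succ n)
    have h1' := h1.mono hle le_rfl
    have h2' := h2.mono hle le_rfl
    have h3 := measurable_noiseSigma₁ (θ₀ := θ 0) (w₀ := w 0) (M₁ := M₁) (M₂ := M₂) n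
    have h4 := measurable_noiseSigma₂ (θ₀ := θ 0) (w₀ := w 0) (M₁ := M₁) (M₂ := M₂) n
    generalize noiseSigma (θ 0) (w 0) M₁ M₂ (n + 1) = m at *
    refine ⟨?_, ?_⟩
    · rw [funext (hθ n)]
      have h5 : Measurable fun ω => P.h₁ (θ n ω) (w n ω) + M₁ (n + 1) ω :=
        ((measurable_const.sub ((act P.Γ₁).measurable.comp h1')).sub
          ((act P.W₁).measurable.comp h2')).add h3
      exact (measurable_sparseProj _ _).comp (h1'.add (h5.const_smul (step P.α n)))
    · rw [funext (hw n)]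
      have h5 : Measurable fun ω => P.h₂ (θ n ω) (w n ω) + M₂ (n + 1) ω :=
        ((measurable_const.sub ((act P.Γ₂).measurable.comp h1')).sub
          ((act P.W₂).measurable.comp h2')).add h4
      exact (measurable_sparseProj _ _).comp (h2'.add (h5.const_smul (step P.β n)))

lemma measurableSet_bddEvent {m : ℕ → MeasurableSpace Ω} (hm : Monotone m)
    (h : ∀ n, Measurable[m n] (θ n) ∧ Measurable[m n] (w n)) (n : ℕ) :
    MeasurableSet[m n] (P.bddEvent θ w n) := by
  have e : P.bddEvent θ w n = {_ω | P.N ≤ n} ∩ ⋂ k : ℕ, ⋂ _ : P.N ≤ k, ⋂ _ : k ≤ n,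
      ({ω | ‖θ k ω - P.θstar‖ ≤ 3 * P.rθ} ∩ {ω | ‖w k ω - P.wstar‖ ≤ P.CRw * P.rw}) := by
    ext ω
    simp [bddEvent]
  have hball : ∀ {m : MeasurableSpace Ω} {f : Ω → E d}, Measurable f → ∀ (c : E d) (r : ℝ),
      MeasurableSet {ω | ‖f ω - c‖ ≤ r} := fun hf c r =>
    measurableSet_le (hf.sub measurable_const).norm measurable_const
  rw [e]
  refine (MeasurableSet.const _).inter (MeasurableSet.iInter fun k => MeasurableSet.iInter fun _ =>
    MeasurableSet.iInter fun hk => ?_)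
  have h1 := (h k).1.mono (hm hk) le_rfl
  have h2 := (h k).2.mono (hm hk) le_rfl
  exact (hball h1 _ _).inter (hball h2 _ _)

lemma one_add_norm_le_B {n : ℕ} {ω : Ω} (hω : ω ∈ P.bddEvent θ w n) :
    1 + ‖θ n ω‖ + ‖w n ω‖ ≤ P.B := by
  obtain ⟨h1, h2⟩ := hω.2 n hω.1 le_rfl
  have h3 := norm_le_norm_sub_add (θ n ω) P.θstar
  have h4 := norm_le_norm_sub_add (w n ω) P.wstar
  unfold B CRθ
  linarith

end Trajectory

namespace Valid

variable {d : ℕ} {P : Problem d} (h : P.Valid) {Ω : Type*} {m0 : MeasurableSpace Ω}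
  {μ : Measure Ω} [IsProbabilityMeasure μ] {θ w M₁ M₂ : ℕ → Ω → E d}
  (hM : DominatedMartingaleDiff μ θ w M₁ M₂ P.m₁ P.m₂)
  (hθ : ∀ n ω, θ (n + 1) ω = sparseProj (n + 1) P.Rθ
    (θ n ω + step P.α n • (P.h₁ (θ n ω) (w n ω) + M₁ (n + 1) ω)))
  (hw : ∀ n ω, w (n + 1) ω = sparseProj (n + 1) P.Rw
    (w n ω + step P.β n • (P.h₂ (θ n ω) (w n ω) + M₂ (n + 1) ω)))

include h

/-! ### The noise is small with high probability -/

/-- The 4d² in the logarithm pays for the union over 2d directions and for halving δ between the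
timescales, with a factor 1/d to spare. -/
lemma exp_neg_logTerm (n : ℕ) :
    2 * d * Real.exp (-P.logTerm n) ≤ P.δ / 2 * ((n : ℝ) + 1) ^ (-P.p) := by
  have hd := h.one_le_d
  have hδ := h.hδ₀
  have h1 : 0 < ((n : ℝ) + 1) ^ P.p := by positivity
  rw [logTerm, Real.exp_neg, Real.exp_log (by positivity), Real.rpow_neg (by positivity)]
  have e : 2 * (d : ℝ) * (4 * (d : ℝ) ^ 2 * ((n : ℝ) + 1) ^ P.p / P.δ)⁻¹ =
    1 / d * (P.δ / 2 * (((n : ℝ) + 1) ^ P.p)⁻¹) := by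
    field_simp
    norm_num
  rw [e]
  refine mul_le_of_le_one_left (by positivity) ?_
  rw [div_le_one (by linarith)]
  exact hd

/-- Tail bound for the accumulated noise of one timescale. -/
lemma measureReal_linRec_gt_le {γ q c V : ℝ} {A : Matrix (Fin d) (Fin d) ℝ}
    {ℱ : ℕ → MeasurableSpace Ω} (hℱm : Monotone ℱ) (hℱ : ∀ n, ℱ n ≤ m0) (hq : 0 < q) (hc : 0 < c)
    (hV : 2 * d * (c ^ 2 / q) ≤ V) (hV0 : 0 < V)
    (hA : ∀ n, P.N ≤ n → q * step γ n ≤ 1 / 2 ∧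
      ∀ x : E d, ‖x - step γ n • act A x‖ ≤ (1 - q * step γ n) * ‖x‖)
    (hstep : ∀ n, P.N ≤ n → step γ n * (1 - q * step γ n / 2) ≤ step γ (n + 1))
    {ξ : ℕ → Ω → E d} (hξm : ∀ n, StronglyMeasurable[ℱ (n + 1)] (ξ n))
    (hξi : ∀ n, Integrable (ξ n) μ) (hξ0 : ∀ n < P.N, ξ n = 0)
    (hξb : ∀ n, ∀ᵐ ω ∂μ, ‖ξ n ω‖ ≤ step γ n * c) (hξc : ∀ n, μ[ξ n | ℱ n] =ᵐ[μ] 0)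
    {n : ℕ} (hn : P.N ≤ n) :
    μ.real {ω | Real.sqrt V * P.ν n γ <
      ‖linRec (fun n => ContinuousLinearMap.id ℝ (E d) - step γ n • act A) ξ n ω‖} ≤
      P.δ / 2 * ((n : ℝ) + 1) ^ (-P.p) := by
  have hsub := integral_exp_inner_recursion_le (μ := μ) hℱ (n₀ := P.N)
    (L := linRec (fun n => ContinuousLinearMap.id ℝ (E d) - step γ n • act A) ξ) (ξ := ξ)
    (T := fun n => ContinuousLinearMap.id ℝ (E d) - step γ n • act A)
    -- The proxy s = (c²/q) · step is the approximate fixed point of s ↦ (1 - q·step)² s +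
    -- (c·step)².
    (c := fun n => step γ n * c) (s := fun n => c ^ 2 / q * step γ n)
    (τ := fun n => 1 - q * step γ n)
    (fun ω => by rw [linRec_eq_zero hξ0 le_rfl]; rfl) (fun n _ ω => rfl)
    (fun n _ => stronglyMeasurable_linRec hℱm hξm n) (fun n => mul_pos (step_pos γ n) hc)
    hξi hξb hξc
    (fun n hn => ContinuousLinearMap.opNorm_le_bound _ (by linarith [(hA n hn).1]) (hA n hn).2)
    (mul_nonneg (by positivity) (step_pos γ _).le) (fun n hn => ?_) n hn
  · have hs : 0 < c ^ 2 / q * step γ n := mul_pos (by positivity) (step_pos γ n)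
    have hν := h.ν_pos n γ
    have hd := h.d_pos
    refine (measureReal_norm_gt_le h.hd hs hsub.2 (by positivity)).trans
      (le_trans ?_ (h.exp_neg_logTerm n))
    refine mul_le_mul_of_nonneg_left (Real.exp_le_exp.2 (neg_le_neg ?_)) (by positivity)
    rw [le_div_iff₀ (by positivity), mul_pow, Real.sq_sqrt hV0.le, h.ν_sq]
    have hl := h.logTerm_pos n
    have hst := step_pos γ n
    calc _ = 2 * d * (c ^ 2 / q) * (step γ n * P.logTerm n) := by ring
      _ ≤ _ := by gcongr
  · have h1 := hstep n hn
    have h2 := (hA n hn).1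
    have hst := step_pos γ n
    have h3 := mul_le_mul_of_nonneg_left h1 (show 0 ≤ c ^ 2 / q by positivity)
    refine le_trans ?_ h3
    -- With u = q·step the bracket is (1-u)² + u = 1 - u + u², at most 1 - u/2 since u ≤ 1/2.
    have e : (1 - q * step γ n) ^ 2 * (c ^ 2 / q * step γ n) + (step γ n * c) ^ 2 =
      c ^ 2 / q * (step γ n * (1 - q * step γ n + (q * step γ n) * (q * step γ n))) := by
      field_simp
      ring
    rw [e]
    gcongr
    have h4 : 0 ≤ q * step γ n := by positivity
    nlinarith

include hM hθ hw

/-- The stopping indicator is measurable with respect to the past, so it preserves zero conditional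
means, and on its support the noise is bounded through `B`. Each timescale contributes half of the
probability. -/
lemma measureReal_noiseEvent_le {n : ℕ} (hn : P.N ≤ n) :
    μ.real (P.noiseEvent θ w M₁ M₂ n) ≤ P.δ * ((n : ℝ) + 1) ^ (-P.p) := by
  have hℱm := noiseSigma_mono (θ₀ := θ 0) (w₀ := w 0) (M₁ := M₁) (M₂ := M₂)
  have hℱ := noiseSigma_le hM.measurable_θ₀ hM.measurable_w₀ hM.measurable₁ hM.measurable₂
  have hbm := measurableSet_bddEvent (P := P) hℱm (measurable_iterates hθ hw)
  have hY := opNorm_mul_le P.W₁ P.W₂⁻¹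
  have hY0 : 0 ≤ opNorm P.Y := opNorm_nonneg P.Y
  have hm₁ := h.hm₁
  have hm₂ := h.hm₂
  have hi₂ : ∀ n, Integrable (act P.Y ∘ M₂ (n + 1)) μ := fun n =>
    (act P.Y).integrable_comp (hM.integrable₂ n)
  have hi₁ : ∀ n, Integrable (M₁ (n + 1) - act P.Y ∘ M₂ (n + 1)) μ := fun n =>
    (hM.integrable₁ n).sub (hi₂ n)
  have hc₂ : ∀ n, μ[step P.β n • M₂ (n + 1) | noiseSigma (θ 0) (w 0) M₁ M₂ n] =ᵐ[μ] 0 := by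
    intro n
    refine (condExp_smul _ _ _).trans ?_
    filter_upwards [hM.condExp₂ n] with ω hω
    simp [hω]
  have hc₁ : ∀ n, μ[step P.α n • (M₁ (n + 1) - act P.Y ∘ M₂ (n + 1)) |
      noiseSigma (θ 0) (w 0) M₁ M₂ n] =ᵐ[μ] 0 := by
    intro n
    refine (condExp_smul _ _ _).trans ?_
    filter_upwards [hM.condExp₁ n, hM.condExp₂ n,
      condExp_sub (hM.integrable₁ n) (hi₂ n) (noiseSigma (θ 0) (w 0) M₁ M₂ n),
      (act P.Y).comp_condExp_comm (m := noiseSigma (θ 0) (w 0) M₁ M₂ n) (hM.integrable₂ n)]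
      with ω h1 h2 h3 h4
    rw [Pi.smul_apply, h3, Pi.sub_apply, ← h4, Function.comp_apply, h1, h2]
    simp
  have hind : ∀ {f : Ω → E d} {n : ℕ}, Integrable f μ →
      μ[f | noiseSigma (θ 0) (w 0) M₁ M₂ n] =ᵐ[μ] 0 →
      μ[(P.bddEvent θ w n).indicator f | noiseSigma (θ 0) (w 0) M₁ M₂ n] =ᵐ[μ] 0 := by
    intro f n hf hf0
    refine (condExp_indicator hf (hbm n)).trans ?_
    filter_upwards [hf0] with ω hω
    by_cases hmem : ω ∈ P.bddEvent θ w n <;> simp [hmem, hω]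
  have h1 : μ.real {ω | Real.sqrt P.Vθ * P.ν n P.α < ‖P.noiseθ θ w M₁ M₂ n ω‖} ≤
      P.δ / 2 * ((n : ℝ) + 1) ^ (-P.p) := by
    refine h.measureReal_linRec_gt_le (ξ := P.ξθ θ w M₁ M₂) hℱm hℱ h.q₁_pos h.cθ_pos h.Vθ_ge h.Vθ_pos
      (fun n hn => h.contraction_α hn) (fun n hn => h.step_succ_α hn) (fun n => ?_)
      (fun n => ((hi₁ n).smul _).indicator (hℱ n _ (hbm n)))
      (fun n hn => by rw [ξθ, bddEvent_eq_empty hn, Set.indicator_empty]; rfl)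
      (fun n => ?_) (fun n => hind ((hi₁ n).smul _) (hc₁ n)) hn
    · refine StronglyMeasurable.indicator ?_ (hℱm (Nat.le_succ n) _ (hbm n))
      refine Measurable.stronglyMeasurable ?_
      exact Measurable.const_smul ((measurable_noiseSigma₁ n).sub
        ((act P.Y).measurable.comp (measurable_noiseSigma₂ n))) _
    · filter_upwards [hM.bound₁ n, hM.bound₂ n] with ω b1 b2
      have hst := step_pos P.α n
      have hc := h.cθ_pos
      by_cases hmem : ω ∈ P.bddEvent θ w n
      · rw [ξθ, Set.indicator_of_mem hmem, Pi.smul_apply, norm_smul, Real.norm_of_nonneg hst.le]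
        refine mul_le_mul_of_nonneg_left ?_ hst.le
        have hB := one_add_norm_le_B hmem
        have hB0 : 0 ≤ P.B := le_trans (by positivity) hB
        have b1' := b1.trans (mul_le_mul_of_nonneg_left hB hm₁.le)
        have b2' := b2.trans (mul_le_mul_of_nonneg_left hB hm₂.le)
        refine (norm_sub_le _ _).trans ((add_le_add b1' (norm_act_le P.Y _)).trans ?_)
        calc _ ≤ P.m₁ * P.B + opNorm P.W₁ * opNorm P.W₂⁻¹ * (P.m₂ * P.B) := by
              exact add_le_add le_rfl (mul_le_mul hY b2' (norm_nonneg _)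
                (mul_nonneg (opNorm_nonneg _) (opNorm_nonneg _)))
          _ = _ := by ring
      · rw [ξθ, Set.indicator_of_notMem hmem, norm_zero]
        positivity
  have h2 : μ.real {ω | Real.sqrt P.Vw * P.ν n P.β < ‖P.noisew θ w M₂ n ω‖} ≤
      P.δ / 2 * ((n : ℝ) + 1) ^ (-P.p) := by
    refine h.measureReal_linRec_gt_le (ξ := P.ξw θ w M₂) hℱm hℱ h.q₂_pos h.cw_pos h.Vw_ge h.Vw_pos
      (fun n hn => h.contraction_β hn) (fun n hn => h.step_succ_β hn) (fun n => ?_)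
      (fun n => ((hM.integrable₂ n).smul _).indicator (hℱ n _ (hbm n)))
      (fun n hn => by rw [ξw, bddEvent_eq_empty hn, Set.indicator_empty]; rfl)
      (fun n => ?_) (fun n => hind ((hM.integrable₂ n).smul _) (hc₂ n)) hn
    · refine StronglyMeasurable.indicator ?_ (hℱm (Nat.le_succ n) _ (hbm n))
      refine Measurable.stronglyMeasurable ?_
      exact Measurable.const_smul (measurable_noiseSigma₂ n) _
    · filter_upwards [hM.bound₂ n] with ω b2
      have hst := step_pos P.β n
      have hc := h.cw_pos
      by_cases hmem : ω ∈ P.bddEvent θ w n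
      · rw [ξw, Set.indicator_of_mem hmem, Pi.smul_apply, norm_smul, Real.norm_of_nonneg hst.le]
        exact mul_le_mul_of_nonneg_left
          (b2.trans (mul_le_mul_of_nonneg_left (one_add_norm_le_B hmem) hm₂.le)) hst.le
      · rw [ξw, Set.indicator_of_notMem hmem, norm_zero]
        positivity
  refine (measureReal_union_le _ _).trans ?_
  linarith

/-- The union starts at N + 1, as the accumulated noise vanishes at N. -/
lemma measureReal_iUnion_noiseEvent_lt :
    μ.real (⋃ j : ℕ, P.noiseEvent θ w M₁ M₂ (P.N + 1 + j)) < P.δ := by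
  obtain ⟨S, hS, hsum⟩ := exists_sum_rpow_neg_le_lt_one h.hp (thresholds (P := P)).1.2.2.2.2.2
  have hδ := h.hδ₀
  have hS0 : 0 ≤ S := by simpa using hsum 0
  have h1 : μ (⋃ j : ℕ, P.noiseEvent θ w M₁ M₂ (P.N + 1 + j)) ≤ ENNReal.ofReal (P.δ * S) := by
    refine (measure_iUnion_le _).trans (ENNReal.tsum_le_of_sum_range_le fun M => ?_)
    calc _ ≤ ∑ j ∈ Finset.range M,
          ENNReal.ofReal (P.δ * (((P.N + 1 + j : ℕ) : ℝ) + 1) ^ (-P.p)) := by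
          refine Finset.sum_le_sum fun j _ => ?_
          rw [← ofReal_measureReal]
          exact ENNReal.ofReal_le_ofReal (h.measureReal_noiseEvent_le hM hθ hw (by omega))
      _ = ENNReal.ofReal (P.δ * ∑ j ∈ Finset.range M, (((P.N + 1 + j : ℕ) : ℝ) + 1) ^ (-P.p)) := by
          rw [Finset.mul_sum, ENNReal.ofReal_sum_of_nonneg]
          intro j _
          positivity
      _ ≤ _ := by
          refine ENNReal.ofReal_le_ofReal ?_
          gcongr
          exact hsum M
  have h2 : μ.real (⋃ j : ℕ, P.noiseEvent θ w M₁ M₂ (P.N + 1 + j)) ≤ P.δ * S :=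
    ENNReal.toReal_le_of_le_ofReal (by positivity) h1
  refine h2.trans_lt ?_
  have := mul_lt_mul_of_pos_left hS hδ
  linarith

/-! ### The iterates when the noise is small -/

omit hM in
-- N is a projection time, and N > 0, so the iterate with this index really has been projected.
lemma norm_iterates_N_le (ω : Ω) :
    ‖θ P.N ω - P.θstar‖ ≤ P.rθ ∧ ‖w P.N ω - P.wstar‖ ≤ P.rw := by
  obtain ⟨m, hm⟩ : ∃ m, P.N = m + 1 := ⟨P.N - 1, by have := h.three_le_N; omega⟩
  have hk : ∃ k : ℕ, 0 < k ∧ m + 1 + 1 = k ^ k := by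
    rw [← hm]
    exact (N_spec (P := P)).2
  refine ⟨(norm_sub_le _ _).trans ?_, (norm_sub_le _ _).trans ?_⟩
  · refine add_le_add ?_ le_rfl
    rw [hm, hθ, sparseProj, if_pos hk]
    exact norm_ballProj_le h.Rθ_pos.le _
  · refine add_le_add ?_ le_rfl
    rw [hm, hw, sparseProj, if_pos hk]
    exact norm_ballProj_le h.Rw_pos.le _

omit hM in
-- Boundedness up to n keeps the noise switched on, so the invariant passes to the unprojected step;
-- its rates show that a projection does nothing, and its absolute bounds give boundedness at n + 1.
lemma inv_of_notMem_noiseEvent {ω : Ω}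
    (hω : ω ∉ ⋃ j : ℕ, P.noiseEvent θ w M₁ M₂ (P.N + 1 + j)) {n : ℕ} (hn : P.N ≤ n) :
    (‖P.noiseθ θ w M₁ M₂ n ω‖ ≤ Real.sqrt P.Vθ * P.ν n P.α ∧
      ‖P.noisew θ w M₂ n ω‖ ≤ Real.sqrt P.Vw * P.ν n P.β) ∧
    P.Inv n (θ n ω - P.θstar) (w n ω - P.wstar) (P.noiseθ θ w M₁ M₂ n ω) (P.noisew θ w M₂ n ω) ∧
      ω ∈ P.bddEvent θ w n := by
  have hnoise : ∀ n, P.N ≤ n → ‖P.noiseθ θ w M₁ M₂ n ω‖ ≤ Real.sqrt P.Vθ * P.ν n P.α ∧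
      ‖P.noisew θ w M₂ n ω‖ ≤ Real.sqrt P.Vw * P.ν n P.β := by
    intro n hn
    rcases hn.eq_or_lt with rfl | hlt
    · rw [noiseθ_N, noisew_N, Pi.zero_apply, norm_zero]
      exact ⟨mul_nonneg (Real.sqrt_nonneg _) (h.ν_pos _ _).le,
        mul_nonneg (Real.sqrt_nonneg _) (h.ν_pos _ _).le⟩
    · obtain ⟨j, rfl⟩ := Nat.exists_eq_add_of_le (Nat.succ_le_of_lt hlt)
      rw [Set.mem_iUnion, not_exists] at hω
      have := hω j
      simp only [noiseEvent, Set.mem_union, Set.mem_ofPred_eq, not_or, not_lt] at this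
      exact this
  refine ⟨hnoise n hn, ?_⟩
  induction n, hn using Nat.le_induction with
  | base =>
    obtain ⟨h1, h2⟩ := h.norm_iterates_N_le hθ hw ω
    obtain ⟨h3, h4⟩ := hnoise P.N le_rfl
    have hI : P.Inv P.N (θ P.N ω - P.θstar) (w P.N ω - P.wstar) (P.noiseθ θ w M₁ M₂ P.N ω)
        (P.noisew θ w M₂ P.N ω) := by
      rw [noiseθ_N, noisew_N]
      exact h.inv_base h1 h2
    refine ⟨hI, le_rfl, fun k hk hk' => ?_⟩
    obtain rfl := le_antisymm hk hk'
    exact ⟨h.norm_t_le le_rfl h3 h4 hI, h.norm_v_le le_rfl h4 hI⟩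
  | succ n hn ih =>
    obtain ⟨hI, hb⟩ := ih
    obtain ⟨h3, h4⟩ := hnoise n hn
    obtain ⟨h3', h4'⟩ := hnoise (n + 1) (by omega)
    have hI' := h.inv_step hn (M₁ := M₁ (n + 1) ω) (M₂ := M₂ (n + 1) ω) h3 h4 hI
    have e1 : P.noiseθ θ w M₁ M₂ (n + 1) ω = P.noiseθ θ w M₁ M₂ n ω -
        step P.α n • act P.X₁ (P.noiseθ θ w M₁ M₂ n ω) +
        step P.α n • (M₁ (n + 1) ω - act P.Y (M₂ (n + 1) ω)) := by
      rw [noiseθ, linRec, ξθ]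
      beta_reduce
      rw [Set.indicator_of_mem hb]
      rfl
    have e2 : P.noisew θ w M₂ (n + 1) ω = P.noisew θ w M₂ n ω -
        step P.β n • act P.W₂ (P.noisew θ w M₂ n ω) + step P.β n • M₂ (n + 1) ω := by
      rw [noisew, linRec, ξw]
      beta_reduce
      rw [Set.indicator_of_mem hb]
      rfl
    rw [← e1, ← e2] at hI'
    have hn1 : P.N ≤ n + 1 := by omega
    have hθ' := hθ n ω
    have hw' := hw n ω
    set x := θ n ω + step P.α n • (P.h₁ (θ n ω) (w n ω) + M₁ (n + 1) ω)
    set y := w n ω + step P.β n • (P.h₂ (θ n ω) (w n ω) + M₂ (n + 1) ω)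
    -- At a projection time after N the bound from the rate is at most `sθ`, so x is in the ball of
    -- radius R_θ around 0.
    have hx : sparseProj (n + 1) P.Rθ x = x := by
      unfold sparseProj
      split_ifs with hk
      · obtain ⟨m, _, hm⟩ := hk
        refine ballProj_eq_self ?_
        have h5 := h.norm_t_le_A₅' hn1 h3' h4' hI'
        have h6 := h.A₅'_mul_ν_le (Nat.lt_succ_of_le hn) hm
        have h7 := norm_le_norm_sub_add x P.θstar
        have h8 : P.A₅' * P.gθ (n + 1) ≤ P.sθ := by
          rw [gθ, ← mul_div_assoc]
          exact (div_le_iff₀ (h.ν_pos _ _)).2 h6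
        unfold sθ at h8
        linarith
      · rfl
    have hy : sparseProj (n + 1) P.Rw y = y := by
      unfold sparseProj
      split_ifs with hk
      · obtain ⟨m, _, hm⟩ := hk
        refine ballProj_eq_self ?_
        have h5 := h.norm_v_le_A₄' h4' hI'
        have h6 := h.A₄'_mul_ν_le (Nat.lt_succ_of_le hn) hm
        have h7 := norm_le_norm_sub_add y P.wstar
        have h8 : P.A₄' * P.gw (n + 1) ≤ P.sw := by
          rw [gw, ← mul_div_assoc]
          exact (div_le_iff₀ (h.ν_pos _ _)).2 h6
        unfold sw at h8
        linarith
      · rfl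
    rw [hx] at hθ'
    rw [hy] at hw'
    rw [← hθ', ← hw'] at hI'
    refine ⟨hI', hn1, fun k hk hk' => ?_⟩
    rcases hk'.eq_or_lt with rfl | hlt
    · exact ⟨h.norm_t_le hn1 h3' h4' hI', h.norm_v_le hn1 h4' hI'⟩
    · exact hb.2 k hk (by omega)

end Valid

end Problem

end TwoTimescale
end

/-! ### Conclusion. -/

theorem theorem1 {d : ℕ} (hd : 0 < d) (P : TwoTimescale.Problem d)
    (hW₂ : TwoTimescale.PosDefNS P.W₂) (hX₁ : TwoTimescale.PosDefNS P.X₁)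
    (hβ : 0 < P.β) (hαβ : P.β < P.α) (hα : P.α < 1)
    (hp : 1 < P.p) (hδ₀ : 0 < P.δ) (hδ₁ : P.δ < 1)
    (hm₁ : 0 < P.m₁) (hm₂ : 0 < P.m₂)
    (hRθ : ‖P.θstar‖ < P.Rθ) (hRw : ‖P.wstar‖ < P.Rw)
    {Ω : Type*} [MeasurableSpace Ω] (μ : MeasureTheory.Measure Ω)
    [MeasureTheory.IsProbabilityMeasure μ]
    (θ w M₁ M₂ : ℕ → Ω → TwoTimescale.E d)
    (hM : TwoTimescale.DominatedMartingaleDiff μ θ w M₁ M₂ P.m₁ P.m₂)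
    (hθ : ∀ n ω, θ (n + 1) ω = TwoTimescale.sparseProj (n + 1) P.Rθ
      (θ n ω + TwoTimescale.step P.α n • (P.h₁ (θ n ω) (w n ω) + M₁ (n + 1) ω)))
    (hw : ∀ n ω, w (n + 1) ω = TwoTimescale.sparseProj (n + 1) P.Rw
      (w n ω + TwoTimescale.step P.β n • (P.h₂ (θ n ω) (w n ω) + M₂ (n + 1) ω))) :
    1 - P.δ < μ.real {ω | ∀ n : ℕ, P.N ≤ n →
      ‖θ n ω - P.θstar‖ ≤ P.Cθ *
        (Real.sqrt (Real.log (4 * (d : ℝ) ^ 2 * ((n : ℝ) + 1) ^ P.p / P.δ)) /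
          ((n : ℝ) + 1) ^ (P.α / 2)) ∧
      ‖w n ω - P.wstar‖ ≤ P.Cw *
        (Real.sqrt (Real.log (4 * (d : ℝ) ^ 2 * ((n : ℝ) + 1) ^ P.p / P.δ)) /
          ((n : ℝ) + 1) ^ (P.β / 2))} := by
  have h : P.Valid := ⟨hd, hW₂, hX₁, hβ, hαβ, hα, hp, hδ₀, hδ₁, hm₁, hm₂, hRθ, hRw⟩
  have hlt := h.measureReal_iUnion_noiseEvent_lt hM hθ hw
  -- Covering the whole space by the rate event and the bad events uses subadditivity only, so
  -- measurability of the rate event is not needed.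
  have hcover := MeasureTheory.measureReal_mono (μ := μ)
    (s₁ := (Set.univ : Set Ω)) (s₂ := {ω | ∀ n : ℕ, P.N ≤ n →
      ‖θ n ω - P.θstar‖ ≤ P.Cθ *
        (Real.sqrt (Real.log (4 * (d : ℝ) ^ 2 * ((n : ℝ) + 1) ^ P.p / P.δ)) /
          ((n : ℝ) + 1) ^ (P.α / 2)) ∧
      ‖w n ω - P.wstar‖ ≤ P.Cw *
        (Real.sqrt (Real.log (4 * (d : ℝ) ^ 2 * ((n : ℝ) + 1) ^ P.p / P.δ)) /
          ((n : ℝ) + 1) ^ (P.β / 2))} ∪ ⋃ j : ℕ, P.noiseEvent θ w M₁ M₂ (P.N + 1 + j)) ?_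
  · have hu := MeasureTheory.measureReal_union_le (μ := μ) {ω | ∀ n : ℕ, P.N ≤ n →
      ‖θ n ω - P.θstar‖ ≤ P.Cθ *
        (Real.sqrt (Real.log (4 * (d : ℝ) ^ 2 * ((n : ℝ) + 1) ^ P.p / P.δ)) /
          ((n : ℝ) + 1) ^ (P.α / 2)) ∧
      ‖w n ω - P.wstar‖ ≤ P.Cw *
        (Real.sqrt (Real.log (4 * (d : ℝ) ^ 2 * ((n : ℝ) + 1) ^ P.p / P.δ)) /
          ((n : ℝ) + 1) ^ (P.β / 2))} (⋃ j : ℕ, P.noiseEvent θ w M₁ M₂ (P.N + 1 + j))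
    rw [MeasureTheory.probReal_univ] at hcover
    linarith
  · intro ω _
    rw [Set.mem_union, or_iff_not_imp_right]
    intro hω n hn
    obtain ⟨⟨h1, h2⟩, hI, -⟩ := h.inv_of_notMem_noiseEvent hθ hw hω hn
    refine ⟨(h.norm_t_le_A₅' hn h1 h2 hI).trans_eq ?_, (h.norm_v_le_A₄' h2 hI).trans_eq ?_⟩
    · rw [TwoTimescale.Problem.gθ, TwoTimescale.Problem.Valid.ν_eq n,
        Real.rpow_neg (by positivity), TwoTimescale.Problem.Cθ, TwoTimescale.Problem.logTerm]
      ring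
    · rw [TwoTimescale.Problem.gw, TwoTimescale.Problem.Valid.ν_eq n,
        Real.rpow_neg (by positivity), TwoTimescale.Problem.Cw, TwoTimescale.Problem.logTerm]
      ring
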